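/- Let $G=\langle a,b,c\mid a^2,b^2,c^2,(ab)^5,(ac)^2,(bc)^5,(abcb)^3\rangle$ be the symmetry group of Bring's surface with its tiling by 12 pentagons. Vertices, edges and faces are the left cosets in $G$ of $\langle b,c\rangle$, $\langle a,c\rangle$ and $\langle a,b\rangle$; two cells are incident if the cosets meet. Bring's code is the $[[30,8,3]]$ CSS code with one qubit on each of the 30 edges, an $X$-check on the edges at each vertex and a $Z$-check on the edges of each face. Number the edges $1,\dots,30$ so that edge $1$ is $\langle a,c\rangle$ and left multiplication by $a,b,c$ acts by $a=(2,3)(4,5)(6,8)(7,9)(10,13)(11,14)(12,15)(16,19)(18,20)(21,26)(22,27)(23,28)(24,29)$, $b=(1,2)(3,6)(4,7)(5,10)(9,16)(11,17)(13,21)(14,22)(15,23)(18,24)(19,26)(20,30)(25,28)$, $c=(2,4)(3,5)(6,11)(7,12)(8,14)(9,15)(10,18)(13,20)(17,25)(21,27)(22,26)(23,29)(24,28)$. Let $b_1,\dots,b_8\in\mathbb F_2^{30}$ be the indicator vectors of $\{1,7,9\}$, $\{2,12,23\}$, $\{3,5,19\}$, $\{10,16,18\}$, $\{21,26,30\}$,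 $\{8,25,28\}$, $\{11,17,29\}$, $\{14,20,27\}$ and $b^1,\dots,b^8$ those of $\{1,6,11\}$, $\{2,8,22\}$, $\{4,5,25\}$, $\{10,13,17\}$, $\{24,28,30\}$, $\{12,19,26\}$, $\{9,16,27\}$, $\{15,20,29\}$. The eight logical qubits have logical $Z$-operators supported on $b_1,\dots,b_5,\ b_2+b_3+b_5+b_6,\ b_1+b_4+b_7,\ b_1+b_4+b_7+b_8$ and logical $X$-operators supported on $b^1,\dots,b^5,\ b^2+b^3+b^5+b^6,\ b^8,\ b^1+b^4+b^7$, in this order; this is a symplectic basis of $\mathcal H_1\oplus\mathcal H^1$. The logical state $|u\rangle$, $u\in\mathbb F_2^8$, is encoded as the uniform superposition of the coset of the logical $X$-support $\sum_iu_i\bar x_i$ modulo the span of the $X$-checks. Let $\tau_0$ be the $ZX$-duality induced by the automorphism of $G$ that exchanges $a,c$ and fixes $b$; on edges $\tau_0(g\langle a,c\rangle)=\tau_0(g)\langle a,c\rangle$. Let $\sigma_a,\sigma_b,\sigma_c$ be the qubit permutations of $a,b,c$, let $H_{\tau_0}=\prod_{i<\tau_0(i)}\mathrm{SWAP}_{i,\tau_0(i)}\prod_iH_i$,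 and let $S_{\tau_0}=\prod_{\tau_0(i)=i}S_i^{(\dagger)}\prod_{i<\tau_0(i)}\mathrm{CZ}_{i,\tau_0(i)}$, with a choice of $S_i$ or $S_i^\dagger$ at each fixed point of $\tau_0$. Write $\tilde U\in\mathrm{Sp}_{16}(\mathbb F_2)$ for the symplectic image of a logical Clifford operator $U$, that is, its action by conjugation on the eight-qubit logical Pauli operators up to phase. Let $\mathcal C_8$ be the Clifford group, the normalizer of the Pauli group $\mathcal P_8$ in the unitary group of eight qubits. Then some choice makes $S_{\tau_0}$ an encoded logical gate (it preserves the code space), and for every such choice the following holds. 1. Let $g$ be one logical gate of the form $\mathrm{CNOT}_{ij}$ for any ordered pair $i\ne j$ of logical qubits, or $\mathrm{CZ}_{ij}$ for any pair $i\neq j$ with $\{i,j\}\notin\{\{1,5\},\{3,4\},\{6,8\}\}$. Then $\tilde\sigma_a,\tilde\sigma_b,\tilde\sigma_c,\tilde H_{\tau_0},\tilde S_{\tau_0},\tilde g$ generate $\mathrm{Sp}_{16}(\mathbb F_2)$. Hence the logical operators implemented by $\sigma_a,\sigma_b,\sigma_c,H_{\tau_0},S_{\tau_0}$, together with $g$,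 the Pauli operators and the global phases, generate the full logical Clifford group $\mathcal C_8$. 2. For $\{i,j\}\in\{\{1,5\},\{3,4\},\{6,8\}\}$, the elements $\tilde\sigma_a,\tilde\sigma_b,\tilde\sigma_c,\tilde H_{\tau_0},\tilde S_{\tau_0},\widetilde{\mathrm{CZ}}_{ij}$ do not generate $\mathrm{Sp}_{16}(\mathbb F_2)$. -/

import Mathlib

open scoped Matrix

namespace BringCode

/-! ### Pauli operators, Clifford group and gates on a finite set `ι` of qubits

The computational basis of the state space is indexed by `ι → ZMod 2`. -/

section Qubits

variable {ι : Type*} [Fintype ι] [DecidableEq ι]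

/-- The operators on the qubits `ι`, written in the computational basis. -/
abbrev Operator (ι : Type*) : Type _ := Matrix (ι → ZMod 2) (ι → ZMod 2) ℂ

/-- The group of unitary operators on the qubits `ι`. -/
abbrev UnitaryOp (ι : Type*) [Fintype ι] [DecidableEq ι] : Type _ :=
  Matrix.unitaryGroup (ι → ZMod 2) ℂ

/-- The sign `(-1) ^ t` of a bit `t`. -/
def sgn (t : ZMod 2) : ℂ := (-1) ^ t.val

/-- The Pauli operator `X^x Z^z`, which sends `|v⟩` to `(-1)^(z·v) |v + x⟩`. -/
def pauli (x z : ι → ZMod 2) : Operator ι :=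
  Matrix.of fun u v => if u = v + x then sgn (z ⬝ᵥ v) else 0

/-- The Pauli group: generated by the operators `X^x Z^z` and the scalar `i`. -/
def pauliGroup (ι : Type*) [Fintype ι] [DecidableEq ι] : Subgroup (UnitaryOp ι) :=
  Subgroup.closure {U | (∃ x z : ι → ZMod 2, (U : Operator ι) = pauli x z) ∨
    (U : Operator ι) = Complex.I • (1 : Operator ι)}

/-- Global phases. -/
def phaseGroup (ι : Type*) [Fintype ι] [DecidableEq ι] : Subgroup (UnitaryOp ι) :=
  Subgroup.closure {U | ∃ c : ℂ, (U : Operator ι) = c • (1 : Operator ι)}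

/-- The Clifford group: the normalizer of the Pauli group in the unitary group. -/
def cliffordGroup (ι : Type*) [Fintype ι] [DecidableEq ι] : Subgroup (UnitaryOp ι) :=
  Subgroup.normalizer (pauliGroup ι : Set (UnitaryOp ι))

/-- The qubit permutation that moves qubit `i` to position `σ i`. -/
def permGate (σ : Equiv.Perm ι) : Operator ι :=
  Matrix.of fun u v => if ∀ i, u (σ i) = v i then 1 else 0

/-- A Hadamard gate on every qubit. -/
noncomputable def hadamardAll (ι : Type*) [Fintype ι] : Operator ι :=
  Matrix.of fun u v => ((Real.sqrt 2 : ℂ)⁻¹) ^ Fintype.card ι * sgn (u ⬝ᵥ v)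

/-- The Hadamard-type gate of a self-inverse `τ`: Hadamards on all qubits, then swaps
of all pairs `i < τ i`; for `τ * τ = 1` these swaps together permute the qubits by `τ`. -/
noncomputable def hadamardGate (τ : Equiv.Perm ι) : Operator ι :=
  permGate τ * hadamardAll ι

/-- The phase-type gate of a self-inverse `τ`: a controlled-Z on each pair `i < τ i`, and on each
fixed point `i` of `τ` the gate `S` if `i ∈ A` and its adjoint if `i ∉ A`. -/
noncomputable def phaseGate [LinearOrder ι] (τ : Equiv.Perm ι) (A : Finset ι) : Operator ι :=
  Matrix.diagonal fun v =>
    (∏ i with τ i = i, (if i ∈ A then Complex.I else -Complex.I) ^ (v i).val) *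
      ∏ i with i < τ i, sgn (v i * v (τ i))

/-- The controlled-NOT with control `i` and target `j`. -/
def cnot (i j : ι) : Operator ι :=
  Matrix.of fun u v => if u = v + Pi.single j (v i) then 1 else 0

/-- The controlled-Z on the qubits `i` and `j`. -/
def cz (i j : ι) : Operator ι :=
  Matrix.diagonal fun v => sgn (v i * v j)

/-- `M` is the symplectic image of `U`: conjugation by `U` maps the Pauli operator with exponent
vector `v` to a multiple of the one with exponent vector `M v`. The left half of a vector
holds the exponents of `Z`, the right half those of `X`. -/
def IsSymplecticImage (U : UnitaryOp ι) (M : Matrix.symplecticGroup ι (ZMod 2)) : Prop :=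
  ∀ v : ι ⊕ ι → ZMod 2, ∃ c : ℂ,
    (U : Operator ι) * pauli (v ∘ Sum.inr) (v ∘ Sum.inl) * (U : Operator ι)ᴴ =
      c • pauli (((M : Matrix (ι ⊕ ι) (ι ⊕ ι) (ZMod 2)) *ᵥ v) ∘ Sum.inr)
        (((M : Matrix (ι ⊕ ι) (ι ⊕ ι) (ZMod 2)) *ᵥ v) ∘ Sum.inl)

/-- The symplectic images of the members of a set of unitary operators. -/
def symplecticImages (S : Set (UnitaryOp ι)) : Set (Matrix.symplecticGroup ι (ZMod 2)) :=
  {M | ∃ U ∈ S, IsSymplecticImage U M}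

end Qubits

/-! ### The symmetry group of Bring's surface and its action on the 30 edges -/

/-- The three generating reflections of the `{5,5}`-tiling. They move, respectively, the vertex,
the edge and the face of the base flag and fix its other two cells. -/
inductive Mirror
  | a
  | b
  | c

open Mirror

/-- The Coxeter relations of the `{5,5}`-tiling and the relation `(abcb)^3`. -/
def relators : Set (FreeGroup Mirror) :=
  {FreeGroup.of a ^ 2, FreeGroup.of b ^ 2, FreeGroup.of c ^ 2,
    (FreeGroup.of a * FreeGroup.of b) ^ 5, (FreeGroup.of a * FreeGroup.of c) ^ 2,
    (FreeGroup.of b * FreeGroup.of c) ^ 5,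
    (FreeGroup.of a * FreeGroup.of b * FreeGroup.of c * FreeGroup.of b) ^ 3}

/-- The symmetry group of Bring's surface with its tiling by 12 pentagons. -/
abbrev SymGroup : Type := PresentedGroup relators

/-- The generating reflections as symmetries of the surface. -/
def mirror (t : Mirror) : SymGroup := PresentedGroup.of t

/-- Vertices: cosets of the stabilizer of the base vertex. -/
abbrev Vertex : Type := SymGroup ⧸ Subgroup.closure {mirror b, mirror c}

/-- Edges: cosets of the stabilizer of the base edge. -/
abbrev Edge : Type := SymGroup ⧸ Subgroup.closure {mirror a, mirror c}

/-- Faces: cosets of the stabilizer of the base face. -/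
abbrev Face : Type := SymGroup ⧸ Subgroup.closure {mirror a, mirror b}

/-- Two cells are incident if their cosets meet. -/
def Incident {H K : Subgroup SymGroup} (P : SymGroup ⧸ H) (Q : SymGroup ⧸ K) : Prop :=
  ∃ g : SymGroup, (g : SymGroup ⧸ H) = P ∧ (g : SymGroup ⧸ K) = Q

/-- Words for representatives of the 30 edges. -/
def edgeWord : Fin 30 → List Mirror :=
    ![[], [b], [a, b], [c, b], [c, a, b], [b, a, b], [b, c, b], [a, b, a, b], [a, b, c, b], [b,
    c, a, b], [c, b, a, b], [c, b, c, b], [a, b, c, a, b], [c, a, b, a, b], [c, a, b, c, b], [b,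
    a, b, c, b], [b, c, b, a, b], [c, b, c, a, b], [a, b, a, b, c, b], [c, a, b, c, a, b], [b,
    a, b, c, a, b], [b, c, a, b, a, b], [b, c, a, b, c, b], [b, c, b, c, a, b], [c, b, c, b, a,
    b], [c, b, c, a, b, a, b], [a, b, c, a, b, a, b], [b, c, b, c, b, a, b], [a, b, c, b, c, a,
    b], [b, c, a, b, c, a, b]]

/-- The edge that carries the qubit `i`. -/
def edge (i : Fin 30) : Edge :=
  (edgeWord i).foldr (fun t e => mirror t • e) ((1 : SymGroup) : Edge)

/-- The reflections as permutations of the edge numbers. -/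
def edgeTable : Mirror → Fin 30 → Fin 30
  | a => ![0, 2, 1, 4, 3, 7, 8, 5, 6, 12, 13, 14, 9, 10, 11, 18, 16, 19, 15, 17, 25, 26, 27, 28, 24, 20, 21, 22, 23, 29]
  | b => ![1, 0, 5, 6, 9, 2, 3, 7, 15, 4, 16, 11, 20, 21, 22, 8, 10, 23, 25, 29, 12, 13, 14, 17, 27, 18, 26, 24, 28, 19]
  | c => ![0, 3, 4, 1, 2, 10, 11, 13, 14, 17, 5, 6, 19, 7, 8, 15, 24, 9, 18, 12, 26, 25, 28, 27, 16, 21, 20, 23, 22, 29]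

/-- The reflections as permutations of the edge numbers. -/
def edgePerm (t : Mirror) : Equiv.Perm (Fin 30) :=
  Function.Involutive.toPerm (edgeTable t) (by cases t <;> unfold Function.Involutive <;> decide)

theorem relators_perm : ∀ r ∈ relators, FreeGroup.lift edgePerm r = 1 := by
  intro r hr
  simp only [relators, Set.mem_insert_iff, Set.mem_singleton_iff] at hr
  rcases hr with rfl | rfl | rfl | rfl | rfl | rfl | rfl <;>
    simp only [map_pow, map_mul, FreeGroup.lift_apply_of] <;> decide

/-- The action of the symmetry group on the edge numbers. -/
def permHom : SymGroup →* Equiv.Perm (Fin 30) := PresentedGroup.toGroup relators_perm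

theorem permHom_mirror (t : Mirror) : permHom (mirror t) = edgePerm t :=
  PresentedGroup.toGroup.of relators_perm

theorem word_eq_one {w : FreeGroup Mirror} (h : w ∈ relators) :
    (PresentedGroup.mk relators w) = 1 := PresentedGroup.one_of_mem h

theorem mirror_sq (t : Mirror) : mirror t * mirror t = 1 := by
  have h : PresentedGroup.mk relators (FreeGroup.of t ^ 2) = 1 :=
    word_eq_one (by cases t <;> simp [relators])
  rwa [map_pow, pow_two] at h

theorem mirror_inv (t : Mirror) : (mirror t)⁻¹ = mirror t :=
  inv_eq_of_mul_eq_one_left (mirror_sq t)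

theorem pow_ab : (mirror a * mirror b) ^ 5 = 1 := by
  have h : PresentedGroup.mk relators ((FreeGroup.of a * FreeGroup.of b) ^ 5) = 1 :=
    word_eq_one (by simp [relators])
  rwa [map_pow, map_mul] at h

theorem pow_ac : (mirror a * mirror c) ^ 2 = 1 := by
  have h : PresentedGroup.mk relators ((FreeGroup.of a * FreeGroup.of c) ^ 2) = 1 :=
    word_eq_one (by simp [relators])
  rwa [map_pow, map_mul] at h

theorem pow_bc : (mirror b * mirror c) ^ 5 = 1 := by
  have h : PresentedGroup.mk relators ((FreeGroup.of b * FreeGroup.of c) ^ 5) = 1 :=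
    word_eq_one (by simp [relators])
  rwa [map_pow, map_mul] at h

theorem pow_abcb : (mirror a * mirror b * mirror c * mirror b) ^ 3 = 1 := by
  have h : PresentedGroup.mk relators
      ((FreeGroup.of a * FreeGroup.of b * FreeGroup.of c * FreeGroup.of b) ^ 3) = 1 :=
    word_eq_one (by simp [relators])
  rwa [map_pow, map_mul, map_mul, map_mul] at h

theorem pow_rotate {G : Type*} [Group G] {x y : G} {n : ℕ} (h : (x * y) ^ n = 1) :
    (y * x) ^ n = 1 := by
  have h1 : y * x = x⁻¹ * (x * y) * x⁻¹⁻¹ := by simp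
  rw [h1, conj_pow, h]
  simp

theorem pow_ba : (mirror b * mirror a) ^ 5 = 1 := pow_rotate pow_ab

theorem pow_ca : (mirror c * mirror a) ^ 2 = 1 := pow_rotate pow_ac

theorem pow_cb : (mirror c * mirror b) ^ 5 = 1 := pow_rotate pow_bc

theorem pow_bcba : (mirror b * mirror c * mirror b * mirror a) ^ 3 = 1 := by
  have h := pow_abcb
  rw [mul_assoc, mul_assoc] at h
  simpa only [mul_assoc] using pow_rotate h

theorem pow_cbab : (mirror c * mirror b * mirror a * mirror b) ^ 3 = 1 := by
  have h := pow_bcba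
  rw [mul_assoc, mul_assoc] at h
  simpa only [mul_assoc] using pow_rotate h

theorem pow_babc : (mirror b * mirror a * mirror b * mirror c) ^ 3 = 1 := by
  have h := pow_cbab
  rw [mul_assoc, mul_assoc] at h
  simpa only [mul_assoc] using pow_rotate h

/-- The mirrors permute the edges according to the table. -/
theorem mirror_smul_edge (t : Mirror) (i : Fin 30) :
    mirror t • edge i = edge (edgePerm t i) := by
  have invol (t : Mirror) (e : Edge) : mirror t • mirror t • e = e := by
    rw [← mul_smul, mirror_sq, one_smul]
  have base_a : mirror a • edge 0 = edge 0 := by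
    change ((mirror a * 1 : SymGroup) : Edge) = ((1 : SymGroup) : Edge)
    rw [eq_comm, QuotientGroup.eq]
    simpa using Subgroup.subset_closure (by simp)
  have base_c : mirror c • edge 0 = edge 0 := by
    change ((mirror c * 1 : SymGroup) : Edge) = ((1 : SymGroup) : Edge)
    rw [eq_comm, QuotientGroup.eq]
    simpa using Subgroup.subset_closure (by simp)
  have two {x y : Mirror} (h : (mirror x * mirror y) ^ 2 = 1) (e : Edge) :
      mirror x • mirror y • mirror x • mirror y • e = e := by
    have := congrArg (fun g : SymGroup => g • e) h
    simpa only [pow_succ, pow_zero, one_mul, mul_smul, one_smul] using this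
  have five {x y : Mirror} (h : (mirror x * mirror y) ^ 5 = 1) (e : Edge) :
      mirror x • mirror y • mirror x • mirror y • mirror x • mirror y • mirror x • mirror y •
        mirror x • mirror y • e = e := by
    have := congrArg (fun g : SymGroup => g • e) h
    simpa only [pow_succ, pow_zero, one_mul, mul_smul, one_smul] using this
  have three {x y z w : Mirror} (h : (mirror x * mirror y * mirror z * mirror w) ^ 3 = 1)
      (e : Edge) :
      mirror x • mirror y • mirror z • mirror w • mirror x • mirror y • mirror z • mirror w •
        mirror x • mirror y • mirror z • mirror w • e = e := by
    have := congrArg (fun g : SymGroup => g • e) h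
    simpa only [pow_succ, pow_zero, one_mul, mul_smul, one_smul] using this
  have b1 : mirror b • edge 0 = edge 1 := rfl
  have b2 : mirror b • edge 1 = edge 0 := by rw [← b1, invol]
  have a2 : mirror a • edge 1 = edge 2 := rfl
  have a3 : mirror a • edge 2 = edge 1 := by rw [← a2, invol]
  have c2 : mirror c • edge 1 = edge 3 := rfl
  have c4 : mirror c • edge 3 = edge 1 := by rw [← c2, invol]
  have b3 : mirror b • edge 2 = edge 5 := rfl
  have b6 : mirror b • edge 5 = edge 2 := by rw [← b3, invol]
  have c3 : mirror c • edge 2 = edge 4 := rfl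
  have c5 : mirror c • edge 4 = edge 2 := by rw [← c3, invol]
  have b4 : mirror b • edge 3 = edge 6 := rfl
  have b7 : mirror b • edge 6 = edge 3 := by rw [← b4, invol]
  have a6 : mirror a • edge 5 = edge 7 := rfl
  have a8 : mirror a • edge 7 = edge 5 := by rw [← a6, invol]
  have c6 : mirror c • edge 5 = edge 10 := rfl
  have c11 : mirror c • edge 10 = edge 5 := by rw [← c6, invol]
  have b5 : mirror b • edge 4 = edge 9 := rfl
  have b10 : mirror b • edge 9 = edge 4 := by rw [← b5, invol]
  have a7 : mirror a • edge 6 = edge 8 := rfl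
  have a9 : mirror a • edge 8 = edge 6 := by rw [← a7, invol]
  have c7 : mirror c • edge 6 = edge 11 := rfl
  have c12 : mirror c • edge 11 = edge 6 := by rw [← c7, invol]
  have c8 : mirror c • edge 7 = edge 13 := rfl
  have c14 : mirror c • edge 13 = edge 7 := by rw [← c8, invol]
  have b11 : mirror b • edge 10 = edge 16 := rfl
  have b17 : mirror b • edge 16 = edge 10 := by rw [← b11, invol]
  have a10 : mirror a • edge 9 = edge 12 := rfl
  have a13 : mirror a • edge 12 = edge 9 := by rw [← a10, invol]
  have c10 : mirror c • edge 9 = edge 17 := rfl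
  have c18 : mirror c • edge 17 = edge 9 := by rw [← c10, invol]
  have b9 : mirror b • edge 8 = edge 15 := rfl
  have b16 : mirror b • edge 15 = edge 8 := by rw [← b9, invol]
  have c9 : mirror c • edge 8 = edge 14 := rfl
  have c15 : mirror c • edge 14 = edge 8 := by rw [← c9, invol]
  have b14 : mirror b • edge 13 = edge 21 := rfl
  have b22 : mirror b • edge 21 = edge 13 := by rw [← b14, invol]
  have c17 : mirror c • edge 16 = edge 24 := rfl
  have c25 : mirror c • edge 24 = edge 16 := by rw [← c17, invol]
  have b13 : mirror b • edge 12 = edge 20 := rfl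
  have b21 : mirror b • edge 20 = edge 12 := by rw [← b13, invol]
  have c13 : mirror c • edge 12 = edge 19 := rfl
  have c20 : mirror c • edge 19 = edge 12 := by rw [← c13, invol]
  have b18 : mirror b • edge 17 = edge 23 := rfl
  have b24 : mirror b • edge 23 = edge 17 := by rw [← b18, invol]
  have a16 : mirror a • edge 15 = edge 18 := rfl
  have a19 : mirror a • edge 18 = edge 15 := by rw [← a16, invol]
  have b15 : mirror b • edge 14 = edge 22 := rfl
  have b23 : mirror b • edge 22 = edge 14 := by rw [← b15, invol]
  have a22 : mirror a • edge 21 = edge 26 := rfl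
  have a27 : mirror a • edge 26 = edge 21 := by rw [← a22, invol]
  have c22 : mirror c • edge 21 = edge 25 := rfl
  have c26 : mirror c • edge 25 = edge 21 := by rw [← c22, invol]
  have b25 : mirror b • edge 24 = edge 27 := rfl
  have b28 : mirror b • edge 27 = edge 24 := by rw [← b25, invol]
  have b20 : mirror b • edge 19 = edge 29 := rfl
  have b30 : mirror b • edge 29 = edge 19 := by rw [← b20, invol]
  have a24 : mirror a • edge 23 = edge 28 := rfl
  have a29 : mirror a • edge 28 = edge 23 := by rw [← a24, invol]
  have a1 : mirror a • edge 0 = edge 0 := base_a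
  have c1 : mirror c • edge 0 = edge 0 := base_c
  have a5 : mirror a • edge 4 = edge 3 := by
    simpa only [c4, a2, c3] using two pow_ac (edge 3)
  have a4 : mirror a • edge 3 = edge 4 := by rw [← a5, invol]
  have a14 : mirror a • edge 13 = edge 10 := by
    simpa only [c11, a6, c8] using two pow_ac (edge 10)
  have a11 : mirror a • edge 10 = edge 13 := by rw [← a14, invol]
  have a15 : mirror a • edge 14 = edge 11 := by
    simpa only [c12, a7, c9] using two pow_ac (edge 11)
  have a12 : mirror a • edge 11 = edge 14 := by rw [← a15, invol]
  have a20 : mirror a • edge 19 = edge 17 := by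
    simpa only [c18, a10, c13] using two pow_ac (edge 17)
  have a18 : mirror a • edge 17 = edge 19 := by rw [← a20, invol]
  have b8 : mirror b • edge 7 = edge 7 := by
    simpa only [a8, b6, a3, b2, a1, b1, a2, b3, a6] using five pow_ba (edge 7)
  have b12 : mirror b • edge 11 = edge 11 := by
    simpa only [c12, b7, c4, b2, c1, b1, c2, b4, c7] using five pow_bc (edge 11)
  have c28 : mirror c • edge 27 = edge 23 := by
    simpa only [b24, c18, b10, c5, b3, c6, b11, c17, b25] using five pow_cb (edge 23)
  have c24 : mirror c • edge 23 = edge 27 := by rw [← c28, invol]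
  have a17 : mirror a • edge 16 = edge 16 := by
    simpa only [b17, c11, b6, a3, b2, c1, b1, a2, b3, c6, b11] using three pow_abcb (edge 16)
  have c16 : mirror c • edge 15 = edge 15 := by
    simpa only [b16, a9, b7, c4, b2, a1, b1, c2, b4, a7, b9] using three pow_cbab (edge 15)
  have a25 : mirror a • edge 24 = edge 24 := by
    simpa only [c25, a17, c17] using two pow_ac (edge 24)
  have c19 : mirror c • edge 18 = edge 18 := by
    simpa only [a19, c16, a16] using two pow_ca (edge 18)
  have b27 : mirror b • edge 26 = edge 26 := by
    simpa only [a27, b22, a14, b11, a17, b17, a11, b14, a22] using five pow_ba (edge 26)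
  have c27 : mirror c • edge 26 = edge 20 := by
    simpa only [b21, a13, b10, c5, b3, a6, b8, c8, b14, a22, b27] using three pow_cbab (edge 20)
  have c21 : mirror c • edge 20 = edge 26 := by rw [← c27, invol]
  have c30 : mirror c • edge 29 = edge 29 := by
    simpa only [b30, a20, b18, c24, b28, a25, b25, c28, b24, a18, b20] using three pow_cbab (edge 29)
  have a26 : mirror a • edge 25 = edge 20 := by
    simpa only [c21, a27, c22] using two pow_ac (edge 20)
  have a21 : mirror a • edge 20 = edge 25 := by rw [← a26, invol]
  have b26 : mirror b • edge 25 = edge 18 := by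
    simpa only [a19, b16, a9, b7, a4, b5, a10, b13, a21] using five pow_ba (edge 18)
  have b19 : mirror b • edge 18 = edge 25 := by rw [← b26, invol]
  have a28 : mirror a • edge 27 = edge 22 := by
    simpa only [b23, c15, b9, a16, b19, c26, b22, a14, b11, c17, b25] using three pow_abcb (edge 22)
  have a23 : mirror a • edge 22 = edge 27 := by rw [← a28, invol]
  have a30 : mirror a • edge 29 = edge 29 := by
    simpa only [b30, c20, b13, a21, b26, c19, b19, a26, b21, c13, b20] using three pow_abcb (edge 29)
  have c29 : mirror c • edge 28 = edge 22 := by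
    simpa only [a23, c28, a24] using two pow_ca (edge 22)
  have c23 : mirror c • edge 22 = edge 28 := by rw [← c29, invol]
  have b29 : mirror b • edge 28 = edge 28 := by
    simpa only [a29, b24, a18, b20, a30, b30, a20, b18, a24] using five pow_ba (edge 28)
  cases t
  · fin_cases i
    exacts [a1, a2, a3, a4, a5, a6, a7, a8, a9, a10, a11, a12, a13, a14, a15,
      a16, a17, a18, a19, a20, a21, a22, a23, a24, a25, a26, a27, a28, a29, a30]
  · fin_cases i
    exacts [b1, b2, b3, b4, b5, b6, b7, b8, b9, b10, b11, b12, b13, b14, b15,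
      b16, b17, b18, b19, b20, b21, b22, b23, b24, b25, b26, b27, b28, b29, b30]
  · fin_cases i
    exacts [c1, c2, c3, c4, c5, c6, c7, c8, c9, c10, c11, c12, c13, c14, c15,
      c16, c17, c18, c19, c20, c21, c22, c23, c24, c25, c26, c27, c28, c29, c30]

theorem permHom_edge (g : SymGroup) (i : Fin 30) : g • edge i = edge (permHom g i) := by
  have hg : g ∈ Subgroup.closure (Set.range mirror) := by
    have h := PresentedGroup.closure_range_of relators
    change Subgroup.closure (Set.range mirror) = ⊤ at h
    rw [h]
    trivial
  induction hg using Subgroup.closure_induction generalizing i with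
  | mem x hx =>
    obtain ⟨t, rfl⟩ := hx
    rw [mirror_smul_edge, permHom_mirror]
  | one => simp
  | mul x y _ _ hx hy => rw [mul_smul, hy, hx, map_mul, Equiv.Perm.mul_apply]
  | inv x _ hx => rw [inv_smul_eq_iff, hx, ← Equiv.Perm.mul_apply, ← map_mul]; simp

/-- Each edge carries exactly one qubit. -/
theorem edge_bijective : Function.Bijective edge := by
  constructor
  · have key : ∀ g : SymGroup, (g : Edge) = ((1 : SymGroup) : Edge) → permHom g 0 = 0 := by
      intro g hg
      rw [eq_comm, QuotientGroup.eq] at hg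
      simp only [inv_one, one_mul] at hg
      induction hg using Subgroup.closure_induction with
      | mem x hx =>
        rcases hx with rfl | rfl <;> rw [permHom_mirror] <;> decide
      | one => simp
      | mul x y _ _ hx hy => rw [map_mul, Equiv.Perm.mul_apply, hy, hx]
      | inv x _ hx => rw [map_inv, Equiv.Perm.inv_eq_iff_eq, hx]
    have word (i : Fin 30) : ∃ g : SymGroup, permHom g 0 = i ∧ (g : Edge) = edge i := by
      refine ⟨((edgeWord i).map mirror).prod, ?_, ?_⟩
      · have h : permHom ((edgeWord i).map mirror).prod = ((edgeWord i).map edgePerm).prod := by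
          rw [map_list_prod, List.map_map]
          congr 1
        rw [h]
        revert i
        decide
      · unfold edge
        generalize edgeWord i = l
        induction l with
        | nil => rfl
        | cons t l ih => rw [List.map_cons, List.prod_cons, List.foldr_cons, ← ih]; rfl
    intro i j hij
    obtain ⟨g, hg, hg'⟩ := word i
    obtain ⟨h, hh, hh'⟩ := word j
    have e : ((h⁻¹ * g : SymGroup) : Edge) = ((1 : SymGroup) : Edge) := by
      rw [eq_comm, QuotientGroup.eq]
      have := hh'.trans (hij.symm.trans hg'.symm)
      rw [QuotientGroup.eq] at this
      simpa using this
    have := key _ e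
    rw [map_mul, map_inv, Equiv.Perm.mul_apply, Equiv.Perm.inv_eq_iff_eq, hg, hh] at this
    exact this
  · intro e
    obtain ⟨g, rfl⟩ := QuotientGroup.mk_surjective e
    refine ⟨permHom g 0, ?_⟩
    rw [← permHom_edge]
    change ((g * 1 : SymGroup) : Edge) = _
    rw [mul_one]

/-- The numbering of the edges by the qubits. -/
noncomputable def edgeEquiv : Fin 30 ≃ Edge := Equiv.ofBijective edge edge_bijective

/-- The permutation of the qubits by which a symmetry of the surface acts on the edges. -/
noncomputable def qubitPerm (g : SymGroup) : Equiv.Perm (Fin 30) :=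
  edgeEquiv.symm.permCongr (MulAction.toPerm g)

/-! ### The duality `τ₀`

The `{5,5}`-tiling sits in the finer `{5,4}`-tiling, whose reflection `f` fixes the base edge,
and conjugation by `f` exchanges `a` and `c` and fixes `b`. Hence `f` maps the cell `g H` to the
cell `(f g f⁻¹) (f H f⁻¹)`, exchanging vertices with faces and mapping edges to edges. -/

/-- The action of conjugation by `f` on the three reflections. -/
def foldMirror : Mirror → Mirror
  | a => c
  | b => b
  | c => a

theorem relators_fold :
    ∀ r ∈ relators, FreeGroup.lift (fun t => mirror (foldMirror t)) r = 1 := by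
  intro r hr
  simp only [relators, Set.mem_insert_iff, Set.mem_singleton_iff] at hr
  rcases hr with rfl | rfl | rfl | rfl | rfl | rfl | rfl <;>
    simp only [map_pow, map_mul, FreeGroup.lift_apply_of, foldMirror]
  · rw [pow_two, mirror_sq]
  · rw [pow_two, mirror_sq]
  · rw [pow_two, mirror_sq]
  · exact pow_cb
  · exact pow_ca
  · exact pow_ba
  · exact pow_cbab

/-- Conjugation by `f`, as an endomorphism of the symmetry group. -/
def foldHom : SymGroup →* SymGroup := PresentedGroup.toGroup relators_fold

theorem foldHom_mirror (t : Mirror) : foldHom (mirror t) = mirror (foldMirror t) :=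
  PresentedGroup.toGroup.of relators_fold

theorem foldHom_foldHom (g : SymGroup) : foldHom (foldHom g) = g := by
  have h : foldHom.comp foldHom = MonoidHom.id SymGroup :=
    PresentedGroup.ext fun t => by
      change foldHom (foldHom (mirror t)) = mirror t
      rw [foldHom_mirror, foldHom_mirror]
      cases t <;> rfl
  exact DFunLike.congr_fun h g

theorem foldHom_stabilizer {g : SymGroup}
    (hg : g ∈ Subgroup.closure {mirror a, mirror c}) :
    foldHom g ∈ Subgroup.closure {mirror a, mirror c} := by
  induction hg using Subgroup.closure_induction with
  | mem x hx =>
    rcases hx with rfl | rfl <;> rw [foldHom_mirror] <;>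
      exact Subgroup.subset_closure (by simp [foldMirror])
  | one => simp
  | mul x y _ _ hx hy => rw [map_mul]; exact mul_mem hx hy
  | inv x _ hx => rw [map_inv]; exact inv_mem hx

/-- The action of `f` on the edges. -/
def foldEdge : Edge → Edge :=
  Quotient.map' foldHom fun g h hgh => by
    rw [QuotientGroup.leftRel_apply] at hgh ⊢
    simpa using foldHom_stabilizer hgh

theorem foldEdge_involutive : Function.Involutive foldEdge := by
  intro e
  obtain ⟨g, rfl⟩ := QuotientGroup.mk_surjective e
  exact congrArg QuotientGroup.mk (foldHom_foldHom g)

/-- The duality `τ₀`, as a permutation of the qubits. -/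
noncomputable def tau0 : Equiv.Perm (Fin 30) :=
  edgeEquiv.symm.permCongr foldEdge_involutive.toPerm

/-! ### Bring's code -/

open Classical in
/-- The support of the `X`-check of a vertex. -/
noncomputable def xCheck (P : Vertex) : Fin 30 → ZMod 2 :=
  fun i => if Incident P (edge i) then 1 else 0

open Classical in
/-- The support of the `Z`-check of a face. -/
noncomputable def zCheck (P : Face) : Fin 30 → ZMod 2 :=
  fun i => if Incident P (edge i) then 1 else 0

/-- The code space: the joint `+1`-eigenspace of all checks. -/
def codeSpace : Set ((Fin 30 → ZMod 2) → ℂ) :=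
  {ψ | (∀ P : Vertex, pauli (xCheck P) 0 *ᵥ ψ = ψ) ∧ ∀ P : Face, pauli 0 (zCheck P) *ᵥ ψ = ψ}

/-- An encoded logical gate maps the code space into itself; for a unitary `W` this says that `W`
commutes with the projector onto the code space. -/
def IsEncodedLogicalGate (W : Operator (Fin 30)) : Prop :=
  ∀ ψ ∈ codeSpace, W *ᵥ ψ ∈ codeSpace

/-- The chain whose support consists of the edges with numbers (counted from 1) in `s`. -/
def chain (s : List ℕ) : Fin 30 → ZMod 2 := fun i => if (i : ℕ) + 1 ∈ s then 1 else 0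

/-- A basis of the first homology group, by essential cycles of length three. -/
def cycles : Fin 8 → Fin 30 → ZMod 2 :=
  ![chain [1, 7, 9], chain [2, 12, 23], chain [3, 5, 19], chain [10, 16, 18],
    chain [21, 26, 30], chain [8, 25, 28], chain [11, 17, 29], chain [14, 20, 27]]

/-- A basis of the first cohomology group; `tau0` exchanges it with `cycles`. -/
def cocycles : Fin 8 → Fin 30 → ZMod 2 :=
  ![chain [1, 6, 11], chain [2, 8, 22], chain [4, 5, 25], chain [10, 13, 17],
    chain [24, 28, 30], chain [12, 19, 26], chain [9, 16, 27], chain [15, 20, 29]]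

/-- The supports of the logical `Z`-operators of the eight logical qubits. -/
def logicalZ : Fin 8 → Fin 30 → ZMod 2 :=
  ![cycles 0, cycles 1, cycles 2, cycles 3, cycles 4,
    cycles 1 + cycles 2 + cycles 4 + cycles 5,
    cycles 0 + cycles 3 + cycles 6,
    cycles 0 + cycles 3 + cycles 6 + cycles 7]

/-- The supports of the logical `X`-operators of the eight logical qubits. Together with `logicalZ`
this is a symplectic basis: `logicalX i` and `logicalZ j` overlap oddly exactly if `i = j`. -/
def logicalX : Fin 8 → Fin 30 → ZMod 2 :=
  ![cocycles 0, cocycles 1, cocycles 2, cocycles 3, cocycles 4,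
    cocycles 1 + cocycles 2 + cocycles 4 + cocycles 5,
    cocycles 7,
    cocycles 0 + cocycles 3 + cocycles 6]

theorem logicalX_dot_logicalZ (i j : Fin 8) :
    logicalX i ⬝ᵥ logicalZ j = if i = j then 1 else 0 := by
  revert i j
  decide +kernel

/-- The space of coboundaries, spanned by the `X`-checks. -/
noncomputable def coboundaries : Submodule (ZMod 2) (Fin 30 → ZMod 2) :=
  Submodule.span (ZMod 2) (Set.range xCheck)

open Classical in
/-- The encoding isometry: the logical basis state `|u⟩` is encoded as the normalized sum of
the states `|w⟩` with `w` in the coset of `∑ i, u i • logicalX i` modulo coboundaries. -/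
noncomputable def encoder : Matrix (Fin 30 → ZMod 2) (Fin 8 → ZMod 2) ℂ :=
  Matrix.of fun w u =>
    if w - ∑ i, u i • logicalX i ∈ coboundaries then
      ((Real.sqrt (Nat.card coboundaries) : ℂ))⁻¹ else 0

/-- The physical operator `W` implements the logical operator `U` on the code space. -/
def Implements (W : Operator (Fin 30)) (U : UnitaryOp (Fin 8)) : Prop :=
  W * encoder = encoder * (U : Operator (Fin 8))

/-- The permutation gates of the three reflections, the Hadamard-type gate and the phase-type gate
(with a choice `A` of fixed points) of the duality `τ₀`. -/
noncomputable def physicalGates (A : Finset (Fin 30)) : Set (Operator (Fin 30)) :=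
  {permGate (qubitPerm (mirror a)), permGate (qubitPerm (mirror b)),
    permGate (qubitPerm (mirror c)), hadamardGate tau0, phaseGate tau0 A}

/-- The logical operators that are implemented by the permutation gates and the fold-transversal
gates, together with one more logical operator `g`. -/
def logicalGates (A : Finset (Fin 30)) (g : Operator (Fin 8)) : Set (UnitaryOp (Fin 8)) :=
  {U | (∃ W ∈ physicalGates A, Implements W U) ∨ (U : Operator (Fin 8)) = g}

end BringCode

open BringCode

/-! Conjugation by a Clifford operator permutes the Pauli operators up to phase. The induced map on
exponent vectors is linear and preserves the symplectic form that records which Pauli operators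
commute, and it is trivial only for Pauli operators times phases
(`eq_smul_pauliVec_of_isSymplecticImage_one`). Generating the Clifford group modulo Pauli operators
and phases therefore reduces to generating Sp₁₆(𝔽₂) (`closure_sup_eq_cliffordGroup`).

The encoder is an isometry, so a physical gate implements at most one logical operator. The encoded
state of u is supported on the cocycles whose parities against `logicalZ` are u (`encoder_apply'`).
A reflection thus acts through its matrix on cohomology, and the Hadamard-type gate through the
intersection form `dualForm` of the duality followed by logical Hadamards. The phase-type gate acts
as a diagonal gate whose phase is a quadratic refinement of `dualForm`. Choosing S or S† at a fixed
point changes the refinement but not its polar form, so the symplectic images do not depend on the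
choice (`symplecticImages_logicalGates`). What remains is a question about five explicit 16 × 16
matrices and the matrix of g.

For generation, write T_u for the transvection with center u. Since M T_u M⁻¹ = T_{Mu},
transvections can be transported, and T_u, T_v yield T_{u+v} when u and v pair to 1. The
transvections at the basis vectors and at the sums of two consecutive Z-vectors suffice
(`eq_top_of_transvection_chain`). Their centers are all images of the first Z-vector under words in
the five matrices and its transvection (`eq_top_of_first_transvection`). It is enough to exhibit one
transvection for each g: a power of a listed word is a transvection, and a second word carries its
center to the first Z-vector. The kernel checks these words on matrices stored as lists of 16-bit
columns.

For the three exceptional pairs, the five matrices and the controlled-Z preserve a common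
8-dimensional subspace, the kernel and range of `foldNilpotent`, which a controlled-NOT does not
preserve (`closure_insert_cz_ne_top`). -/

namespace BringCode

set_option linter.unusedSectionVars false

/-! ### Signs indexed by the field with two elements. -/

section Sign

theorem sgn_zero : sgn 0 = 1 := by simp [sgn]

theorem sgn_one : sgn 1 = -1 := by simp [sgn, ZMod.val_one]

theorem zmod_two_eq_zero_or_one (t : ZMod 2) : t = 0 ∨ t = 1 := by
  revert t
  decide

theorem sgn_add (s t : ZMod 2) : sgn (s + t) = sgn s * sgn t := by
  have h : (1 : ZMod 2) + 1 = 0 := by decide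
  rcases zmod_two_eq_zero_or_one s with rfl | rfl <;>
    rcases zmod_two_eq_zero_or_one t with rfl | rfl <;> simp [sgn_zero, sgn_one, h]

theorem sgn_mul_self (t : ZMod 2) : sgn t * sgn t = 1 := by
  rw [← sgn_add, CharTwo.add_self_eq_zero, sgn_zero]

theorem sgn_ne_zero (t : ZMod 2) : sgn t ≠ 0 := left_ne_zero_of_mul_eq_one (sgn_mul_self t)

theorem star_sgn (t : ZMod 2) : star (sgn t) = sgn t := by simp [sgn]

theorem sgn_injective : Function.Injective sgn := by
  intro s t h
  rcases zmod_two_eq_zero_or_one s with rfl | rfl <;>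
    rcases zmod_two_eq_zero_or_one t with rfl | rfl
  · rfl
  · norm_num [sgn_zero, sgn_one] at h
  · norm_num [sgn_zero, sgn_one] at h
  · rfl

theorem exists_sgn_of_mul_self {c : ℂ} (h : c * c = 1) : ∃ t, c = sgn t := by
  rcases mul_self_eq_one_iff.1 h with rfl | rfl
  · exact ⟨0, sgn_zero.symm⟩
  · exact ⟨1, sgn_one.symm⟩

theorem sgn_sum {κ : Type*} (s : Finset κ) (f : κ → ZMod 2) :
    sgn (∑ i ∈ s, f i) = ∏ i ∈ s, sgn (f i) := by
  classical
  induction s using Finset.induction_on with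
  | empty => simp [sgn_zero]
  | insert a s ha ih => rw [Finset.sum_insert ha, Finset.prod_insert ha, sgn_add, ih]

theorem add_eq_iff_eq_add {V : Type*} [AddCommGroup V] [Module (ZMod 2) V] {u v w : V} :
    u + v = w ↔ u = w + v := by
  have h : v + v = 0 := ZModModule.add_self v
  constructor
  · rintro rfl; rw [add_assoc, h, add_zero]
  · rintro rfl; rw [add_assoc, h, add_zero]

end Sign

/-! ### Algebra of the Pauli operators. -/

section Pauli

variable {ι : Type*} [Fintype ι] [DecidableEq ι]

theorem pauli_apply (x z u v : ι → ZMod 2) :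
    pauli x z u v = if u = v + x then sgn (z ⬝ᵥ v) else 0 := rfl

theorem mul_pauli_apply {κ : Type*} (M : Matrix κ (ι → ZMod 2) ℂ) (x z v : ι → ZMod 2) (u : κ) :
    (M * pauli x z) u v = M u (v + x) * sgn (z ⬝ᵥ v) := by
  simp [Matrix.mul_apply, pauli_apply]

theorem pauli_mul_apply {κ : Type*} (M : Matrix (ι → ZMod 2) κ ℂ) (x z u : ι → ZMod 2) (v : κ) :
    (pauli x z * M) u v = sgn (z ⬝ᵥ (u + x)) * M (u + x) v := by
  have h (w : ι → ZMod 2) : u = w + x ↔ u + x = w := by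
    rw [add_eq_iff_eq_add (u := u)]
  simp [Matrix.mul_apply, pauli_apply, h]

/-- The sign is the cost of moving Z^z past X^x'. -/
theorem pauli_mul_pauli (x z x' z' : ι → ZMod 2) :
    pauli x z * pauli x' z' = sgn (z ⬝ᵥ x') • pauli (x + x') (z + z') := by
  ext u v
  rw [mul_pauli_apply, Matrix.smul_apply, pauli_apply, pauli_apply]
  have : v + x' + x = v + (x + x') := by abel
  rw [this]
  split_ifs
  · rw [dotProduct_add, add_dotProduct, sgn_add, sgn_add, smul_eq_mul]; ring
  · simp

theorem pauli_zero_zero : pauli (0 : ι → ZMod 2) 0 = 1 := by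
  ext u v
  simp [pauli_apply, Matrix.one_apply, sgn_zero]

theorem pauli_conjTranspose (x z : ι → ZMod 2) :
    (pauli x z)ᴴ = sgn (z ⬝ᵥ x) • pauli x z := by
  ext u v
  rw [Matrix.conjTranspose_apply, Matrix.smul_apply, pauli_apply, pauli_apply]
  have h : v = u + x ↔ u = v + x := by rw [eq_comm, add_eq_iff_eq_add]
  simp only [h]
  split_ifs with hu
  · rw [hu, star_sgn, dotProduct_add, sgn_add, smul_eq_mul, mul_comm]
  · simp

theorem pauli_conjTranspose_mul_self (x z : ι → ZMod 2) : (pauli x z)ᴴ * pauli x z = 1 := by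
  rw [pauli_conjTranspose, Matrix.smul_mul, pauli_mul_pauli, smul_smul, sgn_mul_self, one_smul,
    ZModModule.add_self, ZModModule.add_self, pauli_zero_zero]

theorem pauli_mem_unitary (x z : ι → ZMod 2) :
    pauli x z ∈ Matrix.unitaryGroup (ι → ZMod 2) ℂ :=
  Matrix.mem_unitaryGroup_iff'.2 (pauli_conjTranspose_mul_self x z)

/-- Column 0 has a single nonzero entry: its row is x and its value the scalar. The column of the
i-th unit vector then reveals z i as a sign. -/
theorem smul_pauli_inj {x z x' z' : ι → ZMod 2} {c c' : ℂ} (hc : c ≠ 0)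
    (h : c • pauli x z = c' • pauli x' z') : c = c' ∧ x = x' ∧ z = z' := by
  have hx : x = x' := by
    by_contra hne
    have h0 := congrFun (congrFun h x) 0
    simp [pauli_apply, hne, sgn_zero, hc] at h0
  subst hx
  have hcc : c = c' := by
    have h0 := congrFun (congrFun h x) 0
    simpa [pauli_apply, sgn_zero] using h0
  subst hcc
  refine ⟨rfl, rfl, ?_⟩
  ext i
  have h0 := congrFun (congrFun h (Pi.single i 1 + x)) (Pi.single i 1)
  simp only [Matrix.smul_apply, pauli_apply, if_true, smul_eq_mul, dotProduct_single_one] at h0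
  exact sgn_injective (mul_left_cancel₀ hc h0)

/-- The Pauli operator with exponent vector `v`. -/
def pauliVec (v : ι ⊕ ι → ZMod 2) : Operator ι := pauli (v ∘ Sum.inr) (v ∘ Sum.inl)

theorem pauli_eq_pauliVec (x z : ι → ZMod 2) : pauli x z = pauliVec (Sum.elim z x) := rfl

theorem pauliVec_zero : pauliVec (0 : ι ⊕ ι → ZMod 2) = 1 := pauli_zero_zero

theorem pauliVec_mul (v w : ι ⊕ ι → ZMod 2) :
    pauliVec v * pauliVec w = sgn ((v ∘ Sum.inl) ⬝ᵥ (w ∘ Sum.inr)) • pauliVec (v + w) :=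
  pauli_mul_pauli _ _ _ _

theorem smul_pauliVec_inj {v w : ι ⊕ ι → ZMod 2} {c c' : ℂ} (hc : c ≠ 0)
    (h : c • pauliVec v = c' • pauliVec w) : c = c' ∧ v = w := by
  obtain ⟨h1, h2, h3⟩ := smul_pauli_inj hc h
  refine ⟨h1, funext fun i => ?_⟩
  cases i with
  | inl i => exact congrFun h3 i
  | inr i => exact congrFun h2 i

theorem pauliVec_ne_zero (v : ι ⊕ ι → ZMod 2) : pauliVec v ≠ 0 := by
  intro h
  have := (smul_pauliVec_inj (v := v) (w := v) (c := 1) (c' := 0) one_ne_zero (by simp [h])).1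
  exact one_ne_zero this

/-- The standard symplectic form on exponent vectors. -/
def symp (v w : ι ⊕ ι → ZMod 2) : ZMod 2 := v ⬝ᵥ (Matrix.J ι (ZMod 2) *ᵥ w)

theorem symp_eq (v w : ι ⊕ ι → ZMod 2) :
    symp v w = (v ∘ Sum.inl) ⬝ᵥ (w ∘ Sum.inr) + (v ∘ Sum.inr) ⬝ᵥ (w ∘ Sum.inl) := by
  simp [symp, Matrix.J, Matrix.fromBlocks_mulVec, dotProduct, Fintype.sum_sum_type,
    ZModModule.neg_eq_self]

/-- The two orders of multiplication carry the signs z·x' and z'·x, and the sum of these exponents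
is the symplectic form. -/
theorem pauliVec_comm (v w : ι ⊕ ι → ZMod 2) :
    pauliVec v * pauliVec w = sgn (symp v w) • (pauliVec w * pauliVec v) := by
  rw [pauliVec_mul, pauliVec_mul, smul_smul, symp_eq, sgn_add, add_comm w v,
    dotProduct_comm (v ∘ Sum.inr), mul_assoc, sgn_mul_self, mul_one]

theorem pauliVec_mul_self (v : ι ⊕ ι → ZMod 2) :
    ∃ t, pauliVec v * pauliVec v = sgn t • (1 : Operator ι) :=
  ⟨_, by rw [pauliVec_mul, ZModModule.add_self, pauliVec_zero]⟩

/-- The Pauli operator with exponent vector `v`, as a unitary. -/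
def pauliUnitary (v : ι ⊕ ι → ZMod 2) : UnitaryOp ι := ⟨pauliVec v, pauli_mem_unitary _ _⟩

theorem I_smul_one_mem : Complex.I • (1 : Operator ι) ∈ Matrix.unitaryGroup (ι → ZMod 2) ℂ := by
  rw [Matrix.mem_unitaryGroup_iff', Matrix.star_eq_conjTranspose, Matrix.conjTranspose_smul,
    Matrix.conjTranspose_one, Matrix.smul_mul, one_mul, smul_smul]
  simp

theorem pauliUnitary_mem (v : ι ⊕ ι → ZMod 2) : pauliUnitary v ∈ pauliGroup ι :=
  Subgroup.subset_closure (Or.inl ⟨_, _, rfl⟩)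

/-- Normal form: products only add exponent vectors and multiply phases, and all phases that arise
are fourth roots of unity. -/
theorem mem_pauliGroup {U : UnitaryOp ι} :
    U ∈ pauliGroup ι ↔
      ∃ (c : ℂ) (v : ι ⊕ ι → ZMod 2), c ^ 4 = 1 ∧ (U : Operator ι) = c • pauliVec v := by
  constructor
  · intro h
    induction h using Subgroup.closure_induction with
    | mem U hU =>
      rcases hU with ⟨x, z, h⟩ | h
      · exact ⟨1, Sum.elim z x, one_pow 4, by rw [one_smul, h]; rfl⟩
      · exact ⟨Complex.I, 0, Complex.I_pow_four, by rw [h, pauliVec_zero]⟩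
    | one => exact ⟨1, 0, one_pow 4, by simp [pauliVec_zero]⟩
    | mul U W _ _ hU hW =>
      obtain ⟨c, v, hc, hU⟩ := hU
      obtain ⟨d, w, hd, hW⟩ := hW
      refine ⟨c * d * sgn ((v ∘ Sum.inl) ⬝ᵥ (w ∘ Sum.inr)), v + w, ?_, ?_⟩
      · have h := sgn_mul_self ((v ∘ Sum.inl) ⬝ᵥ (w ∘ Sum.inr))
        rw [mul_pow, mul_pow, hc, hd, show (4 : ℕ) = 2 + 2 from rfl, pow_add, pow_two, h]
        norm_num
      · rw [Matrix.UnitaryGroup.mul_val, hU, hW, Matrix.smul_mul, Matrix.mul_smul, pauliVec_mul,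
          smul_smul, smul_smul, mul_assoc]
    | inv U _ hU =>
      obtain ⟨c, v, hc, hU⟩ := hU
      refine ⟨star c * sgn ((v ∘ Sum.inl) ⬝ᵥ (v ∘ Sum.inr)), v, ?_, ?_⟩
      · have h := sgn_mul_self ((v ∘ Sum.inl) ⬝ᵥ (v ∘ Sum.inr))
        rw [mul_pow, ← star_pow, hc, show (4 : ℕ) = 2 + 2 from rfl, pow_add, pow_two, h]
        simp
      · rw [Matrix.UnitaryGroup.inv_val, Matrix.star_eq_conjTranspose, hU,
          Matrix.conjTranspose_smul, pauliVec, pauli_conjTranspose, smul_smul]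
  · rintro ⟨c, v, hc, hU⟩
    have hI : (⟨Complex.I • 1, I_smul_one_mem⟩ : UnitaryOp ι) ∈ pauliGroup ι :=
      Subgroup.subset_closure (Or.inr rfl)
    obtain ⟨k, rfl⟩ : ∃ k : ℕ, c = Complex.I ^ k := by
      -- The factorization of c⁴ - 1 lists the four possible phases as powers of i.
      have h : (c - 1) * (c + 1) * ((c - Complex.I) * (c + Complex.I)) = 0 := by
        have := Complex.I_sq
        linear_combination hc - (c ^ 2 - 1) * this
      simp only [mul_eq_zero, sub_eq_zero, add_eq_zero_iff_eq_neg] at h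
      rcases h with (rfl | rfl) | rfl | rfl
      · exact ⟨0, by simp⟩
      · exact ⟨2, by simp⟩
      · exact ⟨1, by simp⟩
      · exact ⟨3, by simp [pow_succ]⟩
    have : U = (⟨Complex.I • 1, I_smul_one_mem⟩ : UnitaryOp ι) ^ k * pauliUnitary v := by
      apply Subtype.ext
      rw [hU]
      simp [pauliUnitary, smul_pow]
    rw [this]
    exact mul_mem (pow_mem hI k) (pauliUnitary_mem v)

end Pauli

/-! ### Symplectic images and the Clifford group. -/

section SymplecticImage

variable {ι : Type*} [Fintype ι] [DecidableEq ι]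

/-- The matrix identity Mᵀ J M = J is the invariance of the form, tested entrywise on pairs of basis
vectors. -/
theorem mem_symplecticGroup_iff_symp {M : Matrix (ι ⊕ ι) (ι ⊕ ι) (ZMod 2)} :
    M ∈ Matrix.symplecticGroup ι (ZMod 2) ↔ ∀ v w, symp (M *ᵥ v) (M *ᵥ w) = symp v w := by
  have key (v w : ι ⊕ ι → ZMod 2) :
      symp (M *ᵥ v) (M *ᵥ w) = v ⬝ᵥ ((Mᵀ * Matrix.J ι (ZMod 2) * M) *ᵥ w) := by
    rw [symp, ← Matrix.mulVec_mulVec, ← Matrix.mulVec_mulVec, Matrix.dotProduct_mulVec v,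
      Matrix.vecMul_transpose]
  rw [SymplecticGroup.mem_iff']
  constructor
  · intro h v w
    rw [key, h, symp]
  · intro h
    ext i j
    have := h (Pi.single i 1) (Pi.single j 1)
    rw [key, symp] at this
    simpa using this

theorem symp_mulVec (M : Matrix.symplecticGroup ι (ZMod 2)) (v w : ι ⊕ ι → ZMod 2) :
    symp (M.1 *ᵥ v) (M.1 *ᵥ w) = symp v w :=
  mem_symplecticGroup_iff_symp.1 M.2 v w

theorem symplectic_ext {M N : Matrix.symplecticGroup ι (ZMod 2)}
    (h : ∀ v, M.1 *ᵥ v = N.1 *ᵥ v) : M = N :=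
  Subtype.ext (Matrix.mulVec_injective (funext h))

theorem UnitaryOp.conjTranspose_mul (U : UnitaryOp ι) :
    (U : Operator ι)ᴴ * (U : Operator ι) = 1 := Matrix.UnitaryGroup.star_mul_self U

theorem UnitaryOp.mul_conjTranspose (U : UnitaryOp ι) :
    (U : Operator ι) * (U : Operator ι)ᴴ = 1 := Matrix.mem_unitaryGroup_iff.1 U.2

theorem UnitaryOp.inv_val (U : UnitaryOp ι) :
    ((U⁻¹ : UnitaryOp ι) : Operator ι) = (U : Operator ι)ᴴ := rfl

theorem UnitaryOp.conj_injective (U : UnitaryOp ι) :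
    Function.Injective fun A : Operator ι => (U : Operator ι) * A * (U : Operator ι)ᴴ := by
  intro A B h
  have h1 := congrArg (fun A => (U : Operator ι)ᴴ * A * (U : Operator ι)) h
  simpa [Matrix.mul_assoc, U.conjTranspose_mul, ← Matrix.mul_assoc (U : Operator ι)ᴴ] using h1

theorem isSymplecticImage_iff {U : UnitaryOp ι} {M : Matrix.symplecticGroup ι (ZMod 2)} :
    IsSymplecticImage U M ↔ ∀ v, ∃ c : ℂ, (U : Operator ι) * pauliVec v * (U : Operator ι)ᴴ =
      c • pauliVec (M.1 *ᵥ v) := Iff.rfl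

/-- The intertwining form of `IsSymplecticImage`. -/
theorem isSymplecticImage_of_mul {U : UnitaryOp ι} {M : Matrix.symplecticGroup ι (ZMod 2)}
    (h : ∀ v, ∃ c : ℂ, (U : Operator ι) * pauliVec v =
      c • (pauliVec (M.1 *ᵥ v) * (U : Operator ι))) :
    IsSymplecticImage U M := by
  refine isSymplecticImage_iff.2 fun v => ?_
  obtain ⟨c, hc⟩ := h v
  exact ⟨c, by rw [hc, Matrix.smul_mul, Matrix.mul_assoc, U.mul_conjTranspose, mul_one]⟩

theorem conj_pauliVec_phase_ne_zero {U : UnitaryOp ι} {v w : ι ⊕ ι → ZMod 2} {c : ℂ}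
    (h : (U : Operator ι) * pauliVec v * (U : Operator ι)ᴴ = c • pauliVec w) : c ≠ 0 := by
  rintro rfl
  refine pauliVec_ne_zero v (U.conj_injective ?_)
  simpa using h

/-- Pauli operators square to ±1 and conjugation fixes scalars, so comparing squares determines c²
up to the two signs. -/
theorem conj_pauliVec_phase {U : UnitaryOp ι} {v w : ι ⊕ ι → ZMod 2} {c : ℂ}
    (h : (U : Operator ι) * pauliVec v * (U : Operator ι)ᴴ = c • pauliVec w) :
    ∃ s t, pauliVec v * pauliVec v = sgn s • (1 : Operator ι) ∧
      pauliVec w * pauliVec w = sgn t • (1 : Operator ι) ∧ sgn s = c * c * sgn t := by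
  obtain ⟨s, hs⟩ := pauliVec_mul_self v
  obtain ⟨t, ht⟩ := pauliVec_mul_self w
  refine ⟨s, t, hs, ht, ?_⟩
  have h1 : (U : Operator ι) * pauliVec v * (U : Operator ι)ᴴ *
      ((U : Operator ι) * pauliVec v * (U : Operator ι)ᴴ) = sgn s • (1 : Operator ι) := by
    calc _ = (U : Operator ι) * pauliVec v * ((U : Operator ι)ᴴ * (U : Operator ι)) *
          pauliVec v * (U : Operator ι)ᴴ := by simp only [Matrix.mul_assoc]
      _ = (U : Operator ι) * (pauliVec v * pauliVec v) * (U : Operator ι)ᴴ := by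
          rw [U.conjTranspose_mul, mul_one]; simp only [Matrix.mul_assoc]
      _ = _ := by
          rw [hs, Matrix.mul_smul, mul_one, Matrix.smul_mul, U.mul_conjTranspose]
  rw [h, Matrix.smul_mul, Matrix.mul_smul, ht, smul_smul, smul_smul, ← pauliVec_zero] at h1
  rw [← (smul_pauliVec_inj (c' := sgn s) ?_ h1).1]
  exact mul_ne_zero (mul_ne_zero (conj_pauliVec_phase_ne_zero h) (conj_pauliVec_phase_ne_zero h))
    (sgn_ne_zero t)

theorem conj_pauliVec_phase_pow {U : UnitaryOp ι} {v w : ι ⊕ ι → ZMod 2} {c : ℂ}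
    (h : (U : Operator ι) * pauliVec v * (U : Operator ι)ᴴ = c • pauliVec w) : c ^ 4 = 1 := by
  obtain ⟨s, t, -, -, hst⟩ := conj_pauliVec_phase h
  have h1 := sgn_mul_self s
  have h2 := sgn_mul_self t
  rw [hst] at h1
  linear_combination h1 - c ^ 4 * h2

theorem isSymplecticImage_one : IsSymplecticImage (1 : UnitaryOp ι) 1 :=
  isSymplecticImage_iff.2 fun v => ⟨1, by simp⟩

theorem IsSymplecticImage.mul {U W : UnitaryOp ι} {M N : Matrix.symplecticGroup ι (ZMod 2)}
    (hU : IsSymplecticImage U M) (hW : IsSymplecticImage W N) :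
    IsSymplecticImage (U * W) (M * N) := by
  rw [isSymplecticImage_iff] at *
  intro v
  obtain ⟨c, hc⟩ := hW v
  obtain ⟨d, hd⟩ := hU (N.1 *ᵥ v)
  refine ⟨c * d, ?_⟩
  calc _ = (U : Operator ι) * ((W : Operator ι) * pauliVec v * (W : Operator ι)ᴴ) *
        (U : Operator ι)ᴴ := by
        simp only [Matrix.UnitaryGroup.mul_val, Matrix.conjTranspose_mul, Matrix.mul_assoc]
    _ = _ := by
        rw [hc, Matrix.mul_smul, Matrix.smul_mul, hd, smul_smul, Submonoid.coe_mul,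
          Matrix.mulVec_mulVec]

theorem IsSymplecticImage.inv {U : UnitaryOp ι} {M : Matrix.symplecticGroup ι (ZMod 2)}
    (hU : IsSymplecticImage U M) : IsSymplecticImage U⁻¹ M⁻¹ := by
  rw [isSymplecticImage_iff] at *
  intro v
  obtain ⟨c, hc⟩ := hU (M⁻¹.1 *ᵥ v)
  have hc0 := conj_pauliVec_phase_ne_zero hc
  rw [Matrix.mulVec_mulVec, ← Submonoid.coe_mul, mul_inv_cancel, Submonoid.coe_one,
    Matrix.one_mulVec] at hc
  refine ⟨c⁻¹, U.conj_injective ?_⟩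
  simp only [UnitaryOp.inv_val, Matrix.conjTranspose_conjTranspose]
  rw [Matrix.mul_smul, Matrix.smul_mul, hc, smul_smul, inv_mul_cancel₀ hc0, one_smul]
  calc _ = ((U : Operator ι) * (U : Operator ι)ᴴ) * pauliVec v *
        ((U : Operator ι) * (U : Operator ι)ᴴ) := by simp only [Matrix.mul_assoc]
    _ = _ := by rw [U.mul_conjTranspose, one_mul, mul_one]

/-- Pauli operators with different exponent vectors are not proportional. -/
theorem IsSymplecticImage.unique {U : UnitaryOp ι} {M N : Matrix.symplecticGroup ι (ZMod 2)}
    (hM : IsSymplecticImage U M) (hN : IsSymplecticImage U N) : M = N := by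
  rw [isSymplecticImage_iff] at *
  refine symplectic_ext fun v => ?_
  obtain ⟨c, hc⟩ := hM v
  obtain ⟨d, hd⟩ := hN v
  exact (smul_pauliVec_inj (conj_pauliVec_phase_ne_zero hc) (hc.symm.trans hd)).2

/-- `IsSymplecticImage` allows an arbitrary complex phase. It is automatically a fourth root of
unity, so conjugation stays inside the Pauli group. -/
theorem IsSymplecticImage.conj_mem {U : UnitaryOp ι} {M : Matrix.symplecticGroup ι (ZMod 2)}
    (hU : IsSymplecticImage U M) {P : UnitaryOp ι} (hP : P ∈ pauliGroup ι) :
    U * P * U⁻¹ ∈ pauliGroup ι := by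
  rw [mem_pauliGroup] at *
  obtain ⟨c, v, hc, hP⟩ := hP
  obtain ⟨d, hd⟩ := hU v
  refine ⟨c * d, M.1 *ᵥ v, by rw [mul_pow, hc, conj_pauliVec_phase_pow hd, one_mul], ?_⟩
  rw [Matrix.UnitaryGroup.mul_val, Matrix.UnitaryGroup.mul_val, hP, UnitaryOp.inv_val,
    Matrix.mul_smul, Matrix.smul_mul, mul_smul]
  exact congrArg _ hd

theorem IsSymplecticImage.mem_cliffordGroup {U : UnitaryOp ι}
    {M : Matrix.symplecticGroup ι (ZMod 2)} (hU : IsSymplecticImage U M) :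
    U ∈ cliffordGroup ι := by
  refine Subgroup.mem_normalizer_iff.2 fun P => ⟨fun h => hU.conj_mem h, fun h => ?_⟩
  have := hU.inv.conj_mem h
  simpa [mul_assoc] using this

/-- Conjugation is multiplicative: products of Pauli operators make the map on exponent vectors
additive, hence linear over 𝔽₂, and commutation signs make it preserve the form. -/
theorem exists_isSymplecticImage {U : UnitaryOp ι} (hU : U ∈ cliffordGroup ι) :
    ∃ M, IsSymplecticImage U M := by
  have h (v : ι ⊕ ι → ZMod 2) : ∃ (c : ℂ) (w : ι ⊕ ι → ZMod 2),
      (U : Operator ι) * pauliVec v * (U : Operator ι)ᴴ = c • pauliVec w := by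
    obtain ⟨c, w, -, h⟩ := mem_pauliGroup.1
      ((Subgroup.mem_normalizer_iff.1 hU _).1 (pauliUnitary_mem v))
    exact ⟨c, w, h⟩
  choose c f hf using h
  have hc (v) : c v ≠ 0 := conj_pauliVec_phase_ne_zero (hf v)
  have hprod (v w : ι ⊕ ι → ZMod 2) :
      (U : Operator ι) * (pauliVec v * pauliVec w) * (U : Operator ι)ᴴ =
        (c v * c w) • (pauliVec (f v) * pauliVec (f w)) := by
    calc _ = ((U : Operator ι) * pauliVec v) * ((U : Operator ι)ᴴ * (U : Operator ι)) *
          (pauliVec w * (U : Operator ι)ᴴ) := by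
          rw [U.conjTranspose_mul, mul_one]; simp only [Matrix.mul_assoc]
      _ = ((U : Operator ι) * pauliVec v * (U : Operator ι)ᴴ) *
          ((U : Operator ι) * pauliVec w * (U : Operator ι)ᴴ) := by simp only [Matrix.mul_assoc]
      _ = _ := by rw [hf, hf, Matrix.smul_mul, Matrix.mul_smul, smul_smul]
  have hadd (v w : ι ⊕ ι → ZMod 2) : f (v + w) = f v + f w := by
    have h1 := hprod v w
    rw [pauliVec_mul, pauliVec_mul, Matrix.mul_smul, Matrix.smul_mul, hf, smul_smul,
      smul_smul] at h1
    exact (smul_pauliVec_inj (mul_ne_zero (sgn_ne_zero _) (hc _)) h1).2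
  have hsymp (v w : ι ⊕ ι → ZMod 2) : symp (f v) (f w) = symp v w := by
    have h1 := hprod v w
    rw [pauliVec_comm, Matrix.mul_smul, Matrix.smul_mul, hprod w v, pauliVec_comm (f v),
      pauliVec_mul, smul_smul, smul_smul, smul_smul, smul_smul] at h1
    have h2 := (smul_pauliVec_inj (mul_ne_zero (mul_ne_zero (sgn_ne_zero _)
      (mul_ne_zero (hc _) (hc _))) (sgn_ne_zero _)) h1).1
    have h3 : c w * c v * sgn ((f w ∘ Sum.inl) ⬝ᵥ (f v ∘ Sum.inr)) ≠ 0 :=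
      mul_ne_zero (mul_ne_zero (hc _) (hc _)) (sgn_ne_zero _)
    refine sgn_injective (mul_right_cancel₀ h3 ?_)
    linear_combination -h2
  let F : (ι ⊕ ι → ZMod 2) →ₗ[ZMod 2] (ι ⊕ ι → ZMod 2) :=
    AddMonoidHom.toZModLinearMap 2 (AddMonoidHom.mk' f hadd)
  have hF (v) : LinearMap.toMatrix' F *ᵥ v = f v := by
    rw [← Matrix.toLin'_apply, Matrix.toLin'_toMatrix']; rfl
  refine ⟨⟨LinearMap.toMatrix' F, mem_symplecticGroup_iff_symp.2 fun v w => ?_⟩,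
    isSymplecticImage_iff.2 fun v => ⟨c v, ?_⟩⟩
  · rw [hF, hF, hsymp]
  · rw [hf, hF]

/-- An operator that commutes with all Pauli operators is a scalar. -/
theorem eq_smul_one_of_commute {A : Operator ι} (h : ∀ v, A * pauliVec v = pauliVec v * A) :
    ∃ c : ℂ, A = c • 1 := by
  have key (x z u v : ι → ZMod 2) :
      A u (v + x) * sgn (z ⬝ᵥ v) = sgn (z ⬝ᵥ (u + x)) * A (u + x) v := by
    have := congrFun (congrFun (h (Sum.elim z x)) u) v
    rwa [← pauli_eq_pauliVec, mul_pauli_apply, pauli_mul_apply] at this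
  refine ⟨A 0 0, ?_⟩
  ext u v
  rw [Matrix.smul_apply, Matrix.one_apply]
  split_ifs with huv
  -- Commuting with X^u makes the diagonal constant.
  · subst huv
    have h1 := key u 0 0 u
    rw [ZModModule.add_self, zero_dotProduct, zero_dotProduct, sgn_zero, mul_one, one_mul,
      zero_add] at h1
    rw [smul_eq_mul, mul_one, h1]
  -- Where u and v differ at i, commuting with Z on qubit i forces the entry to equal its own
  -- negative.
  · obtain ⟨i, hi⟩ := Function.ne_iff.1 huv
    have h1 := key 0 (Pi.single i 1) u v
    rw [add_zero, add_zero, single_one_dotProduct, single_one_dotProduct, mul_comm] at h1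
    by_contra h2
    rw [smul_zero] at h2
    exact hi (sgn_injective (mul_right_cancel₀ h2 h1)).symm

/-- A unitary with trivial symplectic image is a Pauli operator up to a phase. -/
theorem eq_smul_pauliVec_of_isSymplecticImage_one {U : UnitaryOp ι}
    (h : IsSymplecticImage U 1) : ∃ (c : ℂ) (w : ι ⊕ ι → ZMod 2),
      (U : Operator ι) = c • pauliVec w := by
  -- A Pauli operator and its conjugate have the same square, which restricts the phase to ±1.
  have h0 (v : ι ⊕ ι → ZMod 2) : ∃ t : ZMod 2,
      (U : Operator ι) * pauliVec v * (U : Operator ι)ᴴ = sgn t • pauliVec v := by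
    obtain ⟨c, hc⟩ := isSymplecticImage_iff.1 h v
    rw [Submonoid.coe_one, Matrix.one_mulVec] at hc
    obtain ⟨s, t, hs, ht, hst⟩ := conj_pauliVec_phase hc
    rw [hs, ← pauliVec_zero] at ht
    have hst' := (smul_pauliVec_inj (sgn_ne_zero _) ht).1
    obtain ⟨r, rfl⟩ : ∃ r, c = sgn r := exists_sgn_of_mul_self (by
      rw [← hst'] at hst
      exact (mul_right_cancel₀ (sgn_ne_zero s) (by rw [one_mul, ← hst])))
    exact ⟨r, hc⟩
  choose t ht using h0
  have hcomm (v : ι ⊕ ι → ZMod 2) :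
      (U : Operator ι) * pauliVec v = sgn (t v) • (pauliVec v * (U : Operator ι)) := by
    rw [← Matrix.smul_mul, ← ht, Matrix.mul_assoc, U.conjTranspose_mul, mul_one]
  have hadd (v w : ι ⊕ ι → ZMod 2) : t (v + w) = t v + t w := by
    have h1 := hcomm (v + w)
    have h2 : (U : Operator ι) * (pauliVec v * pauliVec w) =
        (sgn (t v) * sgn (t w)) • (pauliVec v * pauliVec w * (U : Operator ι)) := by
      rw [← Matrix.mul_assoc, hcomm, Matrix.smul_mul, Matrix.mul_assoc, hcomm, Matrix.mul_smul,
        smul_smul, Matrix.mul_assoc]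
    rw [pauliVec_mul, Matrix.mul_smul, Matrix.smul_mul, h1, smul_comm] at h2
    have h3 := congrArg (fun A => A * (U : Operator ι)ᴴ) h2
    simp only [Matrix.smul_mul, Matrix.mul_assoc, U.mul_conjTranspose, mul_one] at h3
    rw [smul_smul, smul_smul] at h3
    have h4 := (smul_pauliVec_inj (mul_ne_zero (sgn_ne_zero _) (sgn_ne_zero _)) h3).1
    refine sgn_injective (mul_right_cancel₀ (sgn_ne_zero ((v ∘ Sum.inl) ⬝ᵥ (w ∘ Sum.inr))) ?_)
    rw [h4, sgn_add]
  let T : (ι ⊕ ι → ZMod 2) →ₗ[ZMod 2] ZMod 2 :=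
    AddMonoidHom.toZModLinearMap 2 (AddMonoidHom.mk' t hadd)
  -- The exponent of the sign is a linear functional, hence pairing with some w. The Pauli operator
  -- of w has the same commutation signs as U, so their product commutes with every Pauli operator
  -- and is a scalar.
  obtain ⟨w, hw⟩ : ∃ w, ∀ v, t v = symp w v := by
    refine ⟨Sum.elim (fun i => t (Pi.single (Sum.inr i) 1)) (fun i => t (Pi.single (Sum.inl i) 1)),
      fun v => ?_⟩
    have h1 : T v = ∑ j, v j • T (Pi.single j 1) := by
      conv_lhs => rw [pi_eq_sum_univ' v, map_sum]
      simp
    change t v = ∑ j, v j • t (Pi.single j 1) at h1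
    rw [h1, symp_eq, Fintype.sum_sum_type, add_comm]
    simp [dotProduct, mul_comm]
  obtain ⟨c, hc⟩ := eq_smul_one_of_commute (A := pauliVec w * (U : Operator ι)) fun v => by
    rw [Matrix.mul_assoc, hcomm, Matrix.mul_smul, ← Matrix.mul_assoc, pauliVec_comm,
      Matrix.smul_mul, smul_smul, hw, sgn_mul_self, one_smul, Matrix.mul_assoc]
  obtain ⟨s, hs⟩ := pauliVec_mul_self w
  refine ⟨sgn s * c, w, ?_⟩
  have h1 := congrArg (fun A => pauliVec w * A) hc
  simp only [← Matrix.mul_assoc, hs, Matrix.smul_mul, one_mul, Matrix.mul_smul, mul_one] at h1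
  rw [mul_smul, ← h1, smul_smul, sgn_mul_self, one_smul]

theorem phaseGroup_le_cliffordGroup : phaseGroup ι ≤ cliffordGroup ι := by
  refine (Subgroup.closure_le _).2 ?_
  rintro U ⟨c, hU⟩
  refine IsSymplecticImage.mem_cliffordGroup (M := 1) (isSymplecticImage_of_mul fun v => ⟨1, ?_⟩)
  simp [hU]

theorem exists_isSymplecticImage_of_mem_closure {S : Set (UnitaryOp ι)}
    {M : Matrix.symplecticGroup ι (ZMod 2)} (hM : M ∈ Subgroup.closure (symplecticImages S)) :
    ∃ U ∈ Subgroup.closure S, IsSymplecticImage U M := by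
  induction hM using Subgroup.closure_induction with
  | mem M hM =>
    obtain ⟨U, hU, hM⟩ := hM
    exact ⟨U, Subgroup.subset_closure hU, hM⟩
  | one => exact ⟨1, one_mem _, isSymplecticImage_one⟩
  | mul M N _ _ hM hN =>
    obtain ⟨U, hU, hM⟩ := hM
    obtain ⟨W, hW, hN⟩ := hN
    exact ⟨U * W, mul_mem hU hW, hM.mul hN⟩
  | inv M _ hM =>
    obtain ⟨U, hU, hM⟩ := hM
    exact ⟨U⁻¹, inv_mem hU, hM.inv⟩

/-- Clifford operators whose symplectic images generate the symplectic group generate the Clifford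
group together with the Pauli operators and the global phases. -/
theorem closure_sup_eq_cliffordGroup {S : Set (UnitaryOp ι)} (hS : S ⊆ cliffordGroup ι)
    (h : Subgroup.closure (symplecticImages S) = ⊤) :
    Subgroup.closure S ⊔ pauliGroup ι ⊔ phaseGroup ι = cliffordGroup ι := by
  apply le_antisymm
  · exact sup_le (sup_le ((Subgroup.closure_le _).2 hS) Subgroup.le_normalizer)
      phaseGroup_le_cliffordGroup
  · intro U hU
    obtain ⟨M, hM⟩ := exists_isSymplecticImage hU
    obtain ⟨W, hW, hWM⟩ := exists_isSymplecticImage_of_mem_closure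
      (show M ∈ Subgroup.closure (symplecticImages S) by rw [h]; trivial)
    -- W is a word in S with the same symplectic image as U, so W⁻¹U has trivial image and is a
    -- Pauli operator times a phase.
    have h1 := hWM.inv.mul hM
    rw [inv_mul_cancel] at h1
    obtain ⟨c, w, hc⟩ := eq_smul_pauliVec_of_isSymplecticImage_one h1
    have h2 : W⁻¹ * U * (pauliUnitary w)⁻¹ ∈ phaseGroup ι := by
      refine Subgroup.subset_closure ⟨c, ?_⟩
      rw [Matrix.UnitaryGroup.mul_val, hc, UnitaryOp.inv_val, Matrix.smul_mul]
      exact congrArg _ (pauliUnitary w).mul_conjTranspose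
    have h3 : U = W * ((W⁻¹ * U * (pauliUnitary w)⁻¹) * pauliUnitary w) := by group
    rw [h3]
    have h4 : pauliGroup ι ≤ Subgroup.closure S ⊔ pauliGroup ι := le_sup_right
    exact mul_mem (Subgroup.mem_sup_left (Subgroup.mem_sup_left hW))
      (mul_mem (Subgroup.mem_sup_right h2) (Subgroup.mem_sup_left (h4 (pauliUnitary_mem w))))

end SymplecticImage

/-! ### Generation of the symplectic group by transvections. -/

section Transvections

variable {ι : Type*} [Fintype ι] [DecidableEq ι]

theorem symp_add_left (u v w : ι ⊕ ι → ZMod 2) : symp (u + v) w = symp u w + symp v w :=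
  add_dotProduct _ _ _

theorem symp_add_right (u v w : ι ⊕ ι → ZMod 2) : symp u (v + w) = symp u v + symp u w := by
  rw [symp, Matrix.mulVec_add, dotProduct_add, symp, symp]

theorem symp_smul_left (t : ZMod 2) (v w : ι ⊕ ι → ZMod 2) : symp (t • v) w = t * symp v w :=
  smul_dotProduct _ _ _

theorem symp_smul_right (t : ZMod 2) (v w : ι ⊕ ι → ZMod 2) : symp v (t • w) = t * symp v w := by
  rw [symp, Matrix.mulVec_smul, dotProduct_smul, symp, smul_eq_mul]

theorem symp_comm (v w : ι ⊕ ι → ZMod 2) : symp v w = symp w v := by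
  rw [symp_eq, symp_eq, add_comm, dotProduct_comm, dotProduct_comm (v ∘ Sum.inl)]

theorem symp_self (v : ι ⊕ ι → ZMod 2) : symp v v = 0 := by
  rw [symp_eq, dotProduct_comm, ZModModule.add_self]

theorem exists_symp_eq_one {v : ι ⊕ ι → ZMod 2} (hv : v ≠ 0) : ∃ w, symp w v = 1 := by
  obtain ⟨i, hi⟩ := Function.ne_iff.1 hv
  have h1 : v i = 1 := (zmod_two_eq_zero_or_one _).resolve_left hi
  cases i with
  | inl i => exact ⟨Pi.single (Sum.inr i) 1, by simpa [symp_eq, dotProduct, Pi.single_apply]⟩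
  | inr i => exact ⟨Pi.single (Sum.inl i) 1, by simpa [symp_eq, dotProduct, Pi.single_apply]⟩

theorem transvection_mulVec (u v : ι ⊕ ι → ZMod 2) :
    (1 + Matrix.vecMulVec u (Matrix.J ι (ZMod 2) *ᵥ u)) *ᵥ v = v + symp v u • u := by
  rw [Matrix.add_mulVec, Matrix.one_mulVec, Matrix.vecMulVec_mulVec, symp, dotProduct_comm]
  simp

/-- The symplectic transvection with center `u`. -/
def transvection (u : ι ⊕ ι → ZMod 2) : Matrix.symplecticGroup ι (ZMod 2) :=
  ⟨1 + Matrix.vecMulVec u (Matrix.J ι (ZMod 2) *ᵥ u), mem_symplecticGroup_iff_symp.2 fun v w => by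
    rw [transvection_mulVec, transvection_mulVec]
    simp only [symp_add_left, symp_add_right, symp_smul_left, symp_smul_right, symp_self,
      symp_comm u w]
    rw [mul_zero, add_zero, mul_comm (symp w u), add_assoc, CharTwo.add_self_eq_zero,
      add_zero]⟩

theorem transvection_apply (u v : ι ⊕ ι → ZMod 2) :
    (transvection u).1 *ᵥ v = v + symp v u • u := transvection_mulVec u v

theorem transvection_zero : transvection (0 : ι ⊕ ι → ZMod 2) = 1 :=
  symplectic_ext fun v => by rw [transvection_apply]; simp

theorem transvection_conj (M : Matrix.symplecticGroup ι (ZMod 2)) (u : ι ⊕ ι → ZMod 2) :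
    M * transvection u * M⁻¹ = transvection (M.1 *ᵥ u) := by
  rw [mul_inv_eq_iff_eq_mul]
  refine symplectic_ext fun v => ?_
  rw [Submonoid.coe_mul, Submonoid.coe_mul, ← Matrix.mulVec_mulVec, ← Matrix.mulVec_mulVec,
    transvection_apply, transvection_apply, symp_mulVec, Matrix.mulVec_add, Matrix.mulVec_smul]

theorem transvection_mem_of_apply {G : Subgroup (Matrix.symplecticGroup ι (ZMod 2))}
    {M : Matrix.symplecticGroup ι (ZMod 2)} (hM : M ∈ G) {u : ι ⊕ ι → ZMod 2}
    (hu : transvection u ∈ G) : transvection (M.1 *ᵥ u) ∈ G := by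
  rw [← transvection_conj]
  exact mul_mem (mul_mem hM hu) (inv_mem hM)

/-- T_v sends u to u + v when the pairing is 1, so conjugating T_u by T_v gives the new
transvection. -/
theorem transvection_add_mem {G : Subgroup (Matrix.symplecticGroup ι (ZMod 2))}
    {u v : ι ⊕ ι → ZMod 2} (hu : transvection u ∈ G) (hv : transvection v ∈ G)
    (h : symp u v = 1) : transvection (u + v) ∈ G := by
  have := transvection_mem_of_apply hv hu
  rwa [transvection_apply, h, one_smul] at this

/-- Left multiplication by a transvection can fix a further vector `v`. -/
theorem exists_transvection_fix {M : Matrix.symplecticGroup ι (ZMod 2)} {v : ι ⊕ ι → ZMod 2}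
    (hv : symp v (M.1 *ᵥ v) = 1) :
    (transvection (v + M.1 *ᵥ v) * M).1 *ᵥ v = v ∧
      ∀ w, M.1 *ᵥ w = w → (transvection (v + M.1 *ᵥ v) * M).1 *ᵥ w = w := by
  constructor
  · rw [Submonoid.coe_mul, ← Matrix.mulVec_mulVec, transvection_apply, symp_add_right, symp_self,
      symp_comm, hv, add_zero, one_smul, add_comm, add_assoc, ZModModule.add_self, add_zero]
  · intro w hw
    have h := symp_mulVec M w v
    rw [hw] at h
    rw [Submonoid.coe_mul, ← Matrix.mulVec_mulVec, transvection_apply, hw, symp_add_right, h,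
      CharTwo.add_self_eq_zero, zero_smul, add_zero]

/-- The symplectic group over the field with two elements is generated by transvections. -/
theorem eq_top_of_transvection_mem {G : Subgroup (Matrix.symplecticGroup ι (ZMod 2))}
    (hG : ∀ u, u ≠ 0 → transvection u ∈ G) : G = ⊤ := by
  have hG' (u) : transvection u ∈ G := by
    by_cases hu : u = 0
    · rw [hu, transvection_zero]; exact one_mem _
    · exact hG u hu
  refine (Subgroup.eq_top_iff' _).2 fun M => ?_
  -- Induction on the number of vectors moved by M: multiplying by one or two transvections keeps
  -- all fixed vectors and adds a new one.
  induction hn : (Finset.univ.filter fun v => M.1 *ᵥ v ≠ v).card using Nat.strong_induction_on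
    generalizing M with
  | _ n ih =>
  have step (u v) (N : Matrix.symplecticGroup ι (ZMod 2))
      (hN : ∀ w, M.1 *ᵥ w = w → N.1 *ᵥ w = w) (hv : M.1 *ᵥ v ≠ v) (hNv : N.1 *ᵥ v = v)
      (h : N = transvection u * M ∨ ∃ u', N = transvection u * (transvection u' * M)) :
      M ∈ G := by
    have hlt : (Finset.univ.filter fun v => N.1 *ᵥ v ≠ v).card < n := by
      rw [← hn]
      refine Finset.card_lt_card (Finset.ssubset_iff_of_subset ?_ |>.2 ⟨v, ?_, ?_⟩)
      · intro w hw
        simp only [Finset.mem_filter, Finset.mem_univ, true_and] at hw ⊢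
        exact fun h => hw (hN w h)
      · simpa using hv
      · simpa using hNv
    have hNG := ih _ hlt N rfl
    rcases h with rfl | ⟨u', rfl⟩
    · exact (Subgroup.mul_mem_cancel_left _ (hG' u)).1 hNG
    · exact (Subgroup.mul_mem_cancel_left _ (hG' u')).1
        ((Subgroup.mul_mem_cancel_left _ (hG' u)).1 hNG)
  by_cases h1 : ∃ v, symp v (M.1 *ᵥ v) = 1
  · obtain ⟨v, hv⟩ := h1
    obtain ⟨h2, h3⟩ := exists_transvection_fix hv
    refine step _ v _ h3 ?_ h2 (Or.inl rfl)
    intro h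
    rw [h, symp_self] at hv
    exact zero_ne_one hv
  -- Here every vector is orthogonal to its image, so no single transvection repairs M. Polarizing
  -- this identity yields a center w + Mw whose transvection keeps the fixed vectors and, after
  -- which, some v pairs to 1 with its image.
  · have h0 (v) : symp v (M.1 *ᵥ v) = 0 :=
      (zmod_two_eq_zero_or_one _).resolve_right fun h => h1 ⟨v, h⟩
    by_cases hM : M = 1
    · rw [hM]; exact one_mem _
    obtain ⟨w, hw⟩ : ∃ w, M.1 *ᵥ w ≠ w := by
      by_contra! h
      exact hM (symplectic_ext fun v => by rw [h v]; simp)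
    have hu0 : w + M.1 *ᵥ w ≠ 0 := fun h => hw (by
      rw [add_eq_iff_eq_add, zero_add] at h; exact h.symm)
    obtain ⟨v, hv⟩ := exists_symp_eq_one hu0
    have hpol : symp (M.1 *ᵥ v) w = symp v (M.1 *ᵥ w) := by
      have h2 := h0 (v + w)
      rw [Matrix.mulVec_add, symp_add_left, symp_add_right, symp_add_right, h0, h0, zero_add,
        add_zero, add_eq_iff_eq_add, zero_add, symp_comm w] at h2
      exact h2.symm
    have hMv : symp (M.1 *ᵥ v) (w + M.1 *ᵥ w) = 1 := by
      rw [← hv, symp_add_right, symp_add_right, symp_mulVec, hpol, add_comm]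
    have hN : symp v ((transvection (w + M.1 *ᵥ w) * M).1 *ᵥ v) = 1 := by
      rw [Submonoid.coe_mul, ← Matrix.mulVec_mulVec, transvection_apply, hMv, one_smul,
        symp_add_right, h0, zero_add, hv]
    have hfix (x) (hx : M.1 *ᵥ x = x) : (transvection (w + M.1 *ᵥ w) * M).1 *ᵥ x = x := by
      have h3 := symp_mulVec M x w
      rw [hx] at h3
      rw [Submonoid.coe_mul, ← Matrix.mulVec_mulVec, transvection_apply, hx, symp_add_right, h3,
        CharTwo.add_self_eq_zero, zero_smul, add_zero]
    obtain ⟨h2, h3⟩ := exists_transvection_fix hN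
    refine step _ v _ (fun x hx => h3 x (hfix x hx)) ?_ h2 (Or.inr ⟨_, rfl⟩)
    intro h
    have h4 := symp_mulVec M v w
    rw [h] at h4
    rw [symp_add_right, h4, CharTwo.add_self_eq_zero] at hv
    exact zero_ne_one hv

theorem symp_single_inl (v : ι ⊕ ι → ZMod 2) (i : ι) :
    symp v (Pi.single (Sum.inl i) 1) = v (Sum.inr i) := by
  simp [symp_eq, dotProduct, Pi.single_apply]

theorem symp_single_inr (v : ι ⊕ ι → ZMod 2) (i : ι) :
    symp v (Pi.single (Sum.inr i) 1) = v (Sum.inl i) := by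
  simp [symp_eq, dotProduct, Pi.single_apply]

/-- The exponent vectors of Pauli operators acting on the qubits in `S`. -/
def supportedOn (S : Finset ι) : Submodule (ZMod 2) (ι ⊕ ι → ZMod 2) where
  carrier := {v | ∀ i ∉ S, v (Sum.inl i) = 0 ∧ v (Sum.inr i) = 0}
  zero_mem' := fun _ _ => ⟨rfl, rfl⟩
  add_mem' := fun hv hw i hi => by simp [hv i hi, hw i hi]
  smul_mem' := fun t v hv i hi => by simp [hv i hi]

/-- The form is nondegenerate on each subset of qubits, because the partner of a basis vector lives
on the same qubit. -/
theorem exists_symp_eq_one_of_supportedOn {S : Finset ι} {v : ι ⊕ ι → ZMod 2}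
    (hS : v ∈ supportedOn S) (hv : v ≠ 0) : ∃ w ∈ supportedOn S, symp w v = 1 := by
  obtain ⟨j, hj⟩ := Function.ne_iff.1 hv
  have h1 : v j = 1 := (zmod_two_eq_zero_or_one _).resolve_left hj
  cases j with
  | inl i =>
    refine ⟨Pi.single (Sum.inr i) 1, fun k hk => ?_, by rw [symp_comm, symp_single_inr, h1]⟩
    have hik : i ≠ k := by rintro rfl; exact hj (hS i hk).1
    simp [hik.symm]
  | inr i =>
    refine ⟨Pi.single (Sum.inl i) 1, fun k hk => ?_, by rw [symp_comm, symp_single_inl, h1]⟩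
    have hik : i ≠ k := by rintro rfl; exact hj (hS i hk).2
    simp [hik.symm]

/-- If x detects v and y detects w, then one of x, y and x + y detects both. -/
theorem exists_symp_eq_one_pair {S : Finset ι} {v w : ι ⊕ ι → ZMod 2} (hvS : v ∈ supportedOn S)
    (hwS : w ∈ supportedOn S) (hv : v ≠ 0) (hw : w ≠ 0) :
    ∃ z ∈ supportedOn S, symp z v = 1 ∧ symp z w = 1 := by
  obtain ⟨x, hxS, hx⟩ := exists_symp_eq_one_of_supportedOn hvS hv
  obtain ⟨y, hyS, hy⟩ := exists_symp_eq_one_of_supportedOn hwS hw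
  rcases zmod_two_eq_zero_or_one (symp x w) with h1 | h1
  · rcases zmod_two_eq_zero_or_one (symp y v) with h2 | h2
    · exact ⟨x + y, add_mem hxS hyS, by rw [symp_add_left, hx, h2, add_zero],
        by rw [symp_add_left, hy, h1, zero_add]⟩
    · exact ⟨y, hyS, h2, hy⟩
  · exact ⟨x, hxS, hx, h1⟩

/-- Enlarging the set of qubits on which all transvections are available. -/
theorem transvection_mem_insert {G : Subgroup (Matrix.symplecticGroup ι (ZMod 2))} {S : Finset ι}
    {i : ι} (hi : i ∉ S) (hS : ∀ v ∈ supportedOn S, v ≠ 0 → transvection v ∈ G)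
    (he : transvection (Pi.single (Sum.inl i) 1) ∈ G)
    (hf : transvection (Pi.single (Sum.inr i) 1) ∈ G)
    (hw : ∃ w ∈ supportedOn S, w ≠ 0 ∧ transvection (w + Pi.single (Sum.inl i) 1) ∈ G) :
    ∀ v ∈ supportedOn (insert i S), v ≠ 0 → transvection v ∈ G := by
  obtain ⟨w, hwS, hw0, hw⟩ := hw
  set e : ι ⊕ ι → ZMod 2 := Pi.single (Sum.inl i) 1 with he_def
  set f : ι ⊕ ι → ZMod 2 := Pi.single (Sum.inr i) 1 with hf_def
  have hSe (v) (hv : v ∈ supportedOn S) : symp v e = 0 := by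
    rw [he_def, symp_single_inl, (hv i hi).2]
  have hSf (v) (hv : v ∈ supportedOn S) : symp v f = 0 := by
    rw [hf_def, symp_single_inr, (hv i hi).1]
  have hef : symp e f = 1 := by rw [hf_def, symp_single_inr]; simp [e]
  -- Combining the centers z + v and v + e cancels v; the two centers pair to symp z v = 1.
  have hmove (v z) (hvS : v ∈ supportedOn S) (hzS : z ∈ supportedOn S) (hzv : symp z v = 1)
      (hv : transvection (v + e) ∈ G) : transvection (z + e) ∈ G := by
    have hne : z + v ≠ 0 := by
      intro h
      rw [add_eq_iff_eq_add, zero_add] at h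
      rw [h, symp_self] at hzv
      exact zero_ne_one hzv
    have h1 := transvection_add_mem (hS _ (add_mem hzS hvS) hne) hv (by
      rw [symp_add_left, symp_add_right, symp_add_right, hSe z hzS, hSe v hvS, symp_self, hzv]
      simp)
    have h2 : z + v + (v + e) = z + e := by
      rw [add_assoc, ← add_assoc v, ZModModule.add_self, zero_add]
    rwa [h2] at h1
  -- Any two nonzero vectors on S have a common z pairing to 1 with both, so two moves carry w + e
  -- to v + e.
  have hSE (v) (hvS : v ∈ supportedOn S) (hv0 : v ≠ 0) : transvection (v + e) ∈ G := by
    obtain ⟨z, hzS, hz1, hz2⟩ := exists_symp_eq_one_pair hwS hvS hw0 hv0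
    exact hmove z v hzS hvS (by rw [symp_comm, hz2]) (hmove w z hwS hzS hz1 hw)
  have hSEF (v) (hvS : v ∈ supportedOn S) (hv0 : v ≠ 0) : transvection (v + e + f) ∈ G :=
    transvection_add_mem (hSE v hvS hv0) hf (by rw [symp_add_left, hSf v hvS, hef, zero_add])
  have hSF (v) (hvS : v ∈ supportedOn S) (hv0 : v ≠ 0) : transvection (v + f) ∈ G := by
    have h1 := transvection_add_mem (hSEF v hvS hv0) he (by
      rw [symp_add_left, symp_add_left, hSe v hvS, symp_self, symp_comm, hef]; simp)
    have h2 : v + e + f + e = v + f := by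
      rw [add_right_comm, add_assoc v, ZModModule.add_self, add_zero]
    rwa [h2] at h1
  intro v hv hv0
  -- Split off the part of v on the new qubit i; the cases below run over the four possible parts.
  obtain ⟨u, huS, hu⟩ : ∃ u ∈ supportedOn S,
      v = u + v (Sum.inl i) • e + v (Sum.inr i) • f := by
    refine ⟨v + v (Sum.inl i) • e + v (Sum.inr i) • f, fun k hk => ?_, ?_⟩
    · by_cases hki : k = i
      · subst hki
        simp [e, f, CharTwo.add_self_eq_zero]
      · have := hv k (by simp [hki, hk])
        simp [e, f, hki, this]
    · set a := v (Sum.inl i) • e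
      set b := v (Sum.inr i) • f
      have h1 : v + a + b + a + b = v + (a + a) + (b + b) := by abel
      rw [h1, ZModModule.add_self, ZModModule.add_self, add_zero, add_zero]
  rw [hu]
  by_cases hu0 : u = 0
  · subst hu0
    rcases zmod_two_eq_zero_or_one (v (Sum.inl i)) with h1 | h1 <;>
      rcases zmod_two_eq_zero_or_one (v (Sum.inr i)) with h2 | h2
    · rw [h1, h2] at hu; simp at hu; exact absurd hu hv0
    · simpa [h1, h2] using hf
    · simpa [h1, h2] using he
    · simpa [h1, h2] using transvection_add_mem he hf hef
  · rcases zmod_two_eq_zero_or_one (v (Sum.inl i)) with h1 | h1 <;>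
      rcases zmod_two_eq_zero_or_one (v (Sum.inr i)) with h2 | h2
    · simpa [h1, h2] using hS u huS hu0
    · simpa [h1, h2] using hSF u huS hu0
    · simpa [h1, h2] using hSE u huS hu0
    · simpa [h1, h2] using hSEF u huS hu0

end Transvections

/-- A chain of transvections that generates the symplectic group. -/
theorem eq_top_of_transvection_chain {n : ℕ}
    {G : Subgroup (Matrix.symplecticGroup (Fin n) (ZMod 2))}
    (h : ∀ s, transvection (Pi.single s 1) ∈ G)
    (h' : ∀ i j : Fin n, (i : ℕ) + 1 = j →
      transvection (Pi.single (Sum.inl i) 1 + Pi.single (Sum.inl j) 1) ∈ G) : G = ⊤ := by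
  -- Qubits are added one at a time: all transvections supported on the first k qubits lie in G.
  have key (k : ℕ) (hk : k ≤ n) : ∀ v ∈ supportedOn (Finset.univ.filter fun i : Fin n => i < k),
      v ≠ 0 → transvection v ∈ G := by
    induction k with
    | zero =>
      intro v hv hv0
      refine absurd (funext fun s => ?_) hv0
      cases s with
      | inl i => exact (hv i (by simp)).1
      | inr i => exact (hv i (by simp)).2
    | succ k ih =>
      have hins : (Finset.univ.filter fun i : Fin n => i < k + 1) =
          insert ⟨k, hk⟩ (Finset.univ.filter fun i : Fin n => i < k) := by
        ext i
        simp [Fin.ext_iff]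
        omega
      rw [hins]
      rcases Nat.eq_zero_or_pos k with rfl | hpos
      · intro v hv hv0
        have hz (i : Fin n) (hi : (i : ℕ) ≠ 0) := hv i (by simp [Fin.ext_iff, hi])
        have hv' : v = v (Sum.inl ⟨0, hk⟩) • Pi.single (Sum.inl ⟨0, hk⟩) 1 +
            v (Sum.inr ⟨0, hk⟩) • Pi.single (Sum.inr ⟨0, hk⟩) 1 := by
          funext s
          rcases s with i | i <;> by_cases hi : (i : ℕ) = 0
          · obtain rfl : i = ⟨0, hk⟩ := Fin.ext hi
            simp
          · simp [Fin.ext_iff, hi, hz i hi]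
          · obtain rfl : i = ⟨0, hk⟩ := Fin.ext hi
            simp
          · simp [Fin.ext_iff, hi, hz i hi]
        rcases zmod_two_eq_zero_or_one (v (Sum.inl ⟨0, hk⟩)) with h1 | h1 <;>
          rcases zmod_two_eq_zero_or_one (v (Sum.inr ⟨0, hk⟩)) with h2 | h2 <;>
          rw [h1, h2] at hv'
        · simp at hv'; exact absurd hv' hv0
        · rw [hv']; simpa using h (Sum.inr ⟨0, hk⟩)
        · rw [hv']; simpa using h (Sum.inl ⟨0, hk⟩)
        · rw [hv', one_smul, one_smul]
          exact transvection_add_mem (h _) (h _) (by rw [symp_single_inr]; simp)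
      -- The link between the old qubits and qubit k is the Z-vector of qubit k - 1, which exists
      -- since k is positive here.
      · refine transvection_mem_insert (by simp) (ih (by omega)) (h _) (h _)
          ⟨Pi.single (Sum.inl ⟨k - 1, by omega⟩) 1, fun i hi => ?_, ?_,
            h' _ _ (by simp; omega)⟩
        · have : i ≠ ⟨k - 1, by omega⟩ := by
            rintro rfl
            simp at hi
            omega
          simp [this]
        · simp
  refine eq_top_of_transvection_mem fun v hv => key n le_rfl v ?_ hv
  intro i hi
  simp at hi

/-! ### Linear, diagonal and Hadamard gates and their symplectic images. -/

section Gates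

variable {ι : Type*} [Fintype ι] [DecidableEq ι]

/-- The gate that sends `|v⟩` to `|P v⟩`. -/
def linearGate (P : Matrix ι ι (ZMod 2)) : Operator ι :=
  Matrix.of fun u v => if u = P *ᵥ v then 1 else 0

theorem mul_linearGate_apply {κ : Type*} (A : Matrix κ (ι → ZMod 2) ℂ) (P : Matrix ι ι (ZMod 2))
    (u : κ) (v : ι → ZMod 2) : (A * linearGate P) u v = A u (P *ᵥ v) := by
  simp [Matrix.mul_apply, linearGate]

theorem linearGate_mul (P Q : Matrix ι ι (ZMod 2)) :
    linearGate P * linearGate Q = linearGate (P * Q) := by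
  ext u v
  rw [mul_linearGate_apply, linearGate, linearGate, Matrix.of_apply, Matrix.of_apply,
    Matrix.mulVec_mulVec]

theorem linearGate_one : linearGate (1 : Matrix ι ι (ZMod 2)) = 1 := by
  ext u v
  simp [linearGate, Matrix.one_apply]

theorem mulVec_eq_iff {P Q : Matrix ι ι (ZMod 2)} (h : P * Q = 1) {u v : ι → ZMod 2} :
    u = P *ᵥ v ↔ v = Q *ᵥ u := by
  constructor
  · rintro rfl
    rw [Matrix.mulVec_mulVec, mul_eq_one_comm.1 h, Matrix.one_mulVec]
  · rintro rfl
    rw [Matrix.mulVec_mulVec, h, Matrix.one_mulVec]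

theorem linearGate_conjTranspose {P Q : Matrix ι ι (ZMod 2)} (h : P * Q = 1) :
    (linearGate P)ᴴ = linearGate Q := by
  ext u v
  simp only [linearGate, Matrix.conjTranspose_apply, Matrix.of_apply, mulVec_eq_iff h]
  split_ifs <;> simp

theorem linearGate_mem_unitary {P Q : Matrix ι ι (ZMod 2)} (h : P * Q = 1) :
    linearGate P ∈ Matrix.unitaryGroup (ι → ZMod 2) ℂ := by
  rw [Matrix.mem_unitaryGroup_iff, Matrix.star_eq_conjTranspose, linearGate_conjTranspose h,
    linearGate_mul, h, linearGate_one]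

/-- The gate `|v⟩ ↦ |P v⟩` as a unitary, with `Q` the inverse of `P`. -/
def linearUnitary (P Q : Matrix ι ι (ZMod 2)) (h : P * Q = 1) : UnitaryOp ι :=
  ⟨linearGate P, linearGate_mem_unitary h⟩

/-- The symplectic matrix of the gate `|v⟩ ↦ |P v⟩`. -/
def linearSymplectic (P Q : Matrix ι ι (ZMod 2)) (h : P * Q = 1) :
    Matrix.symplecticGroup ι (ZMod 2) :=
  ⟨Matrix.fromBlocks Qᵀ 0 0 P, by
    have h' : Qᵀ * Pᵀ = 1 := by rw [← Matrix.transpose_mul, h, Matrix.transpose_one]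
    rw [SymplecticGroup.mem_iff, Matrix.J, Matrix.fromBlocks_multiply,
      Matrix.fromBlocks_transpose, Matrix.fromBlocks_multiply]
    simp [h, h']⟩

/-- X-exponents transform by P, and Z-exponents by the inverse transpose so that the pairing z·v is
kept; no phase arises. -/
theorem isSymplecticImage_linear (P Q : Matrix ι ι (ZMod 2)) (h : P * Q = 1) :
    IsSymplecticImage (linearUnitary P Q h) (linearSymplectic P Q h) := by
  refine isSymplecticImage_of_mul fun v => ⟨1, ?_⟩
  obtain ⟨z, x, rfl⟩ : ∃ z x, v = Sum.elim z x := ⟨_, _, (Sum.elim_comp_inl_inr v).symm⟩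
  have hM : (linearSymplectic P Q h).1 *ᵥ Sum.elim z x = Sum.elim (Qᵀ *ᵥ z) (P *ᵥ x) := by
    simp [linearSymplectic, Matrix.fromBlocks_mulVec]
  rw [hM, ← pauli_eq_pauliVec, ← pauli_eq_pauliVec, one_smul]
  ext u v
  change (linearGate P * pauli x z) u v = (pauli (P *ᵥ x) (Qᵀ *ᵥ z) * linearGate P) u v
  rw [mul_linearGate_apply, mul_pauli_apply, pauli_apply, linearGate, Matrix.of_apply,
    Matrix.mulVec_add]
  split_ifs
  · rw [Matrix.mulVec_transpose, ← Matrix.dotProduct_mulVec, Matrix.mulVec_mulVec,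
      mul_eq_one_comm.1 h, Matrix.one_mulVec, one_mul]
  · rw [zero_mul]

theorem diagonal_mem_unitary {f : (ι → ZMod 2) → ℂ} (hf : ∀ v, f v * star (f v) = 1) :
    Matrix.diagonal f ∈ Matrix.unitaryGroup (ι → ZMod 2) ℂ := by
  rw [Matrix.mem_unitaryGroup_iff, Matrix.star_eq_conjTranspose, Matrix.diagonal_conjTranspose,
    Matrix.diagonal_mul_diagonal, ← Matrix.diagonal_one]
  exact congrArg _ (funext hf)

/-- A diagonal gate as a unitary. -/
def diagonalUnitary (f : (ι → ZMod 2) → ℂ) (hf : ∀ v, f v * star (f v) = 1) : UnitaryOp ι :=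
  ⟨Matrix.diagonal f, diagonal_mem_unitary hf⟩

/-- The symplectic matrix of a diagonal gate whose phase has the polar form `B`. -/
def diagonalSymplectic (B : Matrix ι ι (ZMod 2)) (hB : Bᵀ = B) :
    Matrix.symplecticGroup ι (ZMod 2) :=
  ⟨Matrix.fromBlocks 1 B 0 1, by
    rw [SymplecticGroup.mem_iff, Matrix.J, Matrix.fromBlocks_multiply,
      Matrix.fromBlocks_transpose, Matrix.fromBlocks_multiply]
    simp [hB]⟩

/-- Moving the gate past X^x produces f(v + x)/f(v) = f(x)(-1)^(v·Bx), a phase times Z^(Bx). Only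
the polar form B of the phase survives in the symplectic image. -/
theorem isSymplecticImage_diagonal {f : (ι → ZMod 2) → ℂ} (hf : ∀ v, f v * star (f v) = 1)
    {B : Matrix ι ι (ZMod 2)} (hB : Bᵀ = B)
    (h : ∀ v x, f (v + x) = f v * f x * sgn (v ⬝ᵥ (B *ᵥ x))) :
    IsSymplecticImage (diagonalUnitary f hf) (diagonalSymplectic B hB) := by
  refine isSymplecticImage_of_mul fun v => ⟨f (v ∘ Sum.inr), ?_⟩
  obtain ⟨z, x, rfl⟩ : ∃ z x, v = Sum.elim z x := ⟨_, _, (Sum.elim_comp_inl_inr v).symm⟩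
  have hM : (diagonalSymplectic B hB).1 *ᵥ Sum.elim z x = Sum.elim (z + B *ᵥ x) x := by
    simp [diagonalSymplectic, Matrix.fromBlocks_mulVec]
  rw [hM, ← pauli_eq_pauliVec, ← pauli_eq_pauliVec, Sum.elim_comp_inr]
  ext u v
  change (Matrix.diagonal f * pauli x z) u v =
    f x * (pauli x (z + B *ᵥ x) * Matrix.diagonal f) u v
  rw [Matrix.diagonal_mul, Matrix.mul_diagonal, pauli_apply, pauli_apply]
  split_ifs with hu
  · rw [hu, h, add_dotProduct, sgn_add, dotProduct_comm v]; ring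
  · simp

open Classical in
-- Orthogonality of characters on the subspace C.
theorem sum_sgn_dotProduct (C : Submodule (ZMod 2) (ι → ZMod 2)) (a : ι → ZMod 2) :
    ∑ w, (if w ∈ C then sgn (a ⬝ᵥ w) else 0) =
      if ∀ w ∈ C, a ⬝ᵥ w = 0 then (Nat.card C : ℂ) else 0 := by
  split_ifs with h
  · have h1 (w : ι → ZMod 2) : (if w ∈ C then sgn (a ⬝ᵥ w) else 0) = if w ∈ C then 1 else 0 := by
      split_ifs with hw
      · rw [h w hw, sgn_zero]
      · rfl
    rw [Finset.sum_congr rfl fun w _ => h1 w, Finset.sum_boole, Nat.card_eq_fintype_card,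
      Fintype.card_subtype]
  · push Not at h
    obtain ⟨c, hc, hac⟩ := h
    have hac1 : a ⬝ᵥ c = 1 := (zmod_two_eq_zero_or_one _).resolve_left hac
    -- Translation by c preserves C and flips every sign, so the sum equals its negative.
    have h1 := Equiv.sum_comp (Equiv.addRight c) fun w => if w ∈ C then sgn (a ⬝ᵥ w) else 0
    simp only [Equiv.coe_addRight, Submodule.add_mem_iff_left C hc, dotProduct_add, hac1, sgn_add,
      sgn_one, mul_neg, mul_one] at h1
    have h2 (w : ι → ZMod 2) : (if w ∈ C then -sgn (a ⬝ᵥ w) else 0) =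
        -(if w ∈ C then sgn (a ⬝ᵥ w) else 0) := by split_ifs <;> simp
    rw [Finset.sum_congr rfl fun w _ => h2 w, Finset.sum_neg_distrib, neg_eq_self] at h1
    exact h1

theorem hadamardAll_apply (u v : ι → ZMod 2) :
    hadamardAll ι u v = ((Real.sqrt 2 : ℂ)⁻¹) ^ Fintype.card ι * sgn (u ⬝ᵥ v) := rfl

theorem sqrt_two_inv_mul_self : ((Real.sqrt 2 : ℂ)⁻¹) * ((Real.sqrt 2 : ℂ)⁻¹) = 2⁻¹ := by
  rw [← mul_inv, ← Complex.ofReal_mul, Real.mul_self_sqrt (by norm_num)]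
  norm_num

theorem hadamardAll_conjTranspose : (hadamardAll ι)ᴴ = hadamardAll ι := by
  ext u v
  rw [Matrix.conjTranspose_apply, hadamardAll_apply, hadamardAll_apply, star_mul', star_sgn,
    dotProduct_comm]
  simp

/-- The product of the matrix with itself is a character sum over the whole space. -/
theorem hadamardAll_mem_unitary :
    hadamardAll ι ∈ Matrix.unitaryGroup (ι → ZMod 2) ℂ := by
  classical
  rw [Matrix.mem_unitaryGroup_iff, Matrix.star_eq_conjTranspose, hadamardAll_conjTranspose]
  ext u v
  have h1 := sum_sgn_dotProduct (⊤ : Submodule (ZMod 2) (ι → ZMod 2)) (u + v)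
  simp only [Submodule.mem_top, if_true, forall_const] at h1
  have h2 : (∀ w : ι → ZMod 2, (u + v) ⬝ᵥ w = 0) ↔ u = v := by
    rw [dotProduct_eq_zero_iff, add_eq_iff_eq_add, zero_add]
  simp only [h2] at h1
  have h3 : (hadamardAll ι * hadamardAll ι) u v =
      (2⁻¹ : ℂ) ^ Fintype.card ι * ∑ w, sgn ((u + v) ⬝ᵥ w) := by
    rw [Matrix.mul_apply, Finset.mul_sum]
    refine Finset.sum_congr rfl fun w _ => ?_
    rw [hadamardAll_apply, hadamardAll_apply, add_dotProduct, sgn_add, dotProduct_comm w,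
      ← sqrt_two_inv_mul_self, mul_pow]
    ring
  rw [h3, h1, Matrix.one_apply]
  split_ifs
  · have h4 : Nat.card {_x : ι → ZMod 2 // True} = 2 ^ Fintype.card ι := by
      rw [Nat.card_congr (Equiv.subtypeUnivEquiv fun _ => trivial), Nat.card_eq_fintype_card,
        Fintype.card_fun, ZMod.card]
    rw [h4, Nat.cast_pow, ← mul_pow]
    norm_num
  · simp

/-- Hadamard gates on all qubits, as a unitary. -/
noncomputable def hadamardUnitary (ι : Type*) [Fintype ι] [DecidableEq ι] : UnitaryOp ι :=
  ⟨hadamardAll ι, hadamardAll_mem_unitary⟩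

/-- The symplectic matrix of Hadamard gates on all qubits. -/
def hadamardSymplectic (ι : Type*) [Fintype ι] [DecidableEq ι] :
    Matrix.symplecticGroup ι (ZMod 2) :=
  ⟨Matrix.fromBlocks 0 1 1 0, by
    rw [SymplecticGroup.mem_iff, Matrix.J, Matrix.fromBlocks_multiply,
      Matrix.fromBlocks_transpose, Matrix.fromBlocks_multiply]
    ext i j
    rcases i with i | i <;> rcases j with j | j <;> simp [ZModModule.neg_eq_self]⟩

/-- Exchanging X and Z reverses their order; restoring it costs the sign of z·x. -/
theorem isSymplecticImage_hadamard :
    IsSymplecticImage (hadamardUnitary ι) (hadamardSymplectic ι) := by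
  refine isSymplecticImage_of_mul fun v => ⟨sgn ((v ∘ Sum.inl) ⬝ᵥ (v ∘ Sum.inr)), ?_⟩
  obtain ⟨z, x, rfl⟩ : ∃ z x, v = Sum.elim z x := ⟨_, _, (Sum.elim_comp_inl_inr v).symm⟩
  have hM : (hadamardSymplectic ι).1 *ᵥ Sum.elim z x = Sum.elim x z := by
    simp [hadamardSymplectic, Matrix.fromBlocks_mulVec]
  rw [hM, ← pauli_eq_pauliVec, ← pauli_eq_pauliVec, Sum.elim_comp_inr, Sum.elim_comp_inl]
  ext u v
  change (hadamardAll ι * pauli x z) u v = sgn (z ⬝ᵥ x) * (pauli z x * hadamardAll ι) u v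
  rw [mul_pauli_apply, pauli_mul_apply, hadamardAll_apply, hadamardAll_apply, dotProduct_add,
    dotProduct_add, add_dotProduct, sgn_add, sgn_add, sgn_add, dotProduct_comm x u,
    dotProduct_comm x z]
  linear_combination (-((Real.sqrt 2 : ℂ)⁻¹) ^ Fintype.card ι * sgn (u ⬝ᵥ v) * sgn (u ⬝ᵥ x) *
    sgn (z ⬝ᵥ v)) * sgn_mul_self (z ⬝ᵥ x)

theorem cnot_eq_linearGate (i j : ι) : cnot i j = linearGate (1 + Matrix.single j i 1) := by
  ext u v
  have h : (1 + Matrix.single j i 1 : Matrix ι ι (ZMod 2)) *ᵥ v = v + Pi.single j (v i) := by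
    rw [Matrix.add_mulVec, Matrix.one_mulVec, Matrix.single_mulVec]
    congr 1
    ext k
    simp [Pi.single_apply, Function.update_apply]
  simp only [cnot, linearGate, Matrix.of_apply, h]

theorem cnot_matrix_mul_self {i j : ι} (hij : i ≠ j) :
    (1 + Matrix.single j i 1 : Matrix ι ι (ZMod 2)) * (1 + Matrix.single j i 1) = 1 := by
  have h : (Matrix.single j i 1 : Matrix ι ι (ZMod 2)) * Matrix.single j i 1 = 0 :=
    Matrix.single_mul_single_of_ne _ _ _ _ hij _
  rw [mul_add, mul_one, add_mul, one_mul, h, add_zero, add_assoc, ZModModule.add_self, add_zero]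

theorem cz_phase_add (i j : ι) (v x : ι → ZMod 2) :
    sgn ((v + x) i * (v + x) j) = sgn (v i * v j) * sgn (x i * x j) *
      sgn (v ⬝ᵥ ((Matrix.single i j 1 + Matrix.single j i 1) *ᵥ x)) := by
  have h : v ⬝ᵥ ((Matrix.single i j 1 + Matrix.single j i 1) *ᵥ x) = v i * x j + v j * x i := by
    rw [Matrix.add_mulVec, dotProduct_add, Matrix.single_mulVec, Matrix.single_mulVec]
    simp [dotProduct, Function.update_apply]
  rw [h, ← sgn_add, ← sgn_add, Pi.add_apply, Pi.add_apply]
  congr 1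
  ring

theorem cz_matrix_transpose (i j : ι) :
    (Matrix.single i j 1 + Matrix.single j i 1 : Matrix ι ι (ZMod 2))ᵀ =
      Matrix.single i j 1 + Matrix.single j i 1 := by
  rw [Matrix.transpose_add, Matrix.transpose_single, Matrix.transpose_single, add_comm]

theorem sgn_mul_star (t : ZMod 2) : sgn t * star (sgn t) = 1 := by rw [star_sgn, sgn_mul_self]

end Gates

open Mirror

/-! ### The edges, the duality and the supports of the checks as finite tables. -/

section Geometry

/-- Induction on the length of words in the three reflections. -/
theorem symGroup_induction {p : SymGroup → Prop} (one : p 1)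
    (mul : ∀ t g, p g → p (mirror t * g)) (g : SymGroup) : p g := by
  have hg : g ∈ Subgroup.closure (Set.range mirror) := by
    have h := PresentedGroup.closure_range_of relators
    change Subgroup.closure (Set.range mirror) = ⊤ at h
    rw [h]
    trivial
  induction hg using Subgroup.closure_induction_left with
  | one => exact one
  | mul_left x hx y _ hy =>
    obtain ⟨t, rfl⟩ := hx
    exact mul t y hy
  | inv_mul_cancel x hx y _ hy =>
    obtain ⟨t, rfl⟩ := hx
    rw [mirror_inv]
    exact mul t y hy

theorem qubitPerm_eq_permHom (g : SymGroup) : qubitPerm g = permHom g := by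
  ext1 i
  change edgeEquiv.symm (g • edge i) = permHom g i
  rw [permHom_edge, Equiv.symm_apply_eq]
  rfl

theorem qubitPerm_mirror (t : Mirror) : qubitPerm (mirror t) = edgePerm t := by
  rw [qubitPerm_eq_permHom, permHom_mirror]

/-- The fold is equivariant along `foldHom`, so it rewrites a word for an edge letter by letter. The
image is found by table lookups alone. -/
theorem foldEdge_foldr (l : List Mirror) :
    foldEdge (l.foldr (fun t e => mirror t • e) ((1 : SymGroup) : Edge)) =
      edge (l.foldr (fun t i => edgeTable (foldMirror t) i) 0) := by
  have hsmul (g : SymGroup) (e : Edge) : foldEdge (g • e) = foldHom g • foldEdge e := by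
    obtain ⟨h, rfl⟩ := QuotientGroup.mk_surjective e
    exact congrArg QuotientGroup.mk (map_mul foldHom g h)
  induction l with
  | nil => exact congrArg QuotientGroup.mk (map_one foldHom)
  | cons t l ih =>
    rw [List.foldr_cons, hsmul, ih, foldHom_mirror, mirror_smul_edge]
    rfl

/-- The duality `τ₀` on the edge numbers. -/
def dualTable : Fin 30 → Fin 30 :=
  ![0, 1, 3, 2, 4, 6, 5, 11, 10, 9, 8, 7, 17, 14, 13, 16, 15, 12, 24, 19, 23, 22, 21, 20, 18, 27,
    28, 25, 26, 29]

theorem tau0_apply (i : Fin 30) : tau0 i = dualTable i := by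
  change edgeEquiv.symm (foldEdge (edge i)) = dualTable i
  rw [Equiv.symm_apply_eq, edge, foldEdge_foldr]
  change edge _ = edge _
  congr 1
  revert i
  decide +kernel

theorem tau0_tau0 (i : Fin 30) : tau0 (tau0 i) = i := by
  rw [tau0_apply, tau0_apply]
  revert i
  decide +kernel

/-- Incidence of a cell with the edges in terms of the edge numbers. -/
theorem incident_edge_iff {H : Subgroup SymGroup} (g : SymGroup) (i : Fin 30) :
    Incident (g : SymGroup ⧸ H) (edge i) ↔ ∃ h ∈ H, permHom (g * h) 0 = i := by
  have hmk (k : SymGroup) : (k : Edge) = edge (permHom k 0) := by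
    rw [← permHom_edge]
    change _ = ((k * 1 : SymGroup) : Edge)
    rw [mul_one]
  constructor
  · rintro ⟨k, hk, hi⟩
    refine ⟨g⁻¹ * k, QuotientGroup.eq.1 hk.symm, ?_⟩
    rw [mul_inv_cancel_left]
    exact edge_bijective.1 ((hmk k).symm.trans hi)
  · rintro ⟨h, hh, rfl⟩
    exact ⟨g * h, by rw [eq_comm, QuotientGroup.eq]; simpa using hh, hmk _⟩

/-- A table `cell` of supports that is permuted by the reflections and whose first member is the
orbit of the base edge under two reflections lists the edge sets of all cells of one kind. -/
theorem range_incident_eq (s : Mirror) (cell : Fin 12 → Finset (Fin 30))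
    (hbase : cell 0 = {0, edgePerm b 0, edgePerm s (edgePerm b 0),
      edgePerm b (edgePerm s (edgePerm b 0)),
      edgePerm s (edgePerm b (edgePerm s (edgePerm b 0)))})
    (hstable : ∀ i ∈ cell 0, edgePerm b i ∈ cell 0 ∧ edgePerm s i ∈ cell 0)
    (hperm : ∀ t k, ∃ k', ∀ i, edgePerm t i ∈ cell k' ↔ i ∈ cell k)
    (hconn : ∀ k, k ≠ 0 → ∃ k' < k, ∃ t, ∀ i, edgePerm t i ∈ cell k ↔ i ∈ cell k')
    (H : Subgroup SymGroup) (hH : H = Subgroup.closure {mirror b, mirror s}) :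
    (∀ P : SymGroup ⧸ H, ∃ k, ∀ i, Incident P (edge i) ↔ i ∈ cell k) ∧
      ∀ k, ∃ P : SymGroup ⧸ H, ∀ i, Incident P (edge i) ↔ i ∈ cell k := by
  have hb : mirror b ∈ H := by rw [hH]; exact Subgroup.subset_closure (by simp)
  have hs : mirror s ∈ H := by rw [hH]; exact Subgroup.subset_closure (by simp)
  -- The base cell: its edges are the orbit of edge 0 under b and s. Stability of the first row
  -- bounds the orbit from above, and five explicit words reach every listed edge.
  have h0 (i : Fin 30) : Incident ((1 : SymGroup) : SymGroup ⧸ H) (edge i) ↔ i ∈ cell 0 := by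
    rw [incident_edge_iff]
    constructor
    · rintro ⟨h, hh, rfl⟩
      rw [one_mul]
      have key : ∀ i ∈ cell 0, permHom h i ∈ cell 0 := by
        rw [hH] at hh
        induction hh using Subgroup.closure_induction_left with
        | one => intro i hi; simpa using hi
        | mul_left x hx y _ hy =>
          intro i hi
          rw [map_mul, Equiv.Perm.mul_apply]
          rcases hx with rfl | rfl <;> rw [permHom_mirror]
          exacts [(hstable _ (hy i hi)).1, (hstable _ (hy i hi)).2]
        | inv_mul_cancel x hx y _ hy =>
          intro i hi
          rw [map_mul, Equiv.Perm.mul_apply]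
          rcases hx with rfl | rfl <;> rw [mirror_inv, permHom_mirror]
          exacts [(hstable _ (hy i hi)).1, (hstable _ (hy i hi)).2]
      exact key 0 (by rw [hbase]; simp)
    · intro hi
      rw [hbase] at hi
      simp only [Finset.mem_insert, Finset.mem_singleton] at hi
      rcases hi with rfl | rfl | rfl | rfl | rfl
      · exact ⟨1, one_mem _, by simp⟩
      · exact ⟨mirror b, hb, by simp [permHom_mirror]⟩
      · exact ⟨mirror s * mirror b, mul_mem hs hb, by simp [permHom_mirror]⟩
      · exact ⟨mirror b * (mirror s * mirror b), mul_mem hb (mul_mem hs hb),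
          by simp [permHom_mirror]⟩
      · exact ⟨mirror s * (mirror b * (mirror s * mirror b)), 
          mul_mem hs (mul_mem hb (mul_mem hs hb)), by simp [permHom_mirror]⟩
  have hmul (t : Mirror) (g : SymGroup) (i : Fin 30) :
      Incident ((mirror t * g : SymGroup) : SymGroup ⧸ H) (edge (edgePerm t i)) ↔
        Incident (g : SymGroup ⧸ H) (edge i) := by
    rw [incident_edge_iff, incident_edge_iff]
    simp only [mul_assoc, map_mul permHom (mirror t), permHom_mirror, Equiv.Perm.mul_apply,
      EmbeddingLike.apply_eq_iff_eq]
  have hinv (t : Mirror) (i : Fin 30) : edgePerm t (edgePerm t i) = i := by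
    revert i; cases t <;> decide
  -- Every cell is a translate of the base cell, so induction on words finds its row. Conversely,
  -- each later row is one reflection away from an earlier one, so induction on k realizes every row
  -- by a cell.
  constructor
  · intro P
    obtain ⟨g, rfl⟩ := QuotientGroup.mk_surjective P
    induction g using symGroup_induction with
    | one => exact ⟨0, h0⟩
    | mul t g ih =>
      obtain ⟨k, hk⟩ := ih
      obtain ⟨k', hk'⟩ := hperm t k
      refine ⟨k', fun i => ?_⟩
      have := hmul t g (edgePerm t i)
      rw [hinv] at this
      exact this.trans ((hk _).trans (by rw [← hk', hinv]))
  · intro k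
    induction k using WellFoundedLT.induction with
    | ind k ih =>
      by_cases hk0 : k = 0
      · exact ⟨_, hk0 ▸ h0⟩
      · obtain ⟨k', hlt, t, ht⟩ := hconn k hk0
        obtain ⟨P, hP⟩ := ih k' hlt
        obtain ⟨g, rfl⟩ := QuotientGroup.mk_surjective P
        refine ⟨((mirror t * g : SymGroup) : SymGroup ⧸ H), fun i => ?_⟩
        have := hmul t g (edgePerm t i)
        rw [hinv] at this
        exact this.trans ((hP _).trans (by rw [← ht, hinv]))

open Classical in
/-- A table of supports that is permuted by the reflections and whose first member is the orbit of
the base edge under two reflections lists the supports of the checks of one kind. -/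
theorem range_check_eq (s : Mirror) (cell : Fin 12 → Fin 30 → ZMod 2)
    (hbase : (Finset.univ.filter fun i => cell 0 i = 1) =
      {0, edgePerm b 0, edgePerm s (edgePerm b 0), edgePerm b (edgePerm s (edgePerm b 0)),
        edgePerm s (edgePerm b (edgePerm s (edgePerm b 0)))})
    (hstable : ∀ i, cell 0 i = 1 → cell 0 (edgePerm b i) = 1 ∧ cell 0 (edgePerm s i) = 1)
    (hperm : ∀ k, (∃ k', ∀ i, cell k' (edgePerm a i) = cell k i) ∧
      (∃ k', ∀ i, cell k' (edgePerm b i) = cell k i) ∧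
        ∃ k', ∀ i, cell k' (edgePerm c i) = cell k i)
    (hconn : ∀ k, k ≠ 0 → ∃ k' < k, (∀ i, cell k (edgePerm a i) = cell k' i) ∨
      (∀ i, cell k (edgePerm b i) = cell k' i) ∨ ∀ i, cell k (edgePerm c i) = cell k' i)
    (H : Subgroup SymGroup) (hH : H = Subgroup.closure {mirror b, mirror s}) :
    Set.range (fun (P : SymGroup ⧸ H) i => if Incident P (edge i) then (1 : ZMod 2) else 0) =
      Set.range cell := by
  obtain ⟨h1, h2⟩ := range_incident_eq s (fun k => Finset.univ.filter fun i => cell k i = 1) hbase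
    (by simpa using hstable)
    (by
      intro t k
      obtain ⟨⟨k1, h1⟩, ⟨k2, h2⟩, k3, h3⟩ := hperm k
      cases t
      exacts [⟨k1, fun i => by simp [h1]⟩, ⟨k2, fun i => by simp [h2]⟩,
        ⟨k3, fun i => by simp [h3]⟩])
    (by
      intro k hk
      obtain ⟨k', hlt, h | h | h⟩ := hconn k hk
      exacts [⟨k', hlt, a, fun i => by simp [h]⟩, ⟨k', hlt, b, fun i => by simp [h]⟩,
        ⟨k', hlt, c, fun i => by simp [h]⟩]) H hH
  have key (P : SymGroup ⧸ H) (k : Fin 12)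
      (h : ∀ i, Incident P (edge i) ↔ i ∈ Finset.univ.filter fun i => cell k i = 1) :
      (fun i => if Incident P (edge i) then (1 : ZMod 2) else 0) = cell k := by
    funext i
    have h' := h i
    simp only [Finset.mem_filter, Finset.mem_univ, true_and] at h'
    rcases zmod_two_eq_zero_or_one (cell k i) with h | h <;> simp [h', h]
  ext w
  constructor
  · rintro ⟨P, rfl⟩
    obtain ⟨k, hk⟩ := h1 P
    exact ⟨k, (key P k hk).symm⟩
  · rintro ⟨k, rfl⟩
    obtain ⟨P, hP⟩ := h2 k
    exact ⟨P, key P k hP⟩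

/-- The edges, counted from 1, at the twelve vertices. -/
def starList : Fin 12 → List ℕ :=
  ![[1, 2, 4, 7, 12], [1, 3, 5, 9, 15], [2, 6, 10, 16, 23], [3, 8, 13, 19, 28],
    [4, 11, 16, 18, 29], [6, 8, 21, 25, 26], [5, 14, 19, 20, 24], [7, 9, 17, 24, 29],
    [11, 14, 17, 22, 27], [10, 18, 22, 26, 30], [12, 15, 23, 25, 28], [13, 20, 21, 27, 30]]

/-- The supports of the `X`-checks. -/
def star (k : Fin 12) : Fin 30 → ZMod 2 := chain (starList k)

/-- The supports of the `Z`-checks. -/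
def pentagon (k : Fin 12) : Fin 30 → ZMod 2 := fun i => star k (dualTable i)

theorem range_xCheck : Set.range xCheck = Set.range star :=
  range_check_eq c star (by decide +kernel) (by decide +kernel) (by decide +kernel)
    (by decide +kernel) _ rfl

/-- The base face is stabilized by a and b, so the second reflection is a instead of c. -/
theorem range_zCheck : Set.range zCheck = Set.range pentagon :=
  range_check_eq a pentagon (by decide +kernel) (by decide +kernel) (by decide +kernel)
    (by decide +kernel) _ (by rw [Set.pair_comm])

end Geometry

/-! ### Homological decomposition, the encoder and permutation gates. -/

section Encoding

/-- The vector whose support is given by the binary digits of `n`. -/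
def digits (n : ℕ) : Fin 30 → ZMod 2 := fun i => if n.testBit i then 1 else 0

/-- Functionals that are dual to the first eleven stars and vanish on the logical `X`-operators. -/
def starDual (k : Fin 11) : Fin 30 → ZMod 2 :=
  digits (![168772, 336147781, 722899922, 336147777, 726834126, 1058878962, 1062813143, 168708,
    1062812110, 1059042451, 727094226] k)

/-- Vectors that are dual to the first eleven pentagons and orthogonal to the logical
`Z`-operators. -/
def pentagonDual (k : Fin 11) : Fin 30 → ZMod 2 :=
  digits (![355172480, 730341376, 36880384, 1068204032, 1000423424, 8388608, 697483264, 372998144,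
    697466880, 532234240, 34783232] k)

theorem transpose_mul_mulVec {κ m : Type*} [Fintype κ] [Fintype m] (M N : κ → m → ZMod 2)
    (w : m → ZMod 2) :
    ((Matrix.of M)ᵀ * Matrix.of N) *ᵥ w = ∑ k, (N k ⬝ᵥ w) • M k := by
  rw [← Matrix.mulVec_mulVec, Matrix.mulVec_transpose, Matrix.vecMul_eq_sum]
  rfl

set_option maxRecDepth 10000 in
-- Eleven stars, eight logical X-supports and eleven vectors dual to pentagons form a basis of the
-- 30-dimensional space, displayed with its dual basis. One star is redundant, because every edge
-- lies in two stars and all twelve therefore sum to zero.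
theorem decomposition_matrix :
    (1 : Matrix (Fin 30) (Fin 30) (ZMod 2)) =
      (Matrix.of fun k : Fin 11 => star k.castSucc)ᵀ * Matrix.of starDual +
        (Matrix.of logicalX)ᵀ * Matrix.of logicalZ +
          (Matrix.of pentagonDual)ᵀ * Matrix.of fun k : Fin 11 => pentagon k.castSucc := by
  have h : ∀ i j : Fin 30, (if i = j then (1 : ZMod 2) else 0) =
      ∑ k : Fin 11, star k.castSucc i * starDual k j + ∑ k, logicalX k i * logicalZ k j +
        ∑ k : Fin 11, pentagonDual k i * pentagon k.castSucc j := by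
    decide +kernel
  ext i j
  rw [Matrix.one_apply, h]
  rfl

theorem decomposition (w : Fin 30 → ZMod 2) :
    w = ∑ k : Fin 11, (starDual k ⬝ᵥ w) • star k.castSucc +
      ∑ i, (logicalZ i ⬝ᵥ w) • logicalX i +
        ∑ k : Fin 11, (pentagon k.castSucc ⬝ᵥ w) • pentagonDual k := by
  conv_lhs => rw [← Matrix.one_mulVec w, decomposition_matrix]
  rw [Matrix.add_mulVec, Matrix.add_mulVec, transpose_mul_mulVec, transpose_mul_mulVec,
    transpose_mul_mulVec]

theorem coboundaries_eq : coboundaries = Submodule.span (ZMod 2) (Set.range star) := by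
  rw [coboundaries, range_xCheck]

theorem star_mem (k : Fin 12) : star k ∈ coboundaries := by
  rw [coboundaries_eq]
  exact Submodule.subset_span ⟨k, rfl⟩

theorem pentagon_dot_star (k l : Fin 12) : pentagon k ⬝ᵥ star l = 0 := by
  revert k l; decide +kernel

theorem logicalZ_dot_star (i : Fin 8) (l : Fin 12) : logicalZ i ⬝ᵥ star l = 0 := by
  revert i l; decide +kernel

theorem pentagon_dot_logicalX (k : Fin 12) (i : Fin 8) : pentagon k ⬝ᵥ logicalX i = 0 := by
  revert k i; decide +kernel

theorem coboundaries_le {S : Submodule (ZMod 2) (Fin 30 → ZMod 2)} (h : ∀ k, star k ∈ S) :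
    coboundaries ≤ S := by
  rw [coboundaries_eq, Submodule.span_le]
  rintro _ ⟨k, rfl⟩
  exact h k

/-- The vectors orthogonal to `a`. -/
def orthogonal (a : Fin 30 → ZMod 2) : Submodule (ZMod 2) (Fin 30 → ZMod 2) where
  carrier := {w | a ⬝ᵥ w = 0}
  zero_mem' := dotProduct_zero a
  add_mem' := fun {v w} hv hw => by
    change a ⬝ᵥ (v + w) = 0
    rw [dotProduct_add, show a ⬝ᵥ v = 0 from hv, show a ⬝ᵥ w = 0 from hw, add_zero]
  smul_mem' := fun t v hv => by
    change a ⬝ᵥ (t • v) = 0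
    rw [dotProduct_smul, show a ⬝ᵥ v = 0 from hv, smul_zero]

theorem dot_eq_zero_of_mem_coboundaries {a w : Fin 30 → ZMod 2} (h : ∀ k, a ⬝ᵥ star k = 0)
    (hw : w ∈ coboundaries) : a ⬝ᵥ w = 0 :=
  coboundaries_le (S := orthogonal a) h hw

/-- When all pentagon and logical parities vanish, only stars remain in the decomposition.
Membership in a span thus becomes a list of parity conditions. -/
theorem mem_coboundaries_iff {w : Fin 30 → ZMod 2} :
    w ∈ coboundaries ↔ (∀ k, pentagon k ⬝ᵥ w = 0) ∧ ∀ i, logicalZ i ⬝ᵥ w = 0 := by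
  constructor
  · exact fun h => ⟨fun k => dot_eq_zero_of_mem_coboundaries (pentagon_dot_star k) h,
      fun i => dot_eq_zero_of_mem_coboundaries (logicalZ_dot_star i) h⟩
  · rintro ⟨h1, h2⟩
    rw [decomposition w]
    simp only [h1, h2, zero_smul, Finset.sum_const_zero, add_zero]
    exact Submodule.sum_mem _ fun k _ => Submodule.smul_mem _ _ (star_mem _)

/-- The support of the logical `X`-operator with exponents `u`. -/
def logicalVec (u : Fin 8 → ZMod 2) : Fin 30 → ZMod 2 := ∑ i, u i • logicalX i

theorem dot_logicalVec (a : Fin 30 → ZMod 2) (u : Fin 8 → ZMod 2) :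
    a ⬝ᵥ logicalVec u = ∑ i, u i * (a ⬝ᵥ logicalX i) := by
  simp only [logicalVec, dotProduct_sum, dotProduct_smul, smul_eq_mul]

theorem logicalVec_add (u v : Fin 8 → ZMod 2) :
    logicalVec (u + v) = logicalVec u + logicalVec v := by
  simp only [logicalVec, Pi.add_apply, add_smul, Finset.sum_add_distrib]

theorem pentagon_dot_logicalVec (k : Fin 12) (u : Fin 8 → ZMod 2) :
    pentagon k ⬝ᵥ logicalVec u = 0 := by
  simp [dot_logicalVec, pentagon_dot_logicalX]

theorem logicalZ_dot_logicalVec (i : Fin 8) (u : Fin 8 → ZMod 2) :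
    logicalZ i ⬝ᵥ logicalVec u = u i := by
  rw [dot_logicalVec]
  simp [dotProduct_comm (logicalZ i), logicalX_dot_logicalZ]

/-- Cohomology classes are separated by their parities against the logical Z-supports. This
describes the support of each encoded state. -/
theorem sub_logicalVec_mem_iff {w : Fin 30 → ZMod 2} {u : Fin 8 → ZMod 2} :
    w - logicalVec u ∈ coboundaries ↔
      (∀ k, pentagon k ⬝ᵥ w = 0) ∧ (fun i => logicalZ i ⬝ᵥ w) = u := by
  simp only [mem_coboundaries_iff, dotProduct_sub, pentagon_dot_logicalVec,
    logicalZ_dot_logicalVec, sub_zero, sub_eq_zero, funext_iff]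

theorem starDual_dot_star (k l : Fin 11) :
    starDual k ⬝ᵥ star l.castSucc = if l = k then 1 else 0 := by
  revert k l; decide +kernel

/-- The functionals `starDual` serve as coordinates with respect to the first eleven stars. -/
theorem card_coboundaries : Nat.card coboundaries = 2 ^ 11 := by
  have e : coboundaries ≃ (Fin 11 → ZMod 2) :=
    { toFun := fun w k => starDual k ⬝ᵥ (w : Fin 30 → ZMod 2)
      invFun := fun u => ⟨∑ k : Fin 11, u k • star k.castSucc,
        Submodule.sum_mem _ fun k _ => Submodule.smul_mem _ _ (star_mem _)⟩
      left_inv := fun w => by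
        obtain ⟨h1, h2⟩ := mem_coboundaries_iff.1 w.2
        apply Subtype.ext
        conv_rhs => rw [decomposition w.1]
        simp only [h1, h2, zero_smul, Finset.sum_const_zero, add_zero]
      right_inv := fun u => by
        funext k
        simp [dotProduct_sum, dotProduct_smul, starDual_dot_star] }
  rw [Nat.card_congr e, Nat.card_eq_fintype_card, Fintype.card_fun, ZMod.card, Fintype.card_fin]

/-- The normalization of the encoded states. -/
noncomputable def encoderNorm : ℂ := ((Real.sqrt (Nat.card coboundaries) : ℂ))⁻¹

theorem encoderNorm_mul_self : encoderNorm * encoderNorm * Nat.card coboundaries = 1 := by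
  have h : (Nat.card coboundaries : ℝ) ≠ 0 := by rw [card_coboundaries]; norm_num
  rw [encoderNorm, ← mul_inv, ← Complex.ofReal_mul, Real.mul_self_sqrt (Nat.cast_nonneg _)]
  rw [Complex.ofReal_natCast]
  exact inv_mul_cancel₀ (by exact_mod_cast h)

theorem encoderNorm_ne_zero : encoderNorm ≠ 0 := by
  intro h
  have := encoderNorm_mul_self
  simp [h] at this

theorem star_encoderNorm : Star.star encoderNorm = encoderNorm := by
  simp [encoderNorm]

open Classical in
theorem encoder_apply (w : Fin 30 → ZMod 2) (u : Fin 8 → ZMod 2) :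
    encoder w u = if w - logicalVec u ∈ coboundaries then encoderNorm else 0 := rfl

open Classical in
theorem encoder_apply' (w : Fin 30 → ZMod 2) (u : Fin 8 → ZMod 2) :
    encoder w u = if (∀ k, pentagon k ⬝ᵥ w = 0) ∧ (fun i => logicalZ i ⬝ᵥ w) = u
      then encoderNorm else 0 := by
  rw [encoder_apply, if_congr sub_logicalVec_mem_iff rfl rfl]

open Classical in
theorem sum_coset {M : Type*} [AddCommMonoid M] (u : Fin 8 → ZMod 2)
    (g : (Fin 30 → ZMod 2) → M) :
    ∑ w, (if w - logicalVec u ∈ coboundaries then g w else 0) =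
      ∑ w, if w ∈ coboundaries then g (w + logicalVec u) else 0 := by
  rw [← Equiv.sum_comp (Equiv.addRight (logicalVec u))]
  simp only [Equiv.coe_addRight, add_sub_cancel_right]

/-- Each column is constant on a coset of the coboundaries and normalized by its size, and different
columns live on different cosets. -/
theorem encoder_isometry : encoderᴴ * encoder = 1 := by
  classical
  ext u v
  rw [Matrix.mul_apply, Matrix.one_apply]
  simp only [Matrix.conjTranspose_apply]
  split_ifs with huv
  · subst huv
    have h1 (w : Fin 30 → ZMod 2) : Star.star (encoder w u) * encoder w u =
        if w - logicalVec u ∈ coboundaries then encoderNorm * encoderNorm else 0 := by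
      rw [encoder_apply]
      split_ifs <;> simp [star_encoderNorm]
    rw [Finset.sum_congr rfl fun w _ => h1 w, sum_coset u fun _ => encoderNorm * encoderNorm]
    have h2 := sum_sgn_dotProduct coboundaries 0
    simp only [zero_dotProduct, sgn_zero, implies_true, if_true] at h2
    rw [← encoderNorm_mul_self, ← h2, Finset.mul_sum]
    simp
  -- A vector w determines u through its logical parities, so in each summand at least one of the
  -- two factors vanishes.
  · refine Finset.sum_eq_zero fun w _ => ?_
    rw [encoder_apply', encoder_apply']
    by_cases h1 : (∀ k, pentagon k ⬝ᵥ w = 0) ∧ (fun i => logicalZ i ⬝ᵥ w) = u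
    · rw [if_neg (c := _ ∧ _ = v) fun h2 => huv (h1.2.symm.trans h2.2), mul_zero]
    · rw [if_neg h1, star_zero, zero_mul]

/-- An isometry can be cancelled on the left. -/
theorem Implements.unique {W : Operator (Fin 30)} {U V : UnitaryOp (Fin 8)}
    (hU : Implements W U) (hV : Implements W V) : U = V := by
  apply Subtype.ext
  have h : encoder * (U : Operator (Fin 8)) = encoder * (V : Operator (Fin 8)) :=
    Eq.trans (Eq.symm hU) hV
  have h1 := congrArg (fun A => encoderᴴ * A) h
  simpa only [← Matrix.mul_assoc, encoder_isometry, Matrix.one_mul] using h1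

theorem permGate_mul_apply {κ : Type*} (σ : Equiv.Perm (Fin 30))
    (A : Matrix (Fin 30 → ZMod 2) κ ℂ) (w : Fin 30 → ZMod 2) (u : κ) :
    (permGate σ * A) w u = A (fun i => w (σ i)) u := by
  have h (v : Fin 30 → ZMod 2) : (∀ i, w (σ i) = v i) ↔ (fun i => w (σ i)) = v :=
    funext_iff.symm
  simp [Matrix.mul_apply, permGate, h]

/-- A permutation of the qubits that preserves the coboundaries implements a linear gate. -/
theorem implements_permGate {σ : Equiv.Perm (Fin 30)} (hσ : ∀ i, σ (σ i) = i)
    {P Q : Matrix (Fin 8) (Fin 8) (ZMod 2)} (h : P * Q = 1)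
    (hstar : ∀ k, ∃ k', ∀ i, star k (σ i) = star k' i)
    (hpent : ∀ k j, pentagon k ⬝ᵥ (fun i => logicalX j (σ i)) = 0)
    (hP : ∀ i j, logicalZ i ⬝ᵥ (fun l => logicalX j (σ l)) = P i j) :
    Implements (permGate σ) (linearUnitary P Q h) := by
  classical
  have hC (w : Fin 30 → ZMod 2) (hw : w ∈ coboundaries) :
      (fun i => w (σ i)) ∈ coboundaries := by
    let T : (Fin 30 → ZMod 2) →ₗ[ZMod 2] (Fin 30 → ZMod 2) := LinearMap.funLeft _ _ σ
    refine coboundaries_le (S := coboundaries.comap T) (fun k => ?_) hw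
    obtain ⟨k', hk'⟩ := hstar k
    have : T (star k) = star k' := funext hk'
    rw [Submodule.mem_comap, this]
    exact star_mem k'
  -- The permuted representative is still a cocycle and has parities P u, so it lies in the class of
  -- P u.
  have hL (u : Fin 8 → ZMod 2) :
      (fun i => logicalVec u (σ i)) - logicalVec (P *ᵥ u) ∈ coboundaries := by
    have h1 (a : Fin 30 → ZMod 2) : a ⬝ᵥ (fun i => logicalVec u (σ i)) =
        ∑ j, u j * (a ⬝ᵥ fun i => logicalX j (σ i)) := by
      have : (fun i => logicalVec u (σ i)) = ∑ j, u j • fun i => logicalX j (σ i) := by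
        ext i; simp [logicalVec]
      rw [this]
      simp only [dotProduct_sum, dotProduct_smul, smul_eq_mul]
    rw [sub_logicalVec_mem_iff]
    refine ⟨fun k => by simp [h1, hpent], funext fun i => ?_⟩
    rw [h1]
    simp only [hP]
    exact Finset.sum_congr rfl fun j _ => mul_comm _ _
  rw [Implements]
  ext w u
  rw [permGate_mul_apply]
  change _ = (encoder * linearGate P) w u
  rw [mul_linearGate_apply, encoder_apply, encoder_apply]
  refine if_congr ?_ rfl rfl
  -- Since σ is an involution, it can be moved from one term of the difference to the other.
  have h2 : (fun i => w (σ i)) - logicalVec u ∈ coboundaries ↔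
      w - (fun i => logicalVec u (σ i)) ∈ coboundaries := by
    constructor <;> intro h
    · convert hC _ h using 1
      ext i
      simp [hσ]
    · convert hC _ h using 1
      ext i
      simp [hσ]
  rw [h2, ← Submodule.add_mem_iff_left coboundaries (hL u), sub_add_sub_cancel]

end Encoding

/-! ### The phase-type gate of an involution as a quadratic phase. -/

section PhaseGate

variable {ι : Type*} [Fintype ι] [LinearOrder ι]

/-- The diagonal entries of `phaseGate`. -/
noncomputable def phaseFun (τ : Equiv.Perm ι) (A : Finset ι) (v : ι → ZMod 2) : ℂ :=
  (∏ i with τ i = i, (if i ∈ A then Complex.I else -Complex.I) ^ (v i).val) *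
    ∏ i with i < τ i, sgn (v i * v (τ i))

theorem phaseGate_eq_diagonal (τ : Equiv.Perm ι) (A : Finset ι) :
    phaseGate τ A = Matrix.diagonal (phaseFun τ A) := rfl

/-- Only 1 + 1 = 0 produces a correction, e² = -1. It is the same for e = i and e = -i, which is why
the choice of S or S† does not affect the polar form. -/
theorem pow_val_add {e : ℂ} (he : e * e = -1) (s t : ZMod 2) :
    e ^ (s + t).val = e ^ s.val * e ^ t.val * sgn (s * t) := by
  have h : (1 : ZMod 2) + 1 = 0 := by decide
  rcases zmod_two_eq_zero_or_one s with rfl | rfl <;>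
    rcases zmod_two_eq_zero_or_one t with rfl | rfl <;>
    simp [sgn_zero, sgn_one, h, ZMod.val_one, he]

theorem pow_val_mul_star {e : ℂ} (he : e * Star.star e = 1) (s : ZMod 2) :
    e ^ s.val * Star.star (e ^ s.val) = 1 := by
  rw [star_pow, ← mul_pow, he, one_pow]

theorem ite_I_mul_self (p : Prop) [Decidable p] :
    (if p then Complex.I else -Complex.I) * (if p then Complex.I else -Complex.I) = -1 := by
  split_ifs <;> simp

theorem ite_I_mul_star (p : Prop) [Decidable p] :
    (if p then Complex.I else -Complex.I) * Star.star (if p then Complex.I else -Complex.I) =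
      1 := by
  split_ifs <;> simp

theorem phaseFun_mul_star (τ : Equiv.Perm ι) (A : Finset ι) (v : ι → ZMod 2) :
    phaseFun τ A v * Star.star (phaseFun τ A v) = 1 := by
  rw [phaseFun, star_mul', star_prod, star_prod, mul_mul_mul_comm, ← Finset.prod_mul_distrib,
    ← Finset.prod_mul_distrib,
    Finset.prod_congr rfl fun i _ => pow_val_mul_star (ite_I_mul_star (i ∈ A)) (v i),
    Finset.prod_congr rfl fun i _ => sgn_mul_star (v i * v (τ i))]
  simp

/-- The sum splits into fixed points and two-element orbits, each orbit indexed by its smaller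
member. -/
theorem sum_mul_involution {τ : Equiv.Perm ι} (hτ : ∀ i, τ (τ i) = i) (v x : ι → ZMod 2) :
    v ⬝ᵥ (fun i => x (τ i)) = ∑ i with τ i = i, v i * x i +
      ∑ i with i < τ i, (v i * x (τ i) + x i * v (τ i)) := by
  have h1 : ∑ i with ¬ τ i = i, v i * x (τ i) =
      ∑ i with i < τ i, v i * x (τ i) + ∑ i with τ i < i, v i * x (τ i) := by
    rw [← Finset.sum_union]
    · refine Finset.sum_congr ?_ fun _ _ => rfl
      ext i
      simp only [Finset.mem_filter, Finset.mem_union, Finset.mem_univ, true_and]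
      rw [← ne_eq, ne_iff_lt_or_gt, or_comm]
    · rw [Finset.disjoint_filter]
      exact fun i _ h => h.not_gt
  -- Reindexing by τ turns terms at the larger member of an orbit into terms at the smaller one.
  have h2 : ∑ i with τ i < i, v i * x (τ i) = ∑ i with i < τ i, x i * v (τ i) := by
    refine Finset.sum_nbij' τ τ ?_ ?_ ?_ ?_ ?_
    · intro i hi; simpa [hτ] using hi
    · intro i hi; simpa [hτ] using hi
    · intro i _; exact hτ i
    · intro i _; exact hτ i
    · intro i _; rw [hτ, mul_comm]
  rw [dotProduct, ← Finset.sum_filter_add_sum_filter_not Finset.univ fun i => τ i = i, h1, h2,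
    Finset.sum_add_distrib]
  congr 1
  refine Finset.sum_congr rfl fun i hi => ?_
  rw [(Finset.mem_filter.1 hi).2]

/-- Fixed points contribute v_i x_i and controlled-Z pairs the two cross terms; together these are
the bilinear form of τ. -/
theorem phaseFun_add {τ : Equiv.Perm ι} (hτ : ∀ i, τ (τ i) = i) (A : Finset ι)
    (v x : ι → ZMod 2) : phaseFun τ A (v + x) =
      phaseFun τ A v * phaseFun τ A x * sgn (v ⬝ᵥ fun i => x (τ i)) := by
  rw [sum_mul_involution hτ, sgn_add, sgn_sum, sgn_sum, phaseFun, phaseFun, phaseFun]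
  have h1 : ∏ i with τ i = i, (if i ∈ A then Complex.I else -Complex.I) ^ ((v + x) i).val =
      (∏ i with τ i = i, (if i ∈ A then Complex.I else -Complex.I) ^ (v i).val) *
        (∏ i with τ i = i, (if i ∈ A then Complex.I else -Complex.I) ^ (x i).val) *
          ∏ i with τ i = i, sgn (v i * x i) := by
    rw [← Finset.prod_mul_distrib, ← Finset.prod_mul_distrib]
    exact Finset.prod_congr rfl fun i _ => pow_val_add (ite_I_mul_self _) _ _
  have h2 : ∏ i with i < τ i, sgn ((v + x) i * (v + x) (τ i)) =
      (∏ i with i < τ i, sgn (v i * v (τ i))) * (∏ i with i < τ i, sgn (x i * x (τ i))) *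
          ∏ i with i < τ i, sgn (v i * x (τ i) + x i * v (τ i)) := by
    rw [← Finset.prod_mul_distrib, ← Finset.prod_mul_distrib]
    refine Finset.prod_congr rfl fun i _ => ?_
    rw [← sgn_add, ← sgn_add, Pi.add_apply, Pi.add_apply]
    congr 1
    ring
  rw [h1, h2]
  ring

end PhaseGate

/-! ### Logical action of the fold-transversal gates. -/

section Duality

/-- The intersection form of the duality on the logical qubits. -/
def dualForm : Matrix (Fin 8) (Fin 8) (ZMod 2) :=
  !![1, 0, 0, 0, 0, 0, 0, 0;
    0, 1, 0, 0, 0, 0, 0, 0;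
    0, 0, 1, 0, 0, 0, 0, 0;
    0, 0, 0, 1, 0, 0, 0, 0;
    0, 0, 0, 0, 1, 0, 0, 0;
    0, 0, 0, 0, 0, 1, 0, 0;
    0, 0, 0, 0, 0, 0, 1, 1;
    0, 0, 0, 0, 0, 0, 1, 0]

/-- The inverse of `dualForm`. -/
def dualFormInv : Matrix (Fin 8) (Fin 8) (ZMod 2) :=
  !![1, 0, 0, 0, 0, 0, 0, 0;
    0, 1, 0, 0, 0, 0, 0, 0;
    0, 0, 1, 0, 0, 0, 0, 0;
    0, 0, 0, 1, 0, 0, 0, 0;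
    0, 0, 0, 0, 1, 0, 0, 0;
    0, 0, 0, 0, 0, 1, 0, 0;
    0, 0, 0, 0, 0, 0, 0, 1;
    0, 0, 0, 0, 0, 0, 1, 1]

theorem dualForm_mul_inv : dualForm * dualFormInv = 1 := by decide +kernel

theorem dualForm_transpose : dualFormᵀ = dualForm := by decide +kernel

/-- The images of the logical `X`-operators under the duality. -/
def dualLogicalX (j : Fin 8) : Fin 30 → ZMod 2 := fun l => logicalX j (dualTable l)

theorem logicalX_comp_tau0 (j : Fin 8) : (fun l => logicalX j (tau0 l)) = dualLogicalX j := by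
  funext l
  rw [tau0_apply]
  rfl

theorem logicalX_dot_dual (i j : Fin 8) :
    (logicalX i ⬝ᵥ fun l => logicalX j (tau0 l)) = dualForm i j := by
  have h : (Matrix.of fun i j => logicalX i ⬝ᵥ dualLogicalX j) = dualForm := by decide +kernel
  rw [logicalX_comp_tau0, ← h]
  rfl

theorem star_dot_dual (k : Fin 12) (j : Fin 8) :
    (star k ⬝ᵥ fun l => logicalX j (tau0 l)) = 0 := by
  rw [logicalX_comp_tau0]
  revert k j
  decide +kernel

theorem star_tau0 (k : Fin 12) : (fun i => star k (tau0 i)) = pentagon k := by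
  funext i
  rw [tau0_apply]
  rfl

theorem dot_tau0_comm (v x : Fin 30 → ZMod 2) :
    (v ⬝ᵥ fun i => x (tau0 i)) = (fun i => v (tau0 i)) ⬝ᵥ x := by
  rw [dotProduct, ← Equiv.sum_comp tau0]
  simp only [tau0_tau0]
  rfl

theorem logicalVec_comp_tau0 (u : Fin 8 → ZMod 2) :
    (fun i => logicalVec u (tau0 i)) = ∑ j, u j • fun i => logicalX j (tau0 i) := by
  ext i; simp [logicalVec]

/-- In the decomposition of a cocycle the pentagon part is absent, and stars are orthogonal to the
τ₀-images of logical X-supports. The form therefore descends to `dualForm` on cohomology. -/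
theorem cocycle_dot_dual {w : Fin 30 → ZMod 2} (hw : ∀ k, pentagon k ⬝ᵥ w = 0)
    (u : Fin 8 → ZMod 2) : (w ⬝ᵥ fun i => logicalVec u (tau0 i)) =
      (fun i => logicalZ i ⬝ᵥ w) ⬝ᵥ (dualForm *ᵥ u) := by
  have h (j : Fin 8) : (w ⬝ᵥ fun i => logicalX j (tau0 i)) =
      ∑ i, (logicalZ i ⬝ᵥ w) * dualForm i j := by
    conv_lhs => rw [decomposition w]
    simp only [hw, zero_smul, Finset.sum_const_zero, add_zero, add_dotProduct, sum_dotProduct,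
      smul_dotProduct, star_dot_dual, logicalX_dot_dual, smul_eq_mul, mul_zero, zero_add,
      Finset.sum_const_zero]
  rw [logicalVec_comp_tau0, Matrix.dotProduct_mulVec]
  simp only [dotProduct_sum, dotProduct_smul, h, smul_eq_mul]
  exact Finset.sum_congr rfl fun j _ => mul_comm _ _

theorem logicalVec_dot_dual (u v : Fin 8 → ZMod 2) :
    (logicalVec u ⬝ᵥ fun i => logicalVec v (tau0 i)) = u ⬝ᵥ (dualForm *ᵥ v) := by
  rw [cocycle_dot_dual (fun k => pentagon_dot_logicalVec k u)]
  simp only [logicalZ_dot_logicalVec]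

/-- The transversal Hadamard turns a coset sum over coboundaries into a signed sum over their
orthogonal complement, and τ₀ maps this complement back to the cocycles. The remaining sign is the
logical Hadamard sign at `dualForm` applied to u. -/
theorem implements_hadamardGate :
    Implements (hadamardGate tau0)
      (hadamardUnitary (Fin 8) * linearUnitary dualForm dualFormInv dualForm_mul_inv) := by
  classical
  rw [Implements, Matrix.UnitaryGroup.mul_val]
  change _ = encoder * (hadamardAll (Fin 8) * linearGate dualForm)
  ext w u
  rw [hadamardGate, Matrix.mul_assoc, permGate_mul_apply, ← Matrix.mul_assoc,
    mul_linearGate_apply]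
  set s : ℂ := (Real.sqrt 2 : ℂ)⁻¹
  set w' : Fin 30 → ZMod 2 := fun i => w (tau0 i) with hw'
  -- Writing the coset as a translate of the coboundaries leaves one sign times a character sum.
  have h1 : (hadamardAll (Fin 30) * encoder) w' u = s ^ 30 * encoderNorm *
      (sgn (w' ⬝ᵥ logicalVec u) *
        if ∀ x ∈ coboundaries, w' ⬝ᵥ x = 0 then (Nat.card coboundaries : ℂ) else 0) := by
    have h2 (v : Fin 30 → ZMod 2) : hadamardAll (Fin 30) w' v * encoder v u =
        if v - logicalVec u ∈ coboundaries then s ^ 30 * encoderNorm * sgn (w' ⬝ᵥ v) else 0 := by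
      rw [hadamardAll_apply, encoder_apply, Fintype.card_fin]
      split_ifs
      · ring
      · rw [mul_zero]
    rw [Matrix.mul_apply, Finset.sum_congr rfl fun v _ => h2 v,
      sum_coset u fun v => s ^ 30 * encoderNorm * sgn (w' ⬝ᵥ v), ← sum_sgn_dotProduct,
      Finset.mul_sum, Finset.mul_sum]
    refine Finset.sum_congr rfl fun v _ => ?_
    split_ifs
    · rw [dotProduct_add, sgn_add]; ring
    · ring
  have h3 : (encoder * hadamardAll (Fin 8)) w (dualForm *ᵥ u) =
      if ∀ k, pentagon k ⬝ᵥ w = 0 then encoderNorm *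
        (s ^ 8 * sgn ((fun i => logicalZ i ⬝ᵥ w) ⬝ᵥ (dualForm *ᵥ u))) else 0 := by
    rw [Matrix.mul_apply]
    simp only [encoder_apply', hadamardAll_apply, Fintype.card_fin]
    split_ifs with h
    · simp [h, s]
    · simp [h]
  -- Because τ₀ exchanges stars and pentagons, w' is orthogonal to the coboundaries exactly when w
  -- is a cocycle.
  have h4 : (∀ x ∈ coboundaries, w' ⬝ᵥ x = 0) ↔ ∀ k, pentagon k ⬝ᵥ w = 0 := by
    have h5 (k : Fin 12) : w' ⬝ᵥ star k = pentagon k ⬝ᵥ w := by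
      rw [hw', ← dot_tau0_comm, star_tau0, dotProduct_comm]
    constructor
    · intro h k
      rw [← h5, h _ (star_mem k)]
    · exact fun h x hx => dot_eq_zero_of_mem_coboundaries (fun k => by rw [h5, h]) hx
  rw [h1, h3, if_congr h4 rfl rfl]
  split_ifs with h
  -- The 2¹¹ coboundaries cancel 22 of the 30 factors 1/√2, leaving the eight of the logical
  -- Hadamards.
  · have h6 : s ^ 30 * (Nat.card coboundaries : ℂ) = s ^ 8 := by
      have h7 : s * s = 2⁻¹ := sqrt_two_inv_mul_self
      rw [card_coboundaries, show s ^ 30 = s ^ 8 * (s * s) ^ 11 by ring, h7, mul_assoc]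
      norm_num
    rw [hw', ← dot_tau0_comm, cocycle_dot_dual h]
    linear_combination (encoderNorm *
      sgn ((fun i => logicalZ i ⬝ᵥ w) ⬝ᵥ (dualForm *ᵥ u))) * h6
  · ring

/-- The logical phases of the phase-type gate. -/
noncomputable def logicalPhase (A : Finset (Fin 30)) (u : Fin 8 → ZMod 2) : ℂ :=
  phaseFun tau0 A (logicalVec u)

theorem logicalPhase_mul_star (A : Finset (Fin 30)) (u : Fin 8 → ZMod 2) :
    logicalPhase A u * Star.star (logicalPhase A u) = 1 := phaseFun_mul_star _ _ _

theorem logicalPhase_add (A : Finset (Fin 30)) (u v : Fin 8 → ZMod 2) :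
    logicalPhase A (u + v) = logicalPhase A u * logicalPhase A v *
      sgn (u ⬝ᵥ (dualForm *ᵥ v)) := by
  rw [logicalPhase, logicalVec_add, phaseFun_add tau0_tau0, logicalVec_dot_dual]
  rfl

theorem pauli_mulVec_apply {ι : Type*} [Fintype ι] [DecidableEq ι] (x z : ι → ZMod 2)
    (ψ : (ι → ZMod 2) → ℂ) (u : ι → ZMod 2) :
    (pauli x z *ᵥ ψ) u = sgn (z ⬝ᵥ (u + x)) * ψ (u + x) := by
  have h := pauli_mul_apply (Matrix.of fun v (_ : Unit) => ψ v) x z u ()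
  rwa [Matrix.mul_apply] at h

/-- X-checks translate by stars, while Z-checks multiply by signs and so kill every basis state that
is not a cocycle. -/
theorem mem_codeSpace_iff {ψ : (Fin 30 → ZMod 2) → ℂ} : ψ ∈ codeSpace ↔
    (∀ k w, ψ (w + star k) = ψ w) ∧ ∀ k w, pentagon k ⬝ᵥ w ≠ 0 → ψ w = 0 := by
  have hX : (∀ P : Vertex, pauli (xCheck P) 0 *ᵥ ψ = ψ) ↔ ∀ k w, ψ (w + star k) = ψ w := by
    have h := range_xCheck
    rw [← Set.forall_mem_range (p := fun x => pauli x 0 *ᵥ ψ = ψ), h, Set.forall_mem_range]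
    simp only [funext_iff, pauli_mulVec_apply, zero_dotProduct, sgn_zero, one_mul]
  have hZ : (∀ P : Face, pauli 0 (zCheck P) *ᵥ ψ = ψ) ↔
      ∀ k w, pentagon k ⬝ᵥ w ≠ 0 → ψ w = 0 := by
    rw [← Set.forall_mem_range (p := fun z => pauli 0 z *ᵥ ψ = ψ), range_zCheck,
      Set.forall_mem_range]
    simp only [funext_iff, pauli_mulVec_apply, add_zero]
    refine forall_congr' fun k => forall_congr' fun w => ?_
    rcases zmod_two_eq_zero_or_one (pentagon k ⬝ᵥ w) with h | h <;>
      simp [h, sgn_zero, sgn_one, neg_eq_self]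
  exact and_congr hX hZ

theorem encoder_mem_codeSpace (u : Fin 8 → ZMod 2) : (fun w => encoder w u) ∈ codeSpace := by
  classical
  refine mem_codeSpace_iff.2 ⟨fun k w => ?_, fun k w hw => ?_⟩
  · rw [encoder_apply, encoder_apply, add_sub_right_comm]
    exact if_congr (Submodule.add_mem_iff_left _ (star_mem k)) rfl rfl
  · rw [encoder_apply', if_neg fun h => hw (h.1 k)]

/-- Preservation of the code space forces the phase to be invariant under translation by stars on
each encoded coset. The gate then multiplies an encoded basis state by the phase at its
representative. -/
theorem implements_phaseGate {A : Finset (Fin 30)}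
    (hA : IsEncodedLogicalGate (phaseGate tau0 A)) :
    Implements (phaseGate tau0 A)
      (diagonalUnitary (logicalPhase A) (logicalPhase_mul_star A)) := by
  classical
  have hstep (u : Fin 8 → ZMod 2) (w : Fin 30 → ZMod 2) (k : Fin 12)
      (hw : w - logicalVec u ∈ coboundaries) :
      phaseFun tau0 A (w + star k) = phaseFun tau0 A w := by
    have h1 := (mem_codeSpace_iff.1 (hA _ (encoder_mem_codeSpace u))).1 k w
    rw [phaseGate_eq_diagonal, Matrix.mulVec_diagonal, Matrix.mulVec_diagonal, encoder_apply,
      encoder_apply, if_pos hw, add_sub_right_comm,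
      if_pos (Submodule.add_mem _ hw (star_mem k))] at h1
    exact mul_right_cancel₀ encoderNorm_ne_zero h1
  -- The base point w varies in the induction over the span, since each translation must start from
  -- another point of the same coset.
  have hconst (u : Fin 8 → ZMod 2) (x : Fin 30 → ZMod 2) (hx : x ∈ coboundaries) :
      ∀ w, w - logicalVec u ∈ coboundaries → phaseFun tau0 A (w + x) = phaseFun tau0 A w := by
    rw [coboundaries_eq] at hx
    induction hx using Submodule.span_induction with
    | mem x hx =>
      obtain ⟨k, rfl⟩ := hx
      exact fun w hw => hstep u w k hw
    | zero => intro w _; rw [add_zero]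
    | add x y hx _ ihx ihy =>
      intro w hw
      rw [← add_assoc, ihy, ihx w hw]
      rw [add_sub_right_comm]
      rw [← coboundaries_eq] at hx
      exact Submodule.add_mem _ hw hx
    | smul t x _ ih =>
      intro w hw
      rcases zmod_two_eq_zero_or_one t with rfl | rfl
      · rw [zero_smul, add_zero]
      · rw [one_smul, ih w hw]
  rw [Implements, phaseGate_eq_diagonal]
  change _ = encoder * Matrix.diagonal (logicalPhase A)
  ext w u
  rw [Matrix.diagonal_mul, Matrix.mul_diagonal, encoder_apply]
  split_ifs with h
  · have h1 := hconst u _ h (logicalVec u) (by rw [sub_self]; exact zero_mem _)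
    rw [add_sub_cancel] at h1
    rw [h1, mul_comm]
    rfl
  · rw [mul_zero, zero_mul]

/-- Translating a cocycle w by a star changes the phase by its value at the star and by the sign of
w·pentagon, which is 1. Outside the cocycles the state vanishes. -/
theorem isEncodedLogicalGate_phaseGate {A : Finset (Fin 30)}
    (hA : ∀ k, phaseFun tau0 A (star k) = 1) : IsEncodedLogicalGate (phaseGate tau0 A) := by
  intro ψ hψ
  rw [mem_codeSpace_iff] at *
  rw [phaseGate_eq_diagonal]
  simp only [Matrix.mulVec_diagonal]
  refine ⟨fun k w => ?_, fun k w hw => by rw [hψ.2 k w hw, mul_zero]⟩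
  rw [phaseFun_add tau0_tau0, hA, mul_one, hψ.1, star_tau0, dotProduct_comm]
  rcases zmod_two_eq_zero_or_one (pentagon k ⬝ᵥ w) with h | h
  · rw [h, sgn_zero, mul_one]
  · rw [hψ.2 k w (by rw [h]; exact one_ne_zero), mul_zero, mul_zero]

/-- Collecting all factors as powers of i reduces statements about phases to natural number
arithmetic modulo 4. -/
theorem phaseFun_eq_I_pow (A : Finset (Fin 30)) (v : Fin 30 → ZMod 2) :
    phaseFun tau0 A v = Complex.I ^
      (∑ i with dualTable i = i, (if i ∈ A then 1 else 3) * (v i).val +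
        ∑ i with i < dualTable i, 2 * (v i * v (dualTable i)).val) := by
  have h3 : -Complex.I = Complex.I ^ 3 := by rw [Complex.I_pow_three]
  rw [phaseFun, pow_add, ← Finset.prod_pow_eq_pow_sum, ← Finset.prod_pow_eq_pow_sum]
  simp only [tau0_apply]
  congr 1
  · refine Finset.prod_congr rfl fun i _ => ?_
    split_ifs
    · rw [one_mul]
    · rw [h3, pow_mul]
  · refine Finset.prod_congr rfl fun i _ => ?_
    rw [pow_mul, Complex.I_sq, sgn]

theorem exists_isEncodedLogicalGate :
    ∃ A : Finset (Fin 30), IsEncodedLogicalGate (phaseGate tau0 A) := by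
  -- The fixed points of τ₀ are 0, 1, 4, 9, 19 and 29. Taking S at 0, 9, 19 and S† at the others
  -- gives phase 1 at every star.
  refine ⟨{0, 9, 19}, isEncodedLogicalGate_phaseGate fun k => ?_⟩
  have h : ∀ k, (∑ i with dualTable i = i,
      (if i ∈ ({0, 9, 19} : Finset (Fin 30)) then 1 else 3) * (star k i).val +
        ∑ i with i < dualTable i, 2 * (star k i * star k (dualTable i)).val) % 4 = 0 := by
    decide +kernel
  rw [phaseFun_eq_I_pow, ← Nat.div_add_mod (_ + _) 4, h k, add_zero, pow_mul,
    Complex.I_pow_four, one_pow]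

end Duality

/-! ### Computation with 16 × 16 matrices stored as binary columns. -/

section BitMatrices

/-- The binary digit that holds a coordinate of an exponent vector of eight qubits. -/
def bitIndex : Fin 8 ⊕ Fin 8 → ℕ := Sum.elim (fun i => i) fun i => 8 + i

/-- The exponent vector with binary digits `n`. -/
def ofBits (n : ℕ) : Fin 8 ⊕ Fin 8 → ZMod 2 := fun s => if n.testBit (bitIndex s) then 1 else 0

theorem ofBits_zero : ofBits 0 = 0 := by
  funext s
  simp [ofBits]

theorem ofBits_xor (m n : ℕ) : ofBits (m ^^^ n) = ofBits m + ofBits n := by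
  have h : (1 : ZMod 2) + 1 = 0 := by decide
  funext s
  simp only [ofBits, Nat.testBit_xor, Pi.add_apply]
  cases m.testBit (bitIndex s) <;> cases n.testBit (bitIndex s) <;> simp [h]

/-- The sum of the columns in a list that are selected by the binary digits of `n`. -/
def applyCols (l : List ℕ) : ℕ → ℕ :=
  List.rec (fun _ => 0) (fun c _ f n => Nat.xor (Nat.mul (Nat.mod n 2) c) (f (Nat.div n 2))) l

theorem applyCols_nil (n : ℕ) : applyCols [] n = 0 := rfl

theorem applyCols_cons (c : ℕ) (l : List ℕ) (n : ℕ) :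
    applyCols (c :: l) n = n % 2 * c ^^^ applyCols l (n / 2) := rfl

theorem applyCols_xor (l : List ℕ) (m n : ℕ) :
    applyCols l (m ^^^ n) = applyCols l m ^^^ applyCols l n := by
  induction l generalizing m n with
  | nil => simp [applyCols_nil]
  | cons c l ih =>
    have h1 : (m ^^^ n) % 2 * c = m % 2 * c ^^^ n % 2 * c := by
      have h2 : (m ^^^ n) % 2 = (m + n) % 2 := Nat.xor_mod_two_eq
      rcases Nat.mod_two_eq_zero_or_one m with hm | hm <;>
        rcases Nat.mod_two_eq_zero_or_one n with hn | hn <;>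
        rw [h2, Nat.add_mod, hm, hn] <;> simp
    rw [applyCols_cons, applyCols_cons, applyCols_cons, h1, Nat.xor_div_two, ih]
    ac_rfl

theorem applyCols_mod_two_mul (l : List ℕ) (m n : ℕ) :
    applyCols l (m % 2 * n) = m % 2 * applyCols l n := by
  have h0 : applyCols l 0 = 0 := by
    have := applyCols_xor l 0 0
    simpa using this
  rcases Nat.mod_two_eq_zero_or_one m with hm | hm <;> simp [hm, h0]

/-- Composition of matrices given by their columns. The recursor makes the kernel evaluate each
column before it is stored. -/
def mulCols (l m : List ℕ) : List ℕ :=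
  List.rec [] (fun c _ r => Nat.rec (0 :: r) (fun n _ => Nat.succ n :: r) (applyCols l c)) m

theorem mulCols_nil (l : List ℕ) : mulCols l [] = [] := rfl

theorem mulCols_cons (l : List ℕ) (c : ℕ) (m : List ℕ) :
    mulCols l (c :: m) = applyCols l c :: mulCols l m := by
  change Nat.rec (motive := fun _ => List ℕ) (0 :: mulCols l m)
    (fun n _ => Nat.succ n :: mulCols l m) (applyCols l c) = _
  cases applyCols l c <;> rfl

theorem applyCols_mulCols (l m : List ℕ) (n : ℕ) :
    applyCols (mulCols l m) n = applyCols l (applyCols m n) := by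
  induction m generalizing n with
  | nil =>
    have := applyCols_xor l 0 0
    simpa [mulCols_nil, applyCols_nil] using this.symm
  | cons c m ih =>
    rw [mulCols_cons, applyCols_cons, ih, applyCols_cons, applyCols_xor, applyCols_mod_two_mul]

/-- The matrix `M` has the columns `l`. -/
def IsCols (M : Matrix (Fin 8 ⊕ Fin 8) (Fin 8 ⊕ Fin 8) (ZMod 2)) (l : List ℕ) : Prop :=
  ∀ n, M *ᵥ ofBits n = ofBits (applyCols l n)

theorem IsCols.mul {M N : Matrix (Fin 8 ⊕ Fin 8) (Fin 8 ⊕ Fin 8) (ZMod 2)} {l m : List ℕ}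
    (hM : IsCols M l) (hN : IsCols N m) : IsCols (M * N) (mulCols l m) := by
  intro n
  rw [← Matrix.mulVec_mulVec, hN, hM, applyCols_mulCols]

/-- Unrolling the recursion: digit k of n decides whether column k is added. -/
theorem ofBits_applyCols (l : List ℕ) (n : ℕ) : ofBits (applyCols l n) =
    ∑ k ∈ Finset.range l.length, (if n.testBit k then (1 : ZMod 2) else 0) •
      ofBits (l.getD k 0) := by
  induction l generalizing n with
  | nil => simp [applyCols_nil, ofBits_zero]
  | cons c l ih =>
    rw [applyCols_cons, ofBits_xor, ih, List.length_cons, Finset.sum_range_succ', add_comm]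
    congr 1
    · refine Finset.sum_congr rfl fun k _ => ?_
      rw [Nat.testBit_succ, List.getD_cons_succ]
    · rw [Nat.testBit_zero, List.getD_cons_zero]
      rcases Nat.mod_two_eq_zero_or_one n with h | h <;> simp [h, ofBits_zero]

/-- The matrix with the columns `l`. -/
def colsMatrix (l : List ℕ) : Matrix (Fin 8 ⊕ Fin 8) (Fin 8 ⊕ Fin 8) (ZMod 2) :=
  Matrix.of fun t s => ofBits (l.getD (bitIndex s) 0) t

/-- The bridge from integer arithmetic to matrices; the sum of 16 columns splits into eight for Z
and eight for X. -/
theorem isCols_colsMatrix {l : List ℕ} (hl : l.length = 16) : IsCols (colsMatrix l) l := by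
  intro n
  have h (k : ℕ) (s) (hs : bitIndex s = k) :
      (if n.testBit k then (1 : ZMod 2) else 0) = ofBits n s := by rw [ofBits, hs]
  rw [ofBits_applyCols, hl, show 16 = 8 + 8 from rfl, Finset.sum_range_add,
    ← Fin.sum_univ_eq_sum_range, ← Fin.sum_univ_eq_sum_range]
  funext t
  rw [Matrix.mulVec, dotProduct, Fintype.sum_sum_type, Pi.add_apply, Finset.sum_apply,
    Finset.sum_apply]
  congr 1 <;> refine Finset.sum_congr rfl fun k _ => ?_
  · rw [h k (Sum.inl k) rfl]
    exact mul_comm _ _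
  · rw [h (8 + k) (Sum.inr k) rfl]
    exact mul_comm _ _

/-- The columns of the identity matrix. -/
def oneCols : List ℕ := (List.range 16).map fun k => 2 ^ k

theorem isCols_one : IsCols 1 oneCols := by
  have h : colsMatrix oneCols = 1 := by decide +kernel
  rw [← h]
  exact isCols_colsMatrix rfl

theorem ofBits_two_pow (s : Fin 8 ⊕ Fin 8) : ofBits (2 ^ bitIndex s) = Pi.single s 1 := by
  have h : ∀ s : Fin 8 ⊕ Fin 8, ofBits (2 ^ bitIndex s) = Pi.single s 1 := by decide +kernel
  exact h s

/-- Pairing with a basis vector reads the digit of its partner, which lies eight places away modulo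
16. -/
theorem symp_two_pow (s : Fin 8 ⊕ Fin 8) (v : ℕ) : symp (ofBits (2 ^ bitIndex s)) (ofBits v) =
    if v.testBit ((bitIndex s + 8) % 16) then 1 else 0 := by
  have h : ∀ s : Fin 8 ⊕ Fin 8, bitIndex s.swap = (bitIndex s + 8) % 16 := by decide
  rw [ofBits_two_pow, symp_comm, ← h]
  rcases s with i | i
  · rw [symp_single_inl]; rfl
  · rw [symp_single_inr]; rfl

/-- Whether the matrix with columns `l` is the transvection with center `v`. -/
def isTransvectionCols (l : List ℕ) (v : ℕ) : Bool :=
  (List.range 16).all fun k =>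
    applyCols l (2 ^ k) == if v.testBit ((k + 8) % 16) then 2 ^ k ^^^ v else 2 ^ k

/-- The Boolean test compares all sixteen columns, and a matrix is determined by its action on the
basis. -/
theorem eq_transvection_of_isCols {M : Matrix.symplecticGroup (Fin 8) (ZMod 2)} {l : List ℕ}
    {v : ℕ} (hM : IsCols M.1 l) (h : isTransvectionCols l v = true) :
    M = transvection (ofBits v) := by
  refine Subtype.ext (Matrix.ext_of_mulVec_single fun s => ?_)
  have hs : bitIndex s ∈ List.range 16 := by
    have : ∀ s : Fin 8 ⊕ Fin 8, bitIndex s < 16 := by decide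
    exact List.mem_range.2 (this s)
  have h1 := beq_iff_eq.1 (List.all_eq_true.1 h _ hs)
  rw [← ofBits_two_pow, hM, transvection_apply, symp_two_pow, h1]
  split_ifs
  · rw [ofBits_xor, one_smul]
  · rw [zero_smul, add_zero]

variable {G : Subgroup (Matrix.symplecticGroup (Fin 8) (ZMod 2))}

/-- The group `G` contains the matrix with columns `l`. -/
def ContainsCols (G : Subgroup (Matrix.symplecticGroup (Fin 8) (ZMod 2))) (l : List ℕ) : Prop :=
  ∃ M ∈ G, IsCols M.1 l

theorem containsCols_one : ContainsCols G oneCols := ⟨1, one_mem G, isCols_one⟩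

theorem ContainsCols.mul {l m : List ℕ} (hl : ContainsCols G l) (hm : ContainsCols G m) :
    ContainsCols G (mulCols l m) := by
  obtain ⟨M, hM, hMl⟩ := hl
  obtain ⟨N, hN, hNm⟩ := hm
  exact ⟨M * N, mul_mem hM hN, hMl.mul hNm⟩

theorem ContainsCols.transvection_mem {l : List ℕ} (hl : ContainsCols G l) {v : ℕ}
    (hv : transvection (ofBits v) ∈ G) : transvection (ofBits (applyCols l v)) ∈ G := by
  obtain ⟨M, hM, hMl⟩ := hl
  rw [← hMl]
  exact transvection_mem_of_apply hM hv

/-- The product of the generators with the indices `w`. -/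
def wordCols (gens : List (List ℕ)) (w : List ℕ) : List ℕ :=
  w.foldr (fun k l => mulCols (gens.getD k oneCols) l) oneCols

/-- The image of `v` under the product of the generators with the indices `w`. -/
def wordApply (gens : List (List ℕ)) (w : List ℕ) (v : ℕ) : ℕ :=
  w.foldr (fun k n => applyCols (gens.getD k oneCols) n) v

/-- The `n`-th power of the matrix with columns `l`. -/
def powCols (l : List ℕ) (n : ℕ) : List ℕ := (mulCols l)^[n] oneCols

/-- An index beyond the list selects the identity, so words need no bound on their letters. -/
theorem containsCols_getD {gens : List (List ℕ)} (h : ∀ l ∈ gens, ContainsCols G l) (k : ℕ) :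
    ContainsCols G (gens.getD k oneCols) := by
  rw [List.getD_eq_getElem?_getD]
  cases hk : gens[k]? with
  | none => exact containsCols_one
  | some l => exact h l (List.mem_of_getElem? hk)

theorem containsCols_word {gens : List (List ℕ)} (h : ∀ l ∈ gens, ContainsCols G l)
    (w : List ℕ) : ContainsCols G (wordCols gens w) := by
  induction w with
  | nil => exact containsCols_one
  | cons k w ih => exact (containsCols_getD h k).mul ih

theorem transvection_wordApply_mem {gens : List (List ℕ)} (h : ∀ l ∈ gens, ContainsCols G l)
    (w : List ℕ) {v : ℕ} (hv : transvection (ofBits v) ∈ G) :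
    transvection (ofBits (wordApply gens w v)) ∈ G := by
  induction w with
  | nil => exact hv
  | cons k w ih => exact (containsCols_getD h k).transvection_mem ih

theorem ContainsCols.pow {l : List ℕ} (h : ContainsCols G l) (n : ℕ) :
    ContainsCols G (powCols l n) := by
  induction n with
  | zero => exact containsCols_one
  | succ n ih =>
    rw [powCols, Function.iterate_succ_apply']
    exact h.mul ih

/-- Whether the `n`-th power of the word `w` is a transvection with center `v`, and the word `w'`
carries `v` to the exponent vector of the first logical `Z`-operator. -/
def isTransvectionWord (gens : List (List ℕ)) : List ℕ × ℕ × ℕ × List ℕ → Bool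
  | (w, n, v, w') => isTransvectionCols (powCols (wordCols gens w) n) v &&
      (wordApply gens w' v == 1)

/-- The power of the first word is a transvection in G, and conjugating it by the second word moves
its center to the first Z-vector. -/
theorem transvection_mem_of_word {gens : List (List ℕ)} (h : ∀ l ∈ gens, ContainsCols G l)
    (p : List ℕ × ℕ × ℕ × List ℕ) (hp : isTransvectionWord gens p = true) :
    transvection (ofBits 1) ∈ G := by
  obtain ⟨w, n, v, w'⟩ := p
  rw [isTransvectionWord, Bool.and_eq_true, beq_iff_eq] at hp
  obtain ⟨M, hM, hMl⟩ := (containsCols_word h w).pow n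
  rw [eq_transvection_of_isCols hMl hp.1] at hM
  rw [← hp.2]
  exact transvection_wordApply_mem h w' hM

end BitMatrices

/-! ### Explicit matrices of the physical and the additional gates. -/

section Generators

open Mirror

/-- The matrices by which the three reflections act on the logical `X`-operators. -/
def mirrorMatrix : Mirror → Matrix (Fin 8) (Fin 8) (ZMod 2)
  | a => !![1, 0, 0, 0, 0, 0, 0, 0;
    0, 0, 0, 0, 1, 1, 1, 0;
    0, 1, 1, 0, 0, 0, 0, 1;
    0, 0, 0, 1, 0, 1, 1, 1;
    0, 0, 0, 0, 1, 0, 0, 0;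
    1, 1, 0, 0, 0, 0, 1, 0;
    1, 0, 0, 0, 1, 0, 1, 0;
    0, 1, 0, 0, 1, 1, 1, 1]
  | b => !![0, 1, 1, 0, 0, 0, 0, 1;
    1, 0, 0, 0, 0, 1, 1, 1;
    1, 0, 0, 1, 0, 1, 0, 0;
    0, 0, 1, 0, 1, 0, 0, 1;
    0, 0, 0, 1, 0, 1, 1, 1;
    0, 1, 1, 0, 1, 0, 0, 0;
    1, 1, 0, 1, 1, 0, 1, 0;
    1, 0, 0, 1, 0, 0, 1, 1]
  | c => !![1, 0, 0, 0, 0, 1, 1, 1;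
    0, 0, 1, 0, 0, 1, 1, 0;
    0, 0, 1, 0, 0, 0, 0, 0;
    0, 0, 0, 1, 0, 0, 0, 0;
    0, 1, 0, 0, 1, 0, 0, 1;
    0, 1, 0, 1, 0, 0, 1, 0;
    0, 0, 1, 1, 0, 0, 1, 0;
    0, 1, 1, 0, 0, 1, 1, 1]

theorem mirrorMatrix_mul_self (t : Mirror) : mirrorMatrix t * mirrorMatrix t = 1 := by
  cases t <;> decide +kernel

/-- The images of the logical `X`-operators under a reflection. -/
def mirrorLogicalX (t : Mirror) (j : Fin 8) : Fin 30 → ZMod 2 :=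
  fun l => logicalX j (edgePerm t l)

/-- The matrix entries are the parities of permuted logical X-supports against logical Z-supports.
-/
theorem implements_mirror (t : Mirror) : Implements (permGate (qubitPerm (mirror t)))
    (linearUnitary (mirrorMatrix t) (mirrorMatrix t) (mirrorMatrix_mul_self t)) := by
  rw [qubitPerm_mirror]
  have h : (Matrix.of fun i j => logicalZ i ⬝ᵥ mirrorLogicalX t j) = mirrorMatrix t := by
    cases t <;> decide +kernel
  have h' : ∀ k j, pentagon k ⬝ᵥ mirrorLogicalX t j = 0 := by cases t <;> decide +kernel
  refine implements_permGate ?_ _ ?_ h' fun i j => congrFun (congrFun h i) j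
  · cases t <;> decide
  · cases t <;> decide +kernel

/-- The symplectic matrices of the logical operators of the three reflections. -/
def mirrorSymplectic (t : Mirror) : Matrix.symplecticGroup (Fin 8) (ZMod 2) :=
  linearSymplectic (mirrorMatrix t) (mirrorMatrix t) (mirrorMatrix_mul_self t)

/-- The symplectic matrix of the Hadamard-type gate. -/
def dualHadamardSymplectic : Matrix.symplecticGroup (Fin 8) (ZMod 2) :=
  hadamardSymplectic (Fin 8) * linearSymplectic dualForm dualFormInv dualForm_mul_inv

/-- The symplectic matrix of the phase-type gate. -/
def dualPhaseSymplectic : Matrix.symplecticGroup (Fin 8) (ZMod 2) :=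
  diagonalSymplectic dualForm dualForm_transpose

/-- The columns of `mirrorSymplectic`. -/
def mirrorCols : Mirror → List ℕ
  | a => [1, 112, 134, 232, 16, 67, 81, 242, 24832, 41984, 1024, 2048, 53760, 35328, 59904, 35840]
  | b => [134, 225, 41, 148, 232, 22, 91, 201,
    50688, 24832, 10496, 54272, 26624, 5632, 53760, 39680]
  | c => [225, 100, 4, 8, 146, 74, 76, 230, 256, 45056, 50688, 26624, 4096, 33536, 58112, 37120]

/-- The columns of `dualHadamardSymplectic`. -/
def dualHadamardCols : List ℕ :=
  [256, 512, 1024, 2048, 4096, 8192, 32768, 49152, 1, 2, 4, 8, 16, 32, 192, 64]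

/-- The columns of `dualPhaseSymplectic`. -/
def dualPhaseCols : List ℕ :=
  [1, 2, 4, 8, 16, 32, 64, 128, 257, 514, 1028, 2056, 4112, 8224, 16576, 32832]

theorem isCols_mirror (t : Mirror) : IsCols (mirrorSymplectic t).1 (mirrorCols t) := by
  have h : colsMatrix (mirrorCols t) = (mirrorSymplectic t).1 := by
    cases t <;> decide +kernel
  rw [← h]
  exact isCols_colsMatrix (by cases t <;> rfl)

theorem isCols_dualHadamard : IsCols dualHadamardSymplectic.1 dualHadamardCols := by
  have h : colsMatrix dualHadamardCols = dualHadamardSymplectic.1 := by decide +kernel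
  rw [← h]
  exact isCols_colsMatrix rfl

theorem isCols_dualPhase : IsCols dualPhaseSymplectic.1 dualPhaseCols := by
  have h : colsMatrix dualPhaseCols = dualPhaseSymplectic.1 := by decide +kernel
  rw [← h]
  exact isCols_colsMatrix rfl

/-- The columns of the symplectic matrix of a controlled-NOT. -/
def cnotCols (i j : Fin 8) : List ℕ := (List.range 16).map fun k : ℕ =>
  2 ^ k ^^^ (if k = 8 + i.val then 2 ^ (8 + j.val) else 0) ^^^ if k = j.val then 2 ^ i.val else 0

/-- The columns of the symplectic matrix of a controlled-Z. -/
def czCols (i j : Fin 8) : List ℕ := (List.range 16).map fun k : ℕ =>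
  2 ^ k ^^^ (if k = 8 + i.val then 2 ^ j.val else 0) ^^^ if k = 8 + j.val then 2 ^ i.val else 0

/-- The symplectic matrix of a controlled-NOT. -/
def cnotSymplectic (i j : Fin 8) (hij : i ≠ j) : Matrix.symplecticGroup (Fin 8) (ZMod 2) :=
  linearSymplectic _ _ (cnot_matrix_mul_self hij)

/-- The symplectic matrix of a controlled-Z. -/
def czSymplectic (i j : Fin 8) : Matrix.symplecticGroup (Fin 8) (ZMod 2) :=
  diagonalSymplectic _ (cz_matrix_transpose i j)

set_option maxRecDepth 10000 in
theorem isCols_cnot {i j : Fin 8} (hij : i ≠ j) :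
    IsCols (cnotSymplectic i j hij).1 (cnotCols i j) := by
  have h : ∀ i j : Fin 8, i ≠ j → colsMatrix (cnotCols i j) =
      Matrix.fromBlocks (1 + Matrix.single j i 1)ᵀ 0 0 (1 + Matrix.single j i 1) := by
    decide +kernel
  change IsCols (Matrix.fromBlocks (1 + Matrix.single j i 1)ᵀ 0 0 (1 + Matrix.single j i 1)) _
  rw [← h i j hij]
  exact isCols_colsMatrix (by simp [cnotCols])

set_option maxRecDepth 10000 in
theorem isCols_cz {i j : Fin 8} (hij : i ≠ j) : IsCols (czSymplectic i j).1 (czCols i j) := by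
  have h : ∀ i j : Fin 8, i ≠ j → colsMatrix (czCols i j) =
      Matrix.fromBlocks 1 (Matrix.single i j 1 + Matrix.single j i 1) 0 1 := by
    decide +kernel
  change IsCols (Matrix.fromBlocks 1 (Matrix.single i j 1 + Matrix.single j i 1) 0 1) _
  rw [← h i j hij]
  exact isCols_colsMatrix (by simp [czCols])

/-- The columns of the symplectic matrices of the five physical gates. -/
def physicalCols : List (List ℕ) :=
  [mirrorCols a, mirrorCols b, mirrorCols c, dualHadamardCols, dualPhaseCols]

end Generators

/-! ### Word certificates for generation. -/

section Generation

/-- Words that carry the exponent vector of the first logical `Z`-operator to the standard basis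
vectors and to the sums of two consecutive `Z`-basis vectors. The last letter is the transvection
of the first logical `Z`-operator. -/
def chainWords : List (List ℕ) :=
  [[],
    [1, 2],
    [0, 1],
    [1, 2, 0, 1, 2],
    [2, 1, 2, 0, 1, 0, 1],
    [3, 2, 5, 3, 4, 2, 4, 1, 0, 4, 3, 1],
    [3, 0, 1, 0, 1, 5, 3, 4, 0, 4, 0, 1, 0, 4, 3, 1],
    [3, 1, 5, 3, 4, 0, 4, 0, 1, 0, 4, 3, 1],
    [3],
    [3, 1, 2],
    [3, 0, 1],
    [3, 1, 2, 0, 1, 2],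
    [3, 2, 1, 2, 0, 1, 0, 1],
    [2, 5, 3, 4, 2, 4, 1, 0, 4, 3, 1],
    [3, 2, 0, 1, 0, 1],
    [0, 1, 0, 1, 5, 3, 4, 0, 4, 0, 1, 0, 4, 3, 1],
    [3, 5, 3, 4, 2, 0, 1, 0, 4, 1, 0, 1, 5, 4, 3, 2],
    [3, 2, 0, 1, 5, 3, 0, 4, 1, 2, 4, 3, 0, 1, 2],
    [3, 4, 0, 4, 1, 0, 1, 5, 0, 1, 5, 3, 4, 2, 4, 3, 1, 0, 1, 2],
    [3, 1, 2, 0, 1, 2, 5, 3, 0, 4, 1, 0, 4, 1, 0, 1, 5, 4, 3, 2],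
    [3, 2, 1, 0, 1, 5, 3, 4, 2, 4, 1, 0, 4, 3, 1],
    [3, 2, 1, 5, 3, 0, 4, 1, 2, 4, 3, 0, 1, 2],
    [2, 0, 1, 0, 1]]

/-- For each `i < j`, a power of a word that is a transvection, in the group generated by the
physical gates and the controlled-Z on `i` and `j`. -/
def czWords : List (List ℕ × ℕ × ℕ × List ℕ) :=
  [([], 0, 0, []),
    ([0, 1, 0, 3, 4, 5], 33, 38109, [3, 5, 2, 5, 3, 4, 2, 4, 1, 0, 4, 3, 1]),
    ([1, 2, 4, 5, 3, 5], 63, 52175, [3, 5, 1, 2, 0, 1, 5, 4, 3, 2, 1, 5, 0]),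
    ([0, 1, 0, 1, 2, 4, 3, 5], 39, 58274, [3, 4, 1, 2, 1, 0, 4]),
    ([], 0, 0, []),
    ([0, 1, 0, 1, 4, 5, 3], 55, 39463, [3, 5, 4, 2, 5, 3, 4, 1, 2, 5, 4, 3, 2]),
    ([0, 1, 4, 3, 5, 3], 43, 23053, [3, 0, 5, 3, 1, 5, 4, 2, 1, 2, 4, 0]),
    ([0, 4, 5, 1, 5, 3, 5], 65, 5773, [3, 5, 3, 2, 4, 1, 2, 4, 3, 0]),
    ([], 0, 0, []),
    ([], 0, 0, []),
    ([1, 2, 4, 3, 5, 2, 5], 93, 21277, [3, 1, 5, 0, 5, 2, 1, 0, 5, 3, 0, 5, 4, 0]),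
    ([0, 1, 0, 3, 4, 5], 33, 38109, [3, 1, 2, 1, 5, 4, 3, 2, 5, 1, 5, 1, 0]),
    ([0, 4, 5, 1, 5, 3, 5], 21, 49228, [3, 1, 2, 4, 1, 0, 5, 3, 5, 0, 4, 3, 5, 2]),
    ([1, 3, 4, 5, 2, 5], 43, 52793, [3, 1, 5, 3, 4, 2, 5, 3, 5, 0, 5, 2, 0]),
    ([0, 1, 4, 5, 3, 4, 5], 39, 14037, [3, 4, 0, 4, 1, 2, 1, 2, 4]),
    ([0, 3, 4, 3, 5, 2, 3, 5], 3, 49794, [3, 1, 5, 3, 1, 0, 5, 1, 5, 1, 0, 1]),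
    ([], 0, 0, []),
    ([], 0, 0, []),
    ([], 0, 0, []),
    ([], 0, 0, []),
    ([0, 1, 0, 1, 2, 4, 3, 5], 39, 45152, [3, 0, 4, 1, 2, 5]),
    ([0, 1, 2, 1, 4, 5, 3], 43, 6364, [3, 4, 2, 4, 1, 0, 5, 3, 4, 2, 5, 3, 1]),
    ([0, 1, 3, 4, 3, 5], 63, 33995, [3, 1, 5, 3, 5, 4, 2, 5, 2, 1, 2, 1]),
    ([1, 2, 4, 3, 5, 2, 5], 93, 21277, [3, 1, 2, 5, 3, 2, 1, 5, 4, 2, 5, 3, 5, 2, 0]),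
    ([], 0, 0, []),
    ([], 0, 0, []),
    ([], 0, 0, []),
    ([], 0, 0, []),
    ([1, 2, 4, 5, 3, 5], 63, 29918, [3, 4, 1, 2, 1, 5, 0, 1, 5, 3, 0, 5, 2, 0]),
    ([1, 2, 4, 3, 5, 2, 5], 93, 21277, [3, 4, 2, 1, 2, 4, 3, 5, 3, 5, 0, 1, 2, 5, 2, 0]),
    ([0, 1, 3, 4, 5], 93, 1611, [3, 4, 0, 5, 3, 5, 2, 0, 1, 2, 0]),
    ([0, 1, 2, 1, 4, 5, 3], 43, 1295, [3, 1, 5, 3, 1, 0, 1, 5, 4, 3, 5, 3, 0, 1]),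
    ([], 0, 0, []),
    ([], 0, 0, []),
    ([], 0, 0, []),
    ([], 0, 0, []),
    ([], 0, 0, []),
    ([0, 4, 5, 1, 5, 3, 5], 65, 18748, [3, 0, 1, 2, 5, 3, 4, 2, 5, 4, 1, 0, 1, 0]),
    ([1, 2, 5, 3, 4], 93, 1613, [3, 0, 4, 1, 0, 4, 3, 1, 2, 5, 0, 1]),
    ([0, 1, 0, 1, 4, 5, 3], 55, 26456, [3, 0, 4, 1, 2, 5, 1, 5, 3, 4, 2, 4, 0, 1]),
    ([], 0, 0, []),
    ([], 0, 0, []),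
    ([], 0, 0, []),
    ([], 0, 0, []),
    ([], 0, 0, []),
    ([], 0, 0, []),
    ([1, 5, 2, 4, 5, 3, 5], 45, 43771, [3, 4, 2, 1, 5, 2, 1, 0, 4, 3, 5, 0, 4]),
    ([], 0, 0, []),
    ([], 0, 0, []),
    ([], 0, 0, []),
    ([], 0, 0, []),
    ([], 0, 0, []),
    ([], 0, 0, []),
    ([], 0, 0, []),
    ([], 0, 0, []),
    ([1, 3, 4, 5, 2, 5], 43, 27797, [3, 4, 0, 5, 3, 5, 3, 2, 1, 5, 2, 1]),
    ([], 0, 0, []),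
    ([], 0, 0, []),
    ([], 0, 0, []),
    ([], 0, 0, []),
    ([], 0, 0, []),
    ([], 0, 0, []),
    ([], 0, 0, []),
    ([], 0, 0, [])]

/-- For each `i ≠ j`, a power of a word that is a transvection, in the group generated by the
physical gates and the controlled-NOT with control `i` and target `j`. -/
def cnotWords : List (List ℕ × ℕ × ℕ × List ℕ) :=
  [([], 0, 0, []),
    ([1, 5, 2, 4, 5], 15, 226, [3, 0, 5, 3, 5]),
    ([1, 2, 4, 5, 3, 5], 13, 12233, [3, 4, 5, 0, 4, 1, 2, 4, 3, 1, 2, 4, 0]),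
    ([0, 1, 5, 3, 5, 4], 55, 49835, [1, 0, 1, 5, 3, 4, 0, 1, 5, 1, 0, 1]),
    ([0, 1, 0, 2, 5, 4], 35, 144, [2, 1, 0, 5, 2, 5, 2]),
    ([0, 1, 2, 5, 0, 4, 5], 35, 144, [3, 5, 3, 1]),
    ([0, 1, 2, 5, 2, 4], 35, 52, [2, 1, 0, 1, 2, 5, 2, 0, 1]),
    ([0, 1, 0, 1, 4, 5], 35, 175, [1, 5, 0, 1]),
    ([1, 2, 1, 2, 5, 4], 35, 135, [5, 1, 2]),
    ([], 0, 0, []),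
    ([0, 1, 5, 4], 35, 213, [2, 1, 0, 1, 0, 5, 0]),
    ([0, 1, 3, 4, 5], 93, 18678, [3, 1, 2, 1, 2, 5, 4, 1, 2, 1, 0, 1]),
    ([0, 1, 0, 2, 5, 4], 35, 220, [2, 1, 0, 1, 0, 5, 2]),
    ([1, 2, 5, 4], 35, 224, [2, 5, 2, 1, 5]),
    ([0, 1, 5, 4], 35, 213, [2, 1, 0, 5, 1, 0, 5]),
    ([0, 3, 4, 5, 2, 5], 7, 7500, [3, 0, 1, 5, 0, 4, 1, 5, 2, 1]),
    ([0, 1, 0, 1, 5, 4], 35, 135, [5, 0]),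
    ([1, 2, 5, 4], 35, 27, [2, 1, 0, 1, 0, 5, 1, 2]),
    ([], 0, 0, []),
    ([0, 1, 5, 4], 35, 40, [1, 0, 1, 5, 0, 5]),
    ([0, 1, 4, 3, 5, 4, 5], 39, 28580, [3, 1, 5, 4, 0, 1, 2, 4, 1, 0, 1, 2, 4, 3]),
    ([0, 1, 5, 4], 35, 40, [2, 5, 2, 1, 5, 0]),
    ([0, 1, 3, 5, 4], 93, 18678, [3, 0, 1, 0, 5, 4, 0, 1, 2, 4]),
    ([0, 1, 0, 1, 4, 5], 35, 135, [2, 5, 2, 0]),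
    ([0, 1, 4, 3, 5, 4, 5], 39, 40616, [5, 3, 4, 1, 2, 4, 1, 0, 1, 2, 4, 3]),
    ([0, 1, 3, 5, 4], 93, 1611, [3, 1, 2, 1, 2, 5, 4, 0, 1, 2, 4]),
    ([0, 1, 5, 4], 35, 132, [1, 5, 1, 0, 1, 2]),
    ([], 0, 0, []),
    ([0, 1, 0, 1, 5, 4], 35, 248, [1, 0, 1, 2, 0, 1, 5, 2, 0]),
    ([0, 1, 0, 1, 4, 5], 35, 248, [2, 1, 2, 5, 1, 5]),
    ([1, 2, 5, 4], 35, 213, [2, 1, 0, 1, 2, 5, 1, 2]),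
    ([0, 5, 1, 3, 4, 5], 33, 11764, [1, 5, 3, 4, 1, 2, 0, 5, 2, 1, 0]),
    ([0, 1, 0, 2, 5, 4], 35, 33, [2, 5, 1, 0, 1, 5]),
    ([0, 1, 2, 5, 2, 4], 35, 137, [2, 1, 0, 1, 0, 5, 2, 0, 1]),
    ([0, 1, 5, 3, 5, 4], 55, 24692, [2, 1, 2, 5, 3, 2, 4, 0, 1, 5, 1, 0, 1]),
    ([1, 2, 4, 5, 3, 5], 13, 39958, [3, 1, 2, 4, 1, 5, 4, 3, 5, 0, 4, 1, 5]),
    ([], 0, 0, []),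
    ([0, 1, 0, 1, 4, 5], 35, 124, [2, 1, 0, 1, 5, 1, 2]),
    ([1, 5, 2, 4, 5], 15, 66, [2, 1, 2, 5, 2, 1, 0]),
    ([0, 1, 0, 3, 5, 4], 43, 11039, [1, 5, 3, 0, 5, 4, 0, 1, 2, 4, 3]),
    ([0, 4, 2, 5, 1, 2, 5], 35, 109, [2, 5, 0, 1, 0, 5]),
    ([0, 1, 4, 5, 4], 35, 3, [1, 5, 0, 5, 1]),
    ([1, 2, 4, 5, 4], 35, 5, [3, 0, 5, 3, 2]),
    ([0, 1, 0, 1, 4, 5, 4], 35, 249, [3, 0, 1, 2, 5, 2, 1, 5, 3]),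
    ([0, 1, 3, 5, 4, 2, 5], 21, 52151, [3, 0, 5, 0, 4, 1, 2, 4, 5, 3]),
    ([], 0, 0, []),
    ([0, 1, 3, 5, 0, 4, 5], 33, 14369, [3, 0, 5, 2, 4, 1, 5, 1, 0]),
    ([0, 3, 4, 5, 2, 5], 7, 7500, [3, 0, 1, 0, 5, 4, 1, 5, 0]),
    ([0, 1, 4, 5, 4], 35, 203, [5, 2, 5, 0, 1, 0, 1]),
    ([0, 3, 4, 5, 2, 5], 7, 37201, [1, 5, 3, 1, 0, 1, 5, 2, 4, 1]),
    ([0, 1, 0, 4, 3, 5], 43, 13355, [3, 0, 5, 4, 1, 0, 1, 0, 4]),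
    ([0, 1, 4, 5, 4], 35, 203, [3, 0, 5, 3, 5, 0, 1, 2]),
    ([1, 2, 4, 5, 4], 35, 154, [3, 1, 5, 3, 0, 5, 1]),
    ([0, 3, 4, 5, 2, 5], 7, 37201, [2, 1, 2, 5, 3, 1, 0, 4]),
    ([], 0, 0, []),
    ([0, 1, 2, 4, 5, 1, 5], 7, 17, [1, 5, 2, 1, 5, 0, 1, 5, 0, 1, 2]),
    ([0, 1, 3, 5, 4, 2, 5], 21, 29817, [3, 1, 2, 4, 1, 5, 3, 4, 0, 4, 1]),
    ([0, 1, 3, 5, 0, 4, 5], 33, 50576, [3, 1, 5, 0, 4, 1, 5, 1, 0]),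
    ([0, 1, 0, 1, 4, 5, 4], 35, 151, [1, 5, 2, 1, 5, 2, 1, 0]),
    ([1, 2, 4, 5, 4], 35, 24, [3, 0, 1, 2, 5, 3, 5, 0]),
    ([0, 4, 2, 5, 1, 2, 5], 35, 190, [3, 0, 1, 2, 5, 3, 1, 0, 5]),
    ([0, 3, 4, 5, 2, 5], 45, 28078, [2, 1, 0, 1, 5, 3, 4, 0, 5, 2]),
    ([0, 1, 4, 5, 4], 35, 208, [2, 1, 2, 5, 1, 2, 0, 5]),
    ([], 0, 0, [])]

/-- Letters 0 to 4 are the physical gates and letter 5 is the controlled-NOT. The placeholder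
entries of the table fail the test, since they leave the center at 0 instead of 1. -/
theorem isTransvectionWord_cnot (i j : Fin 8) (hij : i ≠ j) :
    isTransvectionWord (physicalCols ++ [cnotCols i j])
      (cnotWords.getD (8 * i + j) ([], 0, 0, [])) = true := by
  have h : ∀ i j : Fin 8, i ≠ j → isTransvectionWord (physicalCols ++ [cnotCols i j])
      (cnotWords.getD (8 * i + j) ([], 0, 0, [])) = true := by decide +kernel
  exact h i j hij

theorem isTransvectionWord_cz (i j : Fin 8) (hij : i < j)
    (h0 : (i, j) ∉ [((0 : Fin 8), (4 : Fin 8)), (2, 3), (5, 7)]) :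
    isTransvectionWord (physicalCols ++ [czCols i j])
      (czWords.getD (8 * i + j) ([], 0, 0, [])) = true := by
  have h : ∀ i j : Fin 8, i < j → (i, j) ∉ [((0 : Fin 8), (4 : Fin 8)), (2, 3), (5, 7)] →
      isTransvectionWord (physicalCols ++ [czCols i j])
        (czWords.getD (8 * i + j) ([], 0, 0, [])) = true := by decide +kernel
  exact h i j hij h0

variable {G : Subgroup (Matrix.symplecticGroup (Fin 8) (ZMod 2))}

/-- The columns of the transvection of the first logical `Z`-operator. -/
def firstTransvectionCols : List ℕ :=
  [1, 2, 4, 8, 16, 32, 64, 128, 257, 512, 1024, 2048, 4096, 8192, 16384, 32768]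

theorem isCols_firstTransvection : IsCols (transvection (ofBits 1)).1 firstTransvectionCols := by
  have h : colsMatrix firstTransvectionCols = (transvection (ofBits 1)).1 := by decide +kernel
  rw [← h]
  exact isCols_colsMatrix rfl

/-- The physical gates and one transvection generate the symplectic group. -/
theorem eq_top_of_first_transvection (hG : ∀ l ∈ physicalCols, ContainsCols G l)
    (hT : transvection (ofBits 1) ∈ G) : G = ⊤ := by
  have hG' : ∀ l ∈ physicalCols ++ [firstTransvectionCols], ContainsCols G l := by
    intro l hl
    rcases List.mem_append.1 hl with hl | hl
    · exact hG l hl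
    · rw [List.mem_singleton.1 hl]
      exact ⟨_, hT, isCols_firstTransvection⟩
  have key (k : ℕ) : transvection (ofBits (wordApply (physicalCols ++ [firstTransvectionCols])
      (chainWords.getD k []) 1)) ∈ G := transvection_wordApply_mem hG' _ hT
  have h1 : ∀ s : Fin 8 ⊕ Fin 8, wordApply (physicalCols ++ [firstTransvectionCols])
      (chainWords.getD (bitIndex s) []) 1 = 2 ^ bitIndex s := by decide +kernel
  -- Entries 0 to 15 of `chainWords` reach the basis vectors; the seven entries from 16 on reach the
  -- sums of consecutive Z-vectors.
  have h2 : ∀ i j : Fin 8, (i : ℕ) + 1 = j → wordApply (physicalCols ++ [firstTransvectionCols])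
      (chainWords.getD (16 + i) []) 1 = 2 ^ bitIndex (Sum.inl i) ^^^ 2 ^ bitIndex (Sum.inl j) := by
    decide +kernel
  refine eq_top_of_transvection_chain (fun s => ?_) fun i j hij => ?_
  · have := key (bitIndex s)
    rwa [h1, ofBits_two_pow] at this
  · have := key (16 + i)
    rwa [h2 i j hij, ofBits_xor, ofBits_two_pow, ofBits_two_pow] at this

theorem eq_top_of_word {l : List ℕ} (hG : ∀ l ∈ physicalCols, ContainsCols G l)
    (hl : ContainsCols G l) (p : List ℕ × ℕ × ℕ × List ℕ)
    (hp : isTransvectionWord (physicalCols ++ [l]) p = true) : G = ⊤ := by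
  refine eq_top_of_first_transvection hG (transvection_mem_of_word (fun m hm => ?_) p hp)
  rcases List.mem_append.1 hm with hm | hm
  · exact hG m hm
  · rwa [List.mem_singleton.1 hm]

end Generation

/-! ### From logical operators to the five explicit symplectic matrices. -/

section LogicalGates

open Mirror

/-- The symplectic images of the logical operators of the five physical gates. -/
def physicalSymplectic : Set (Matrix.symplecticGroup (Fin 8) (ZMod 2)) :=
  {mirrorSymplectic a, mirrorSymplectic b, mirrorSymplectic c, dualHadamardSymplectic,
    dualPhaseSymplectic}

variable {A : Finset (Fin 30)}

/-- The logical operators of the physical gates and their symplectic images. -/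
def IsPhysicalPair (A : Finset (Fin 30)) (U : UnitaryOp (Fin 8))
    (M : Matrix.symplecticGroup (Fin 8) (ZMod 2)) : Prop :=
  IsSymplecticImage U M ∧ M ∈ physicalSymplectic ∧ ∃ W ∈ physicalGates A, Implements W U

theorem isPhysicalPair_mirror (t : Mirror) :
    IsPhysicalPair A (linearUnitary _ _ (mirrorMatrix_mul_self t)) (mirrorSymplectic t) :=
  ⟨isSymplecticImage_linear _ _ _, by cases t <;> simp [physicalSymplectic],
    _, by cases t <;> simp [physicalGates], implements_mirror t⟩

theorem isPhysicalPair_hadamard :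
    IsPhysicalPair A (hadamardUnitary (Fin 8) * linearUnitary _ _ dualForm_mul_inv)
      dualHadamardSymplectic :=
  ⟨isSymplecticImage_hadamard.mul (isSymplecticImage_linear _ _ _), by simp [physicalSymplectic],
    _, by simp [physicalGates], implements_hadamardGate⟩

theorem isPhysicalPair_phase (hA : IsEncodedLogicalGate (phaseGate tau0 A)) :
    IsPhysicalPair A (diagonalUnitary _ (logicalPhase_mul_star A)) dualPhaseSymplectic :=
  ⟨isSymplecticImage_diagonal _ dualForm_transpose (logicalPhase_add A),
    by simp [physicalSymplectic], _, by simp [physicalGates], implements_phaseGate hA⟩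

theorem exists_isPhysicalPair_of_mem_physicalSymplectic
    (hA : IsEncodedLogicalGate (phaseGate tau0 A))
    {M : Matrix.symplecticGroup (Fin 8) (ZMod 2)} (hM : M ∈ physicalSymplectic) :
    ∃ U, IsPhysicalPair A U M := by
  rcases hM with rfl | rfl | rfl | rfl | rfl
  exacts [⟨_, isPhysicalPair_mirror a⟩, ⟨_, isPhysicalPair_mirror b⟩, ⟨_, isPhysicalPair_mirror c⟩,
    ⟨_, isPhysicalPair_hadamard⟩, ⟨_, isPhysicalPair_phase hA⟩]

theorem exists_isPhysicalPair_of_implements (hA : IsEncodedLogicalGate (phaseGate tau0 A))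
    {W : Operator (Fin 30)} (hW : W ∈ physicalGates A) {U : UnitaryOp (Fin 8)}
    (hU : Implements W U) : ∃ M, IsPhysicalPair A U M := by
  rcases hW with rfl | rfl | rfl | rfl | rfl
  · exact ⟨_, hU.unique (implements_mirror a) ▸ isPhysicalPair_mirror a⟩
  · exact ⟨_, hU.unique (implements_mirror b) ▸ isPhysicalPair_mirror b⟩
  · exact ⟨_, hU.unique (implements_mirror c) ▸ isPhysicalPair_mirror c⟩
  · exact ⟨_, hU.unique implements_hadamardGate ▸ isPhysicalPair_hadamard⟩
  · exact ⟨_, hU.unique (implements_phaseGate hA) ▸ isPhysicalPair_phase hA⟩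

theorem logicalGates_subset_cliffordGroup (hA : IsEncodedLogicalGate (phaseGate tau0 A))
    {g : UnitaryOp (Fin 8)} {N : Matrix.symplecticGroup (Fin 8) (ZMod 2)}
    (hg : IsSymplecticImage g N) : logicalGates A g ⊆ cliffordGroup (Fin 8) := by
  rintro U (⟨W, hW, hU⟩ | hU)
  · obtain ⟨M, hM⟩ := exists_isPhysicalPair_of_implements hA hW hU
    exact hM.1.mem_cliffordGroup
  · rw [Subtype.ext hU]
    exact hg.mem_cliffordGroup

/-- Logical operators and symplectic images are both unique, so the set of images is known exactly
and does not involve A. Exactness matters for the negative statement, where no further generator may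
occur. -/
theorem symplecticImages_logicalGates (hA : IsEncodedLogicalGate (phaseGate tau0 A))
    {g : UnitaryOp (Fin 8)} {N : Matrix.symplecticGroup (Fin 8) (ZMod 2)}
    (hg : IsSymplecticImage g N) :
    symplecticImages (logicalGates A g) = insert N physicalSymplectic := by
  ext M
  constructor
  · rintro ⟨U, ⟨W, hW, hU⟩ | hU, hM⟩
    · obtain ⟨M', hM'⟩ := exists_isPhysicalPair_of_implements hA hW hU
      exact Or.inr (hM.unique hM'.1 ▸ hM'.2.1)
    · rw [Subtype.ext hU] at hM
      exact Or.inl (hM.unique hg)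
  · rintro (rfl | hM)
    · exact ⟨g, Or.inr rfl, hg⟩
    · obtain ⟨U, hU⟩ := exists_isPhysicalPair_of_mem_physicalSymplectic hA hM
      exact ⟨U, Or.inl hU.2.2, hU.1⟩

theorem containsCols_physical {G : Subgroup (Matrix.symplecticGroup (Fin 8) (ZMod 2))}
    (hG : physicalSymplectic ⊆ G) : ∀ l ∈ physicalCols, ContainsCols G l := by
  intro l hl
  simp only [physicalCols, List.mem_cons, List.not_mem_nil, or_false] at hl
  rcases hl with rfl | rfl | rfl | rfl | rfl
  exacts [⟨_, hG (by simp [physicalSymplectic]), isCols_mirror a⟩,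
    ⟨_, hG (by simp [physicalSymplectic]), isCols_mirror b⟩,
    ⟨_, hG (by simp [physicalSymplectic]), isCols_mirror c⟩,
    ⟨_, hG (by simp [physicalSymplectic]), isCols_dualHadamard⟩,
    ⟨_, hG (by simp [physicalSymplectic]), isCols_dualPhase⟩]

theorem closure_insert_eq_top {N : Matrix.symplecticGroup (Fin 8) (ZMod 2)} {l : List ℕ}
    (hN : IsCols N.1 l) (p : List ℕ × ℕ × ℕ × List ℕ)
    (hp : isTransvectionWord (physicalCols ++ [l]) p = true) :
    Subgroup.closure (insert N physicalSymplectic) = ⊤ :=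
  eq_top_of_word
    (containsCols_physical ((Set.subset_insert _ _).trans Subgroup.subset_closure))
    ⟨N, Subgroup.subset_closure (Set.mem_insert _ _), hN⟩ p hp

theorem closure_insert_cnot_eq_top {i j : Fin 8} (hij : i ≠ j) :
    Subgroup.closure (insert (cnotSymplectic i j hij) physicalSymplectic) = ⊤ :=
  closure_insert_eq_top (isCols_cnot hij) _ (isTransvectionWord_cnot i j hij)

theorem czSymplectic_comm (i j : Fin 8) : czSymplectic i j = czSymplectic j i := by
  apply Subtype.ext
  simp only [czSymplectic, diagonalSymplectic, add_comm]

theorem closure_insert_cz_eq_top {i j : Fin 8} (hij : i ≠ j)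
    (h : s(i, j) ∉ ({s(0, 4), s(2, 3), s(5, 7)} : Set (Sym2 (Fin 8)))) :
    Subgroup.closure (insert (czSymplectic i j) physicalSymplectic) = ⊤ := by
  -- `czWords` has certificates only for i < j, and the gate is symmetric.
  wlog hlt : i < j generalizing i j
  · rw [czSymplectic_comm]
    exact this hij.symm (Sym2.eq_swap (a := i) ▸ h) (lt_of_le_of_ne (not_lt.1 hlt) hij.symm)
  refine closure_insert_eq_top (isCols_cz hij) _ (isTransvectionWord_cz i j hlt fun h' => h ?_)
  simp only [List.mem_cons, Prod.mk.injEq, List.not_mem_nil, or_false] at h'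
  rcases h' with ⟨rfl, rfl⟩ | ⟨rfl, rfl⟩ | ⟨rfl, rfl⟩ <;> simp

/-- A controlled-NOT as a unitary operator. -/
def cnotUnitary (i j : Fin 8) (hij : i ≠ j) : UnitaryOp (Fin 8) :=
  linearUnitary _ _ (cnot_matrix_mul_self hij)

theorem coe_cnotUnitary {i j : Fin 8} (hij : i ≠ j) :
    (cnotUnitary i j hij : Operator (Fin 8)) = cnot i j := (cnot_eq_linearGate i j).symm

theorem isSymplecticImage_cnot {i j : Fin 8} (hij : i ≠ j) :
    IsSymplecticImage (cnotUnitary i j hij) (cnotSymplectic i j hij) :=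
  isSymplecticImage_linear _ _ _

/-- A controlled-Z as a unitary operator. -/
def czUnitary (i j : Fin 8) : UnitaryOp (Fin 8) :=
  diagonalUnitary (fun v => sgn (v i * v j)) fun _ => sgn_mul_star _

theorem coe_czUnitary (i j : Fin 8) : (czUnitary i j : Operator (Fin 8)) = cz i j := rfl

theorem isSymplecticImage_cz (i j : Fin 8) :
    IsSymplecticImage (czUnitary i j) (czSymplectic i j) :=
  isSymplecticImage_diagonal _ _ (cz_phase_add i j)

end LogicalGates

/-! ### An invariant subspace -/

section Invariant

open Mirror

/-- A matrix with square zero whose kernel, which is also its range, is invariant under the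
physical gates. -/
def foldNilpotent : Matrix (Fin 8 ⊕ Fin 8) (Fin 8 ⊕ Fin 8) (ZMod 2) :=
  colsMatrix [17, 98, 12, 12, 17, 160, 194, 160, 4352, 16896, 3072, 3072, 4352, 41472, 16896, 57344]

/-- A contracting homotopy of `foldNilpotent`. -/
def foldHomotopy : Matrix (Fin 8 ⊕ Fin 8) (Fin 8 ⊕ Fin 8) (ZMod 2) :=
  colsMatrix [0, 0, 0, 4, 1, 0, 2, 32, 0, 0, 0, 1024, 256, 0, 512, 8192]

/-- With N the nilpotent matrix and h the homotopy, Nx = 0 gives x = N(hx). Together with N² = 0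
this identifies kernel and range, so N M N = 0 means that M preserves the kernel. -/
theorem foldNilpotent_homotopy :
    foldNilpotent * foldHomotopy + foldHomotopy * foldNilpotent = 1 := by decide +kernel

/-- A matrix `M` preserves the kernel of `foldNilpotent`. -/
def PreservesFold (M : Matrix (Fin 8 ⊕ Fin 8) (Fin 8 ⊕ Fin 8) (ZMod 2)) : Prop :=
  foldNilpotent * M * foldNilpotent = 0

instance (M : Matrix (Fin 8 ⊕ Fin 8) (Fin 8 ⊕ Fin 8) (ZMod 2)) : Decidable (PreservesFold M) :=
  inferInstanceAs (Decidable (_ = _))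

theorem PreservesFold.mul {M M' : Matrix (Fin 8 ⊕ Fin 8) (Fin 8 ⊕ Fin 8) (ZMod 2)}
    (h : PreservesFold M) (h' : PreservesFold M') : PreservesFold (M * M') := by
  have key : foldNilpotent * (M * M') * foldNilpotent =
      foldNilpotent * M * foldNilpotent * foldHomotopy * M' * foldNilpotent +
        foldNilpotent * M * foldHomotopy * (foldNilpotent * M' * foldNilpotent) := by
    -- Inserting 1 = Nh + hN between M and M' makes a factor N M N or N M' N appear in each summand.
    conv_lhs => rw [← Matrix.mul_one M, ← foldNilpotent_homotopy]
    simp only [mul_add, add_mul, Matrix.mul_assoc]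
  rw [PreservesFold, key, h, h']
  simp

/-- In a finite group the generated subgroup is the generated monoid, so closure under products
suffices. -/
theorem preservesFold_of_mem_closure {S : Set (Matrix.symplecticGroup (Fin 8) (ZMod 2))}
    (hS : ∀ M ∈ S, PreservesFold M.1) {M : Matrix.symplecticGroup (Fin 8) (ZMod 2)}
    (hM : M ∈ Subgroup.closure S) : PreservesFold M.1 := by
  have : Finite (Matrix.symplecticGroup (Fin 8) (ZMod 2)) := Subtype.finite
  rw [← Subgroup.mem_toSubmonoid, Subgroup.closure_toSubmonoid_of_finite] at hM
  induction hM using Submonoid.closure_induction with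
  | mem M hM => exact hS M hM
  | one =>
    change PreservesFold 1
    decide +kernel
  | mul M N _ _ hM hN => exact hM.mul hN

theorem preservesFold_physical {M : Matrix.symplecticGroup (Fin 8) (ZMod 2)}
    (hM : M ∈ physicalSymplectic) : PreservesFold M.1 := by
  rcases hM with rfl | rfl | rfl | rfl | rfl <;> decide +kernel

theorem preservesFold_cz {i j : Fin 8}
    (h : s(i, j) ∈ ({s(0, 4), s(2, 3), s(5, 7)} : Set (Sym2 (Fin 8)))) :
    PreservesFold (czSymplectic i j).1 := by
  simp only [Set.mem_insert_iff, Set.mem_singleton_iff, Sym2.eq_iff] at h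
  rcases h with (⟨rfl, rfl⟩ | ⟨rfl, rfl⟩) | (⟨rfl, rfl⟩ | ⟨rfl, rfl⟩) | ⟨rfl, rfl⟩ | ⟨rfl, rfl⟩ <;>
    decide +kernel

/-- A witness that the invariant subspace is not preserved by the whole symplectic group. -/
theorem not_preservesFold_cnot : ¬ PreservesFold (cnotSymplectic 0 1 (by decide)).1 := by
  decide +kernel

theorem closure_insert_cz_ne_top {i j : Fin 8}
    (h : s(i, j) ∈ ({s(0, 4), s(2, 3), s(5, 7)} : Set (Sym2 (Fin 8)))) :
    Subgroup.closure (insert (czSymplectic i j) physicalSymplectic) ≠ ⊤ := by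
  intro htop
  refine not_preservesFold_cnot (preservesFold_of_mem_closure
    (S := insert (czSymplectic i j) physicalSymplectic) ?_ (htop ▸ Subgroup.mem_top _))
  rintro M (rfl | hM)
  exacts [preservesFold_cz h, preservesFold_physical hM]

end Invariant

end BringCode

open BringCode

theorem mainTheorem8 :
    (∃ A : Finset (Fin 30), IsEncodedLogicalGate (phaseGate tau0 A)) ∧
    ∀ A : Finset (Fin 30), IsEncodedLogicalGate (phaseGate tau0 A) →
      (∀ g : Operator (Fin 8),
        ((∃ i j : Fin 8, i ≠ j ∧ g = cnot i j) ∨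
          (∃ i j : Fin 8, i ≠ j ∧ s(i, j) ∉ ({s(0, 4), s(2, 3), s(5, 7)} : Set (Sym2 (Fin 8))) ∧
            g = cz i j)) →
        Subgroup.closure (symplecticImages (logicalGates A g)) = ⊤ ∧
        Subgroup.closure (logicalGates A g) ⊔ pauliGroup (Fin 8) ⊔ phaseGroup (Fin 8) =
          cliffordGroup (Fin 8)) ∧
      (∀ i j : Fin 8, s(i, j) ∈ ({s(0, 4), s(2, 3), s(5, 7)} : Set (Sym2 (Fin 8))) →
        Subgroup.closure (symplecticImages (logicalGates A (cz i j))) ≠ ⊤) := by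
  refine ⟨exists_isEncodedLogicalGate, fun A hA => ⟨fun g hg => ?_, fun i j hij => ?_⟩⟩
  -- Both kinds of gate enter only through a unitary and its symplectic image that completes a
  -- generating set.
  · obtain ⟨U, N, rfl, hU, hN⟩ : ∃ (U : UnitaryOp (Fin 8))
        (N : Matrix.symplecticGroup (Fin 8) (ZMod 2)), g = U ∧ IsSymplecticImage U N ∧
          Subgroup.closure (insert N physicalSymplectic) = ⊤ := by
      rcases hg with ⟨i, j, hij, rfl⟩ | ⟨i, j, hij, h, rfl⟩
      · exact ⟨_, _, (coe_cnotUnitary hij).symm, isSymplecticImage_cnot hij,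
          closure_insert_cnot_eq_top hij⟩
      · exact ⟨_, _, (coe_czUnitary i j).symm, isSymplecticImage_cz i j,
          closure_insert_cz_eq_top hij h⟩
    have h := (congrArg Subgroup.closure (symplecticImages_logicalGates hA hU)).trans hN
    exact ⟨h, closure_sup_eq_cliffordGroup (logicalGates_subset_cliffordGroup hA hU) h⟩
  · rw [← coe_czUnitary, symplecticImages_logicalGates hA (isSymplecticImage_cz i j)]
    exact closure_insert_cz_ne_top hij
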